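/- \textbf{Setting.} Let $S$ be a disk with two punctures $P,Q$ and $b=n-2\ge 1$ marked points on the boundary, labelled $1,\dots,b$ counterclockwise (indices modulo $b$). Let $T$ be a triangulation of $S$ (self-folded triangles allowed) containing no peripheral arc, i.e. no arc homotopic to a concatenation of boundary segments. Let $p$ and $q$ be the numbers of ends of arcs of $T$ at $P$ and at $Q$ (a loop counts twice). \textbf{The annulus.} A triangulated annulus $T'$, with outer marked points $1,\dots,b$, and a number $a$ are associated to $T$ as follows. (I) Suppose that no arc of $T$ joins $P$ and $Q$. Let $\gamma$ be the simple curve from $P$ to $Q$ in minimal position with respect to $T$, with no triangle visited twice. Cut $S$ along $\gamma$. Each crossed arc is cut into two arcs, ending on the new (inner) boundary. Each triangle crossed by $\gamma$ through two of its sides is cut into a triangle and a quadrilateral, and in the quadrilateral the side on $\gamma$ is contracted to a point. The first and the last triangle met by $\gamma$ are each cut into two triangles. The result is $T'$. Let $\gamma',\gamma''$ be the two peripheral arcs of the annulus from $P$ to $Q$ along the two sides of the cut. For $\delta\in\{\gamma',\gamma''\}$ let $M(\delta)$ be the string module over a field $k$: the representation of the quiver of $T'$ with one copy of $k$ at each arc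 of $T'$ crossed by $\delta$, the identity for each angle crossed by $\delta$, and zero elsewhere. Let $\rho$ denote the number of submodules, and put $a=\rho(M(\gamma'))$. (II) Suppose that an arc of $T$ joins $P$ and $Q$, and that both punctures are also joined to the boundary by arcs of $T$. Then $T'$ is obtained by cutting $S$ along the arc $PQ$; put $a=1$. (III) Suppose that an arc of $T$ joining $P$ and $Q$ is the radius of a self-folded triangle. Then $T'$ is obtained by removing that triangle; put $a=1$. The quiddity sequence $(a_1,\dots,a_b)$ of the outer boundary of $T'$ is given by the numbers $a_i$ of triangles locally incident with $i$. An \emph{infinite frieze} is a staggered array of integers with rows $-1,0,1,2,\dots$ in which row $-1$ consists of $0$s, row $0$ of $1$s, all later entries are positive, and every diamond with left, top, right, bottom entries $x,y,z,t$ satisfies $xz-yt=1$. Its row $1$ is the quiddity sequence, repeated with period $b$. \textbf{Proposition.} For every such $T$ at least one of the cases (I)--(III) applies, and in case (I) a curve $\gamma$ as described exists. For every $T'$ so obtained: (1) for each $i$, the number $a_i$ equals the number of triangles of $T$ locally incident with $i$; (2) in case (I), $\rho(M(\gamma'))=\rho(M(\gamma''))=a$; (3) there is exactly one infinite frieze with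 quiddity sequence $(a_1,\dots,a_b)$; (4) its growth coefficient is $a^2pq-2$: for every entry of row $b$, the difference between it and the entry two rows above it, in row $b-2$, equals $$s(a_1,\dots,a_b)=a^2pq-2 .$$ -/

import Mathlib

universe u v w

/-! ### Triangulated oriented surfaces, as triangles glued along their sides -/

/-- A triangulated oriented surface with boundary, given by gluing oriented triangles along sides.
`D` is the set of all sides of all triangles; every side is oriented so that its triangle lies on
its left (counterclockwise around the triangle). `next x` is the side following `x` in its triangle.
`glue x` is the side (of another or of the same triangle) to which `x` is glued, orientations being
reversed; `glue x = x` means that `x` is a boundary segment. Two sides of one triangle may be glued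
to each other (self-folded triangle), and different corners of a triangle may be the same point. -/
structure TriangulatedSurface (D : Type u) where
  next : D → D
  glue : D → D
  next_ne : ∀ x, next x ≠ x
  next_next_next : ∀ x, next (next (next x)) = x
  glue_glue : ∀ x, glue (glue x) = x

namespace TriangulatedSurface

variable {D : Type u} (T : TriangulatedSurface D)

/-- The side preceding `x` in its triangle. -/
def prev (x : D) : D := T.next (T.next x)

/-- `x` and `y` are sides of the same triangle. -/
def SameTriangle (x y : D) : Prop := y = x ∨ y = T.next x ∨ y = T.prev x

/-- The triangles. -/
def Triangle : Type u := Quot fun x y : D => y = T.next x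

/-- The edges: arcs and boundary segments. -/
def Edge : Type u := Quot fun x y : D => y = T.glue x

/-- The edge of which `x` is a side. -/
def edge (x : D) : T.Edge := Quot.mk _ x

/-- The vertices (marked points). The corner at the starting point of `x` is represented by `x`;
crossing the glued side `x`, the next corner at the same point is that of `next (glue x)`. -/
def Vertex : Type u := Quot fun x y : D => T.glue x ≠ x ∧ y = T.next (T.glue x)

/-- The starting point of the side `x`; its end point is `T.origin (T.next x)`, and the vertex of
its triangle opposite to `x` is `T.origin (T.prev x)`. -/
def origin (x : D) : T.Vertex := Quot.mk _ x

/-- `v` lies on the boundary. (Each boundary vertex is the start of a boundary segment.) -/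
def IsBoundaryVertex (v : T.Vertex) : Prop := ∃ x, T.glue x = x ∧ T.origin x = v

/-- The number of triangle corners at `v`, i.e. of regions in a small neighbourhood of `v`. At an
interior vertex this is also the number of ends of arcs at `v` (a loop at `v` has two ends). -/
noncomputable def cornerCount (v : T.Vertex) : ℕ := Nat.card {x : D // T.origin x = v}

/-- Connectedness of the surface. -/
def IsConnected : Prop :=
  Nonempty D ∧ ∀ S : Set D, S.Nonempty → (∀ x ∈ S, T.next x ∈ S ∧ T.glue x ∈ S) → S = Set.univ

/-- The Euler characteristic. -/
noncomputable def eulerChar : ℤ :=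
  (Nat.card T.Vertex : ℤ) - Nat.card T.Edge + Nat.card T.Triangle

/-- `T` triangulates a disk with exactly two punctures `P`, `Q` and with `b` marked points on the
boundary: it is connected, has Euler characteristic `1` and one boundary component, and its
interior vertices are exactly `P` and `Q`. The boundary segments are `bd i`, `i ∈ ℤ/b`, in
counterclockwise order; the boundary marked point `i` is the starting point of `bd i`. -/
structure IsTwicePuncturedDisk {b : ℕ} (bd : ZMod b → D) (P Q : T.Vertex) : Prop where
  connected : T.IsConnected
  euler : T.eulerChar = 1
  bd_injective : Function.Injective bd
  range_bd : Set.range bd = {x | T.glue x = x}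
  bd_succ : ∀ i, T.origin (bd (i + 1)) = T.origin (T.next (bd i))
  punctures_ne : P ≠ Q
  interior_iff : ∀ v, ¬ T.IsBoundaryVertex v ↔ v = P ∨ v = Q

/-- The arc with side `x` is peripheral (homotopic to a concatenation of boundary segments): on the
side of `x` it cuts off a part `S` of the surface all of whose vertices lie on the boundary (on a
disk, such a part is an unpunctured polygon). -/
def IsPeripheral (x : D) : Prop :=
  T.glue x ≠ x ∧ ∃ S : Set D, x ∈ S ∧ T.glue x ∉ S ∧ (∀ y ∈ S, T.next y ∈ S) ∧
    (∀ y ∈ S, y ≠ x → T.glue y ∈ S) ∧ ∀ y ∈ S, T.IsBoundaryVertex (T.origin y)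

/-! ### The quiver of a triangulation without punctures, and string modules -/

/-- The arcs: edges which are not boundary segments. -/
def Arc : Type u := {e : T.Edge // ∃ x, T.glue x ≠ x ∧ T.edge x = e}

/-- The quiver of a triangulation without self-folded triangles: vertices are the arcs, and each
angle of a triangle formed by two arcs gives an arrow to the arc that is clockwise from the other.
The angle at the start of `x` lies between `T.prev x` and `x`, and `x` is clockwise from
`T.prev x`. -/
instance : Quiver T.Arc where
  Hom α β := {x : D // T.edge (T.prev x) = α.1 ∧ T.edge x = β.1}

end TriangulatedSurface

section Representations

variable (k : Type v) [Field k] {V : Type u} [Quiver.{w} V]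

/-- The number of subrepresentations of a representation `M` of the quiver `V` over `k`. -/
noncomputable def numSubrep (M : V ⥤q ModuleCat.{v} k) : ℕ :=
  Nat.card {W : ∀ v : V, Submodule k (M.obj v) //
    ∀ (v w : V) (f : v ⟶ w), ∀ m ∈ W v, (M.map f).hom m ∈ W w}

/-- The one-dimensional space `k` if `v ∈ S`, and `0` otherwise. -/
def thinSpace {V : Type u} (S : Set V) (v : V) : Submodule k k where
  carrier := {c | v ∉ S → c = 0}
  zero_mem' := fun _ => rfl
  add_mem' := fun {a b} ha hb h => by rw [ha h, hb h, add_zero]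
  smul_mem' := fun c a ha h => by rw [ha h, smul_zero]

open Classical in
/-- The map of thin spaces which is the identity of `k` if `A` holds (and both spaces are `k`), and
`0` otherwise. -/
noncomputable def thinMap {V : Type u} (S : Set V) (v w : V) (A : Prop) :
    thinSpace k S v →ₗ[k] thinSpace k S w where
  toFun c := ⟨if A ∧ w ∈ S then c.1 else 0, fun h => by simp [h]⟩
  map_add' c d := by
    apply Subtype.ext
    by_cases h : A ∧ w ∈ S <;> simp [h]
  map_smul' r c := by
    apply Subtype.ext
    by_cases h : A ∧ w ∈ S <;> simp [h]

/-- The representation of the quiver `V` defined by a subquiver with vertex set `S` and set of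
arrows `A`: one copy of `k` at each vertex in `S` and the identity for each arrow in `A`; all other
spaces and maps are zero. -/
noncomputable def subquiverModule (S : Set V) (A : ∀ v w : V, (v ⟶ w) → Prop) :
    V ⥤q ModuleCat.{v} k where
  obj v := ModuleCat.of k (thinSpace k S v)
  map {v w} f := ModuleCat.ofHom (thinMap k S v w (A v w f))

end Representations

namespace TriangulatedSurface

variable {D : Type u} (T : TriangulatedSurface D)

/-- The string module of a curve crossing exactly the arcs with sides in `C`, each of them once:
its vertices are these arcs, its arrows the angles crossed by the curve, i.e. the angles both of
whose sides are in `C`. -/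
noncomputable def stringModule (k : Type v) [Field k] (C : Set D) : T.Arc ⥤q ModuleCat.{v} k :=
  subquiverModule k {α | ∃ x ∈ C, T.edge x = α.1} fun _ _ f => f.1 ∈ C ∧ T.prev f.1 ∈ C

end TriangulatedSurface

/-! ### The annulus of a triangulated twice-punctured disk -/

/-- A triangulated surface with a choice of `b` segments of its outer boundary and, for the two
peripheral curves along the inner boundary (`γ'` for `true`, `γ''` for `false`), the sets of sides
of the arcs which they cross. -/
structure CutSurface (b : ℕ) where
  Side : Type u
  surf : TriangulatedSurface Side
  outer : ZMod b → Side
  crossed : Bool → Set Side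

namespace CutSurface

/-- The quiddity sequence of the outer boundary: the number of triangles locally incident with the
outer marked point `i`. -/
noncomputable def quiddity {b : ℕ} (A : CutSurface.{u} b) (i : ZMod b) : ℕ :=
  A.surf.cornerCount (A.surf.origin (A.outer i))

/-- `ρ(M(γ'))` for `s = true` and `ρ(M(γ''))` for `s = false`. -/
noncomputable def rho {b : ℕ} (A : CutSurface.{u} b) (k : Type v) [Field k] (s : Bool) : ℕ :=
  numSubrep k (A.surf.stringModule k (A.crossed s))

end CutSurface

namespace TriangulatedSurface

variable {D : Type u} (T : TriangulatedSurface D)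

/-- A curve from `P` to `Q` without self-crossings, in minimal position to the arcs of `T`: it
starts at a corner `P` of a first triangle and leaves that triangle through the opposite side
`side 0`; it leaves the successive triangles through `side 0`, …, `side m`, entering the following
triangle through the glued side and leaving it through one of its two other sides; it ends at the
corner `Q`, opposite to the entered side, of the last triangle. No triangle is visited twice. -/
structure CrossingCurve (P Q : T.Vertex) where
  m : ℕ
  side : Fin (m + 1) → D
  start : T.origin (T.prev (side 0)) = P
  glued : ∀ i, T.glue (side i) ≠ side i
  step : ∀ i : Fin m, side i.succ = T.next (T.glue (side i.castSucc)) ∨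
    side i.succ = T.prev (T.glue (side i.castSucc))
  finish : T.origin (T.prev (T.glue (side (Fin.last m)))) = Q
  distinct : ∀ i j, i ≠ j → ¬ T.SameTriangle (side i) (side j)
  distinct_last : ∀ i, ¬ T.SameTriangle (side i) (T.glue (side (Fin.last m)))

namespace CrossingCurve

variable {T} {P Q : T.Vertex} (c : T.CrossingCurve P Q)

/-- `x` is a side of an arc crossed by the curve. -/
def Crosses (x : D) : Prop := ∃ i, x = c.side i ∨ x = T.glue (c.side i)

/-- The triangle of `x` is traversed by the curve. -/
def Visits (x : D) : Prop := ∃ y, c.Crosses y ∧ T.SameTriangle y x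

open Classical in
/-- `true` if `x` is an uncrossed side lying to the left of the curve in a visited triangle. -/
noncomputable def isLeft (x : D) : Bool :=
  decide (∃ i, x = T.next (c.side i) ∨ x = T.prev (T.glue (c.side i)))

/-- The sides of the triangles of the annulus: a visited triangle gives two triangles, a copy on
the left (`true`) and a copy on the right (`false`) of the curve; the others are kept. -/
def CutSide : Type u := {d : D × Bool // c.Visits d.1 ∨ d.2 = false}

theorem visits_next {x : D} (h : c.Visits x) : c.Visits (T.next x) := by
  obtain ⟨y, hy, rfl | rfl | rfl⟩ := h
  · exact ⟨x, hy, Or.inr (Or.inl rfl)⟩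
  · exact ⟨y, hy, Or.inr (Or.inr rfl)⟩
  · exact ⟨y, hy, Or.inl (T.next_next_next y)⟩

theorem crosses_glue {x : D} (h : c.Crosses x) : c.Crosses (T.glue x) := by
  obtain ⟨i, rfl | rfl⟩ := h
  · exact ⟨i, Or.inr rfl⟩
  · exact ⟨i, Or.inl (T.glue_glue _)⟩

theorem crosses_glue_iff {x : D} : c.Crosses (T.glue x) ↔ c.Crosses x :=
  ⟨fun h => by simpa [T.glue_glue] using c.crosses_glue h, c.crosses_glue⟩

theorem visits_or (x : D) : c.Visits x ∨ c.isLeft x = false := by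
  by_cases h : c.isLeft x = true
  · left
    simp only [isLeft, decide_eq_true_eq] at h
    obtain ⟨i, hi | hi⟩ := h
    · exact ⟨c.side i, ⟨i, Or.inl rfl⟩, Or.inr (Or.inl hi)⟩
    · exact ⟨T.glue (c.side i), ⟨i, Or.inr rfl⟩, Or.inr (Or.inr hi)⟩
  · right
    simpa using h

/-- The copy of the uncrossed side `x` in the piece of its triangle which contains it. -/
noncomputable def keep (x : D) : c.CutSide := ⟨(x, c.isLeft x), c.visits_or x⟩

open Classical in
/-- The gluing of the annulus. A crossed side is cut into two halves, each glued to the half of the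
glued side on the same side of the curve. An uncrossed side `x` is glued as before. The other copy
of an uncrossed side of a visited triangle stands for a segment of the inner boundary. -/
noncomputable def cutGlue (d : c.CutSide) : c.CutSide :=
  if h : c.Crosses d.1.1 then
    ⟨(T.glue d.1.1, d.1.2), Or.inl ⟨T.glue d.1.1, c.crosses_glue h, Or.inl rfl⟩⟩
  else if d.1.2 = c.isLeft d.1.1 then c.keep (T.glue d.1.1) else d

/-- The surface obtained by cutting along the curve. A visited triangle is cut by the curve into
pieces; in a triangle with two crossed sides, these are a triangle having one side on the curve
and a quadrilateral, whose side on the curve is contracted to a point, and which becomes a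
triangle. -/
noncomputable def cut : TriangulatedSurface c.CutSide where
  next d := ⟨(T.next d.1.1, d.1.2), d.2.imp c.visits_next id⟩
  glue := c.cutGlue
  next_ne d h := T.next_ne d.1.1 (congrArg (fun e : c.CutSide => e.1.1) h)
  next_next_next d := Subtype.ext (Prod.ext (T.next_next_next d.1.1) rfl)
  glue_glue d := by
    obtain ⟨⟨x, s⟩, hd⟩ := d
    apply Subtype.ext
    by_cases h : c.Crosses x
    · simp [cutGlue, h, c.crosses_glue h, T.glue_glue]
    · by_cases hs : s = c.isLeft x
      · subst hs
        simp [cutGlue, h, c.crosses_glue_iff, T.glue_glue, keep]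
      · simp [cutGlue, h, hs]

/-- Cutting along the curve, with the outer boundary and the curves `γ'`, `γ''` which run along the
inner boundary, on the left and on the right of the curve, and so cross the left and the right
halves of the crossed arcs. -/
noncomputable def cutSurface {b : ℕ} (bd : ZMod b → D) : CutSurface.{u} b where
  Side := c.CutSide
  surf := c.cut
  outer i := c.keep (bd i)
  crossed s := {d | c.Crosses d.1.1 ∧ d.1.2 = s}

end CrossingCurve

open Classical in
/-- Cutting along the arc with side `x`: its two sides become boundary segments. -/
noncomputable def unglue (x : D) : TriangulatedSurface D where
  next := T.next
  glue y := if y = x ∨ y = T.glue x then y else T.glue y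
  next_ne := T.next_ne
  next_next_next := T.next_next_next
  glue_glue y := by
    by_cases h : y = x ∨ y = T.glue x
    · simp [h]
    · have h' : ¬ (T.glue y = x ∨ T.glue y = T.glue x) := by
        rintro (e | e)
        · exact h (Or.inr (by rw [← e, T.glue_glue]))
        · exact h (Or.inl (by rw [← T.glue_glue y, e, T.glue_glue]))
      simp [h, h', T.glue_glue]

theorem sameTriangle_of_next {x y : D} (h : T.SameTriangle x (T.next y)) : T.SameTriangle x y := by
  have e : y = T.prev (T.next y) := (T.next_next_next y).symm
  rcases h with h | h | h <;> rw [h] at e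
  · exact Or.inr (Or.inr e)
  · exact Or.inl (e.trans (T.next_next_next x))
  · exact Or.inr (Or.inl (e.trans (by simp only [prev, T.next_next_next])))

open Classical in
/-- Removing the triangle with side `x`: the sides glued to its sides become boundary segments. -/
noncomputable def removeTriangle (x : D) : TriangulatedSurface {y : D // ¬ T.SameTriangle x y} where
  next y := ⟨T.next y.1, fun h => y.2 (T.sameTriangle_of_next h)⟩
  glue y := if h : ¬ T.SameTriangle x (T.glue y.1) then ⟨T.glue y.1, h⟩ else y
  next_ne y h := T.next_ne y.1 (congrArg Subtype.val h)
  next_next_next y := Subtype.ext (T.next_next_next y.1)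
  glue_glue y := by
    apply Subtype.ext
    by_cases h : T.SameTriangle x (T.glue y.1)
    · simp [h]
    · simp [h, T.glue_glue, y.2]

/-- `A` is the triangulated annulus associated with the triangulation `T` of the twice-punctured
disk with boundary segments `bd` and punctures `P`, `Q`. In the last two cases `γ'` and `γ''` run
along the inner boundary and cross no arc, so their modules are zero. -/
inductive IsAssociatedAnnulus {b : ℕ} (bd : ZMod b → D) (P Q : T.Vertex) :
    CutSurface.{u} b → Prop
  /-- No arc joins `P` and `Q`: cut along the curve from `P` to `Q`. -/
  | noArc (h : ¬ ∃ x, T.origin x = P ∧ T.origin (T.next x) = Q) (c : T.CrossingCurve P Q) :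
      IsAssociatedAnnulus bd P Q (c.cutSurface bd)
  /-- An arc with side `x` joins `P` and `Q`, and both punctures are joined to the boundary:
  cut along this arc. -/
  | arc (x : D) (hP : T.origin x = P) (hQ : T.origin (T.next x) = Q)
      (hP' : ∃ y, T.origin y = P ∧ T.IsBoundaryVertex (T.origin (T.next y)))
      (hQ' : ∃ y, T.origin y = Q ∧ T.IsBoundaryVertex (T.origin (T.next y))) :
      IsAssociatedAnnulus bd P Q
        { Side := D, surf := T.unglue x, outer := bd, crossed := fun _ => ∅ }
  /-- An arc joining `P` and `Q` is the radius, with sides `x` and `T.next x`, of a self-folded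
  triangle: cut out this triangle. -/
  | selfFolded (x : D) (hx : T.glue x = T.next x)
      (hPQ : (T.origin x = P ∧ T.origin (T.next x) = Q) ∨
        (T.origin x = Q ∧ T.origin (T.next x) = P))
      (hbd : ∀ i, ¬ T.SameTriangle x (bd i)) :
      IsAssociatedAnnulus bd P Q
        { Side := {y : D // ¬ T.SameTriangle x y}, surf := T.removeTriangle x,
          outer := fun i => ⟨bd i, hbd i⟩, crossed := fun _ => ∅ }

end TriangulatedSurface

/-! ### Infinite friezes -/

/-- An infinite frieze with its rows indexed so that `F 0` is the row of `0`s, `F 1` the row of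
`1`s and `F 2` the quiddity row (in the usual numbering these are the rows `-1`, `0` and `1`).
In the staggered array, `F (r + 1) i` and `F (r + 1) (i + 1)` are neighbours, `F r (i + 1)` is
above and between them, and `F (r + 2) i` is below and between them. -/
structure IsInfiniteFrieze (F : ℕ → ℤ → ℤ) : Prop where
  row_zero : ∀ i, F 0 i = 0
  row_one : ∀ i, F 1 i = 1
  pos : ∀ r i, 0 < F (r + 2) i
  diamond : ∀ r i, F (r + 1) i * F (r + 1) (i + 1) - F r (i + 1) * F (r + 2) i = 1

/-- `F` is an infinite frieze with quiddity sequence `a` of length `b`. -/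
def IsFriezeOf {b : ℕ} (a : ZMod b → ℕ) (F : ℕ → ℤ → ℤ) : Prop :=
  IsInfiniteFrieze F ∧ ∀ i : ℤ, F 2 i = (a (i : ZMod b) : ℤ)

/-- The growth coefficient of `F`, for a quiddity sequence of length `b`, is `s`: the difference
between any entry in row `b` and the entry above it in row `b - 2`, in the usual numbering of rows
(where row `-1` is the row of `0`s), equals `s`. -/
def HasGrowthCoefficient (F : ℕ → ℤ → ℤ) (b : ℕ) (s : ℤ) : Prop :=
  ∀ i : ℤ, F (b + 1) i - F (b - 1) (i + 1) = s

/-! ### Corners around a vertex and the permutation running through them. -/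

namespace TriangulatedSurface

variable {D : Type u} (T : TriangulatedSurface D)

/-! The growth coefficient is a trace. If all quiddity entries are at least 2, the continuants form
the only frieze, and its growth coefficient is the trace of the product of the matrices
`continuantMatrix (a i)` over one period. Entries are at least 2 because there is no peripheral arc
(`two_le_cornerCount`), and passing to the annulus does not change the corners at boundary vertices
(`cornerCount_cut`, `cornerCount_unglue`, `cornerCount_removeTriangle`). So one trace has to be
computed, inside `T`.

Write U for `cornerMatrix` and S for `segmentMatrix`. Since U^n S is `continuantMatrix n`, the
product is a word with one U per corner and one S per boundary segment; `rot` runs through the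
boundary corners in a single cycle. The trace does not depend on the starting corner, so the word
may be regrouped by triangles instead of by boundary vertices.

The geometry of the disk comes from a dimension count modulo two (`exists_arcBoundary_eq`): a loop,
or an arc with both ends on the boundary, separates the surface. Without peripheral arcs, an arc of
the second kind separates P from Q, and a loop at a puncture bounds a self-folded triangle. Hence in
case (I) exactly one corner at each puncture is opposite to an arc, the other corners there are
opposite to boundary segments, and every intermediate triangle crossed by the curve has a boundary
segment as its third side.

A triangle in the star of a puncture contributes UUS, which is `starMatrix`, a unipotent matrix. A
triangle crossed by the curve contributes U or USU, the two elementary matrices, according to the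
turn. If R is their product along one side of the curve, the way back along the other side gives the
transpose of R. Up to cyclic order the word is R A_q Rᵗ A_p, where A_n = `starMatrix`^(n-1) U² = J +
nE, with J = [[0,1],[-1,0]] and E the matrix of ones. As det R = 1, R J Rᵗ = J; the terms linear in
p or q vanish, tr J² = -2, and what remains is a²pq - 2 with a the sum of the entries of R
(`trace_two_stars`). In cases (II) and (III) the same walk gives shorter words with trace pq - 2.

Finally, the string modules of both peripheral curves are thin modules on a zigzag whose arrows are
given by the turns. Their submodules are the sets of indices closed under the arrows, and the
elementary matrices are the transfer matrices counting these sets, so both counts equal a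
(`numSubrep_cut`). -/

theorem prev_next (x : D) : T.prev (T.next x) = x := T.next_next_next x

theorem next_prev (x : D) : T.next (T.prev x) = x := T.next_next_next x

theorem prev_prev (x : D) : T.prev (T.prev x) = T.next x := by
  simp only [prev, T.next_next_next]

theorem next_next (x : D) : T.next (T.next x) = T.prev x := rfl

theorem next_inj {x y : D} : T.next x = T.next y ↔ x = y :=
  ⟨fun h => by rw [← T.prev_next x, h, T.prev_next], fun h => by rw [h]⟩

theorem prev_inj {x y : D} : T.prev x = T.prev y ↔ x = y :=
  ⟨fun h => by rw [← T.next_prev x, h, T.next_prev], fun h => by rw [h]⟩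

theorem glue_inj {x y : D} : T.glue x = T.glue y ↔ x = y :=
  ⟨fun h => by rw [← T.glue_glue x, h, T.glue_glue], fun h => by rw [h]⟩

theorem prev_ne (x : D) : T.prev x ≠ x := fun h => T.next_ne x (by
  conv_lhs => rw [← h]
  rw [T.next_prev])

theorem prev_ne_next (x : D) : T.prev x ≠ T.next x := T.next_ne (T.next x)

theorem next_eq_iff {x y : D} : T.next x = y ↔ x = T.prev y :=
  ⟨fun h => by rw [← h, T.prev_next], fun h => by rw [h, T.next_prev]⟩

theorem glue_eq_iff {x y : D} : T.glue x = y ↔ x = T.glue y :=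
  ⟨fun h => by rw [← h, T.glue_glue], fun h => by rw [h, T.glue_glue]⟩

theorem glue_glue_ne {x : D} (h : T.glue x ≠ x) : T.glue (T.glue x) ≠ T.glue x := by
  rw [T.glue_glue]; exact h.symm

theorem sameTriangle_refl (x : D) : T.SameTriangle x x := Or.inl rfl

variable {T} in
theorem SameTriangle.symm {x y : D} (h : T.SameTriangle x y) : T.SameTriangle y x := by
  rcases h with rfl | rfl | rfl
  · exact Or.inl rfl
  · exact Or.inr (Or.inr (T.prev_next x).symm)
  · exact Or.inr (Or.inl (T.next_prev x).symm)

variable {T} in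
theorem SameTriangle.next {x y : D} (h : T.SameTriangle x y) : T.SameTriangle x (T.next y) := by
  rcases h with rfl | rfl | rfl
  · exact Or.inr (Or.inl rfl)
  · exact Or.inr (Or.inr rfl)
  · exact Or.inl (T.next_prev x)

variable {T} in
theorem SameTriangle.prev {x y : D} (h : T.SameTriangle x y) : T.SameTriangle x (T.prev y) :=
  h.next.next

variable {T} in
theorem SameTriangle.trans {x y z : D} (h : T.SameTriangle x y) (h' : T.SameTriangle y z) :
    T.SameTriangle x z := by
  rcases h' with rfl | rfl | rfl
  exacts [h, h.next, h.prev]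

/-- The permutation of corners taking a corner to the next one at the same vertex, and the last
corner at a boundary vertex to the first one at the following boundary vertex. -/
def rot : Equiv.Perm D where
  toFun x := T.next (T.glue x)
  invFun x := T.glue (T.prev x)
  left_inv x := by simp only [T.prev_next, T.glue_glue]
  right_inv x := by simp only [T.glue_glue, T.next_prev]

theorem rot_apply (x : D) : T.rot x = T.next (T.glue x) := rfl

theorem rot_symm_apply (x : D) : T.rot.symm x = T.glue (T.prev x) := rfl

theorem origin_rot {x : D} (h : T.glue x ≠ x) : T.origin (T.rot x) = T.origin x :=
  (Quot.sound ⟨h, rfl⟩ : T.origin x = T.origin (T.rot x)).symm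

theorem origin_next_glue {x : D} (h : T.glue x ≠ x) : T.origin (T.next (T.glue x)) = T.origin x :=
  T.origin_rot h

theorem origin_glue {x : D} (h : T.glue x ≠ x) : T.origin (T.glue x) = T.origin (T.next x) := by
  have := T.origin_next_glue (T.glue_glue_ne h)
  rw [T.glue_glue] at this
  exact this.symm

/-- Equality of vertices is generated by single steps of `rot` across glued sides, so a property
preserved in both directions by these steps holds at all corners of a vertex or at none. This is how
local facts are carried around a vertex. -/
theorem mem_iff_of_origin_eq {S : Set D} {x y : D} (h : T.origin x = T.origin y)
    (hS : ∀ z, T.origin z = T.origin x → T.glue z ≠ z → (z ∈ S ↔ T.rot z ∈ S)) :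
    x ∈ S ↔ y ∈ S := by
  have key : ∀ a b : D, Relation.EqvGen (fun x y : D => T.glue x ≠ x ∧ y = T.next (T.glue x)) a b →
      T.origin a = T.origin b ∧ (T.origin a = T.origin x → (a ∈ S ↔ b ∈ S)) := by
    intro a b hab
    induction hab with
    | rel a b hab =>
      obtain ⟨h1, rfl⟩ := hab
      exact ⟨(T.origin_rot h1).symm, fun h2 => hS a h2 h1⟩
    | refl a => exact ⟨rfl, fun _ => Iff.rfl⟩
    | symm a b _ ih => exact ⟨ih.1.symm, fun h2 => (ih.2 (ih.1.trans h2)).symm⟩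
    | trans a b c _ _ ih1 ih2 =>
      exact ⟨ih1.1.trans ih2.1, fun h2 => (ih1.2 h2).trans (ih2.2 (ih1.1.symm.trans h2))⟩
  exact (key x y (Quot.eqvGen_exact h)).2 rfl

theorem sameCycle_of_origin_eq {x y : D} (h : T.origin x = T.origin y) : T.rot.SameCycle x y :=
  (T.mem_iff_of_origin_eq (S := {z | T.rot.SameCycle x z}) h fun _ _ _ =>
    (Equiv.Perm.sameCycle_apply_right).symm).1 (Equiv.Perm.SameCycle.refl _ _)

/-- The fan of corners from `x` on ends at the boundary segment `y`, after `n` steps. -/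
def FanEnds (x y : D) (n : ℕ) : Prop :=
  T.rot^[n] x = y ∧ T.glue y = y ∧ ∀ j < n, T.glue (T.rot^[j] x) ≠ T.rot^[j] x

variable {T}

theorem FanEnds.zero {y : D} (hy : T.glue y = y) : T.FanEnds y y 0 :=
  ⟨rfl, hy, fun _ h => absurd h (Nat.not_lt_zero _)⟩

theorem fanEnds_rot_iff {x y : D} {n : ℕ} (hx : T.glue x ≠ x) :
    T.FanEnds (T.rot x) y n ↔ T.FanEnds x y (n + 1) := by
  constructor
  · rintro ⟨h1, h2, h3⟩
    refine ⟨h1, h2, fun j hj => ?_⟩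
    cases j with
    | zero => exact hx
    | succ j => exact h3 j (by omega)
  · rintro ⟨h1, h2, h3⟩
    exact ⟨h1, h2, fun j hj => h3 (j + 1) (by omega)⟩

/-- A step across a glued side only changes the length of the fan by one, so all corners of a
boundary vertex run into the same segment. -/
theorem FanEnds.exists_of_origin_eq {x x' y : D} (h : T.origin x = T.origin x')
    (hx : ∃ n, T.FanEnds x y n) : ∃ n, T.FanEnds x' y n := by
  refine (T.mem_iff_of_origin_eq (S := {z | ∃ n, T.FanEnds z y n}) h fun z _ hz => ?_).1 hx
  constructor
  · rintro ⟨n, hn⟩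
    cases n with
    | zero => exact absurd hn.2.1 (by rw [← hn.1]; exact hz)
    | succ n => exact ⟨n, (fanEnds_rot_iff hz).2 hn⟩
  · rintro ⟨n, hn⟩
    exact ⟨n + 1, (fanEnds_rot_iff hz).1 hn⟩

theorem eq_of_boundary_of_origin_eq {x y : D} (hx : T.glue x = x) (hy : T.glue y = y)
    (h : T.origin x = T.origin y) : x = y := by
  obtain ⟨n, h1, h2, h3⟩ := FanEnds.exists_of_origin_eq h ⟨0, FanEnds.zero hx⟩
  cases n with
  | zero => exact h1.symm
  | succ n => exact absurd hy (h3 0 (by omega))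

theorem FanEnds.origin_iterate {x y : D} {n : ℕ} (h : T.FanEnds x y n) {j : ℕ} (hj : j ≤ n) :
    T.origin (T.rot^[j] x) = T.origin x := by
  induction j with
  | zero => rfl
  | succ j ih =>
    rw [Function.iterate_succ_apply', T.origin_rot (h.2.2 j (by omega)), ih (by omega)]

theorem FanEnds.injOn {x y : D} {n : ℕ} (h : T.FanEnds x y n) {i j : ℕ} (hi : i ≤ n) (hj : j ≤ n)
    (hij : T.rot^[i] x = T.rot^[j] x) : i = j := by
  wlog hlt : i < j generalizing i j
  · rcases Nat.lt_trichotomy i j with h' | h' | h'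
    · exact absurd h' hlt
    · exact h'
    · exact (this hj hi hij.symm h').symm
  exfalso
  -- A repetition would make the final boundary segment appear before the end of the fan.
  have : T.rot^[n - j + i] x = T.rot^[n] x := by
    rw [Function.iterate_add_apply, hij, ← Function.iterate_add_apply, Nat.sub_add_cancel hj]
  refine h.2.2 (n - j + i) (by omega) ?_
  rw [this, h.1, h.2.1]

/-- The corners at a boundary vertex, from the first one on. -/
theorem FanEnds.corners {x y : D} {n : ℕ} (h : T.FanEnds x y n)
    (hx : T.glue (T.prev x) = T.prev x) (z : D) :
    T.origin z = T.origin x ↔ ∃ j ≤ n, T.rot^[j] x = z := by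
  constructor
  · intro hz
    obtain ⟨m, hm⟩ := FanEnds.exists_of_origin_eq hz.symm ⟨n, h⟩
    rcases le_or_gt m n with hmn | hmn
    · refine ⟨n - m, by omega, T.rot.injective.iterate m ?_⟩
      rw [hm.1, ← Function.iterate_add_apply, Nat.add_sub_cancel' hmn, h.1]
    -- The fan of `z` would pass through `x`, hence through `T.prev x` just before; but that is a
    -- boundary segment, where the fan should have stopped.
    · exfalso
      have h1 : T.rot^[m - n] z = x := by
        refine T.rot.injective.iterate n ?_
        rw [h.1, ← Function.iterate_add_apply, Nat.add_sub_cancel' hmn.le, hm.1]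
      obtain ⟨k, hk⟩ : ∃ k, m - n = k + 1 := ⟨m - n - 1, by omega⟩
      rw [hk, Function.iterate_succ_apply'] at h1
      have h2 : T.rot^[k] z = T.prev x := by
        apply T.rot.injective
        rw [h1, T.rot_apply, hx, T.next_prev]
      exact hm.2.2 k (by omega) (by rw [h2, hx])
  · rintro ⟨j, hj, rfl⟩
    exact h.origin_iterate hj

theorem FanEnds.cornerCount {x y : D} {n : ℕ} (h : T.FanEnds x y n)
    (hx : T.glue (T.prev x) = T.prev x) : T.cornerCount (T.origin x) = n + 1 := by
  have e : Fin (n + 1) ≃ {z : D // T.origin z = T.origin x} :=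
    Equiv.ofBijective (fun j => ⟨T.rot^[j.1] x, h.origin_iterate (by omega)⟩)
      ⟨fun i j hij => Fin.ext (h.injOn (by omega) (by omega) (congrArg Subtype.val hij)),
        fun ⟨z, hz⟩ => by
          obtain ⟨j, hj, rfl⟩ := (h.corners hx z).1 hz
          exact ⟨⟨j, by omega⟩, rfl⟩⟩
  rw [TriangulatedSurface.cornerCount, ← Nat.card_congr e, Nat.card_fin]

/-- The corners at an interior vertex form a cycle of `rot`. -/
theorem corners_interior [Finite D] {x : D} (hx : ¬ T.IsBoundaryVertex (T.origin x)) (z : D) :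
    T.origin z = T.origin x ↔ ∃ j < Function.minimalPeriod T.rot x, T.rot^[j] x = z := by
  have ho : ∀ j, T.origin (T.rot^[j] x) = T.origin x := by
    intro j
    induction j with
    | zero => rfl
    | succ j ih =>
      rw [Function.iterate_succ_apply', T.origin_rot, ih]
      intro h
      exact hx ⟨_, h, ih⟩
  constructor
  · intro hz
    obtain ⟨j, hj⟩ := (T.sameCycle_of_origin_eq hz.symm).exists_nat_pow_eq
    rw [Equiv.Perm.coe_pow] at hj
    have hp : 0 < Function.minimalPeriod T.rot x :=
      Function.minimalPeriod_pos_of_mem_periodicPts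
        (T.rot.injective.mem_periodicPts x)
    exact ⟨j % Function.minimalPeriod T.rot x, Nat.mod_lt _ hp, by
      rw [Function.iterate_mod_minimalPeriod_eq, hj]⟩
  · rintro ⟨j, -, rfl⟩
    exact ho j

theorem cornerCount_interior [Finite D] {x : D} (hx : ¬ T.IsBoundaryVertex (T.origin x)) :
    T.cornerCount (T.origin x) = Function.minimalPeriod T.rot x := by
  have e : Fin (Function.minimalPeriod T.rot x) ≃ {z : D // T.origin z = T.origin x} :=
    Equiv.ofBijective (fun j => ⟨T.rot^[j.1] x, (corners_interior hx _).2 ⟨j.1, j.2, rfl⟩⟩)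
      ⟨fun i j hij => Fin.ext (Function.iterate_injOn_Iio_minimalPeriod i.2 j.2
          (congrArg Subtype.val hij)),
        fun ⟨z, hz⟩ => by
          obtain ⟨j, hj, rfl⟩ := (corners_interior hx z).1 hz
          exact ⟨⟨j, hj⟩, rfl⟩⟩
  rw [TriangulatedSurface.cornerCount, ← Nat.card_congr e, Nat.card_fin]

end TriangulatedSurface

/-! ### Separating arcs, by homology modulo two. -/

namespace TriangulatedSurface

variable {D : Type u} {T : TriangulatedSurface D}

/-- `S` is the part of the surface, on the side of `x`, which the arc with side `x` cuts off. -/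
structure CutsOff (T : TriangulatedSurface D) (x : D) (S : Set D) : Prop where
  mem : x ∈ S
  glue_notMem : T.glue x ∉ S
  next : ∀ y ∈ S, T.next y ∈ S
  glue : ∀ y ∈ S, y ≠ x → T.glue y ∈ S

namespace CutsOff

variable {x : D} {S : Set D} (h : T.CutsOff x S)
include h

theorem glue_ne : T.glue x ≠ x := fun e => h.glue_notMem (e.symm ▸ h.mem)

theorem next_iff {y : D} : T.next y ∈ S ↔ y ∈ S :=
  ⟨fun hy => by simpa [T.next_next_next] using h.next _ (h.next _ hy), h.next y⟩

theorem prev_iff {y : D} : T.prev y ∈ S ↔ y ∈ S := by rw [prev, h.next_iff, h.next_iff]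

theorem sameTriangle {y z : D} (hyz : T.SameTriangle y z) : y ∈ S ↔ z ∈ S := by
  rcases hyz with rfl | rfl | rfl
  exacts [Iff.rfl, h.next_iff.symm, h.prev_iff.symm]

theorem compl : T.CutsOff (T.glue x) Sᶜ where
  mem := h.glue_notMem
  glue_notMem := by rw [T.glue_glue]; exact fun e => e h.mem
  next y hy := fun e => hy (h.next_iff.1 e)
  glue y hy hne := fun e => hy (by
    have := h.glue _ e fun e' => hne (T.glue_eq_iff.1 e')
    rwa [T.glue_glue] at this)

theorem glue_iff {y : D} (h1 : y ≠ x) (h2 : y ≠ T.glue x) : T.glue y ∈ S ↔ y ∈ S := by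
  constructor
  · intro hy
    by_contra hn
    exact h.compl.glue y hn h2 hy
  · exact fun hy => h.glue y hy h1

/-- Turning around a vertex changes sides only when crossing `x` or `T.glue x`, which start at the
two ends of the arc. -/
theorem origin_iff {y z : D} (hyz : T.origin y = T.origin z) (h1 : T.origin y ≠ T.origin x)
    (h2 : T.origin y ≠ T.origin (T.next x)) : y ∈ S ↔ z ∈ S := by
  refine T.mem_iff_of_origin_eq hyz fun z hz hg => ?_
  rw [T.rot_apply, h.next_iff, h.glue_iff]
  · rintro rfl
    exact h1 hz.symm
  · rintro rfl
    exact h2 (by rw [← hz, T.origin_glue h.glue_ne])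

theorem isPeripheral (hS : ∀ y ∈ S, T.IsBoundaryVertex (T.origin y)) : T.IsPeripheral x :=
  ⟨h.glue_ne, S, h.mem, h.glue_notMem, h.next, h.glue, hS⟩

end CutsOff

instance [Finite D] : Finite T.Edge := by unfold Edge; infer_instance

instance [Finite D] : Finite T.Vertex := by unfold Vertex; infer_instance

instance [Finite D] : Finite T.Triangle := by unfold Triangle; infer_instance

theorem edge_glue (x : D) : T.edge (T.glue x) = T.edge x := (Quot.sound rfl : T.edge x = _).symm

theorem edge_eq_iff {x y : D} : T.edge x = T.edge y ↔ y = x ∨ y = T.glue x := by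
  constructor
  · intro h
    have := Quot.eqvGen_exact h
    clear h
    induction this with
    | rel a b h => exact Or.inr h
    | refl a => exact Or.inl rfl
    | symm a b _ ih =>
      rcases ih with rfl | rfl
      · exact Or.inl rfl
      · exact Or.inr (T.glue_glue _).symm
    | trans a b c _ _ ih1 ih2 =>
      rcases ih1 with rfl | rfl <;> rcases ih2 with rfl | rfl
      · exact Or.inl rfl
      · exact Or.inr rfl
      · exact Or.inr rfl
      · exact Or.inl (T.glue_glue _)
  · rintro (rfl | rfl)
    · rfl
    · exact (edge_glue x).symm

/-- The coboundary, modulo two, of a function on the vertices. -/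
def coboundary (T : TriangulatedSurface D) (g : T.Vertex → ZMod 2) : T.Edge → ZMod 2 :=
  Quot.lift (fun x => g (T.origin x) + g (T.origin (T.next x))) (by
    rintro x _ rfl
    by_cases h : T.glue x = x
    · rw [h]
    · rw [T.origin_glue h, T.origin_next_glue h, add_comm])

theorem coboundary_edge (g : T.Vertex → ZMod 2) (x : D) :
    T.coboundary g (T.edge x) = g (T.origin x) + g (T.origin (T.next x)) := rfl

/-- The boundary arcs, modulo two, of a set of triangles. -/
def arcBoundary (T : TriangulatedSurface D) :
    (T.Triangle → ZMod 2) →ₗ[ZMod 2] (T.Edge → ZMod 2) where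
  toFun f := Quot.lift (fun x => f (Quot.mk _ x) + f (Quot.mk _ (T.glue x))) (by
    rintro x _ rfl
    rw [T.glue_glue, add_comm])
  map_add' f f' := by
    funext e
    induction e using Quot.ind
    exact add_add_add_comm _ _ _ _
  map_smul' c f := by
    funext e
    induction e using Quot.ind
    exact (mul_add c _ _).symm

theorem arcBoundary_edge (f : T.Triangle → ZMod 2) (x : D) :
    T.arcBoundary f (T.edge x) = f (Quot.mk _ x) + f (Quot.mk _ (T.glue x)) := rfl

theorem triangle_next (x : D) : (Quot.mk _ (T.next x) : T.Triangle) = Quot.mk _ x :=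
  (Quot.sound rfl : (Quot.mk _ x : T.Triangle) = _).symm

-- An arc has two sides, which give the two terms of `arcBoundary`. A boundary segment has one side
-- only, but there `c` vanishes.
open Classical in
theorem sum_edge [Fintype D] [Fintype T.Edge] (f : T.Triangle → ZMod 2) (c : T.Edge → ZMod 2)
    (hc : ∀ x, T.glue x = x → c (T.edge x) = 0) :
    ∑ e, T.arcBoundary f e * c e = ∑ x, f (Quot.mk _ x) * c (T.edge x) := by
  rw [← Finset.sum_fiberwise (s := Finset.univ) (g := T.edge)]
  refine Finset.sum_congr rfl fun e _ => ?_
  induction e using Quot.ind with | _ x => ?_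
  change T.arcBoundary f (T.edge x) * c (T.edge x) = ∑ y with T.edge y = T.edge x, _
  have hsum : ∀ y ∈ Finset.univ.filter (fun y => T.edge y = T.edge x),
      f (Quot.mk _ y) * c (T.edge y) = f (Quot.mk _ y) * c (T.edge x) := by
    intro y hy
    rw [(Finset.mem_filter.1 hy).2]
  rw [Finset.sum_congr rfl hsum, ← Finset.sum_mul]
  by_cases h : T.glue x = x
  · rw [hc x h, mul_zero, mul_zero]
  · have : Finset.univ.filter (fun y => T.edge y = T.edge x) = {x, T.glue x} := by
      ext y
      rw [Finset.mem_filter, eq_comm (a := T.edge y), edge_eq_iff]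
      simp
    rw [this, Finset.sum_pair (Ne.symm h), arcBoundary_edge]

/-- A discrete Stokes formula: around a triangle every vertex value occurs twice, so the coboundary
sums to zero modulo two. -/
theorem sum_arcBoundary_mul_coboundary [Finite D] [Fintype T.Edge] (f : T.Triangle → ZMod 2)
    (g : T.Vertex → ZMod 2)
    (hg : ∀ x, T.glue x = x → g (T.origin x) = g (T.origin (T.next x))) :
    ∑ e, T.arcBoundary f e * T.coboundary g e = 0 := by
  have := Fintype.ofFinite D
  rw [sum_edge f (T.coboundary g) fun x hx => by
    rw [coboundary_edge, hg x hx, CharTwo.add_self_eq_zero]]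
  simp only [coboundary_edge, mul_add, Finset.sum_add_distrib]
  have : ∑ x, f (Quot.mk _ x) * g (T.origin (T.next x)) = ∑ x, f (Quot.mk _ x) * g (T.origin x) :=
    Fintype.sum_bijective T.next
      ⟨fun _ _ h => T.next_inj.1 h, fun y => ⟨T.prev y, T.next_prev y⟩⟩ _ _ fun x => by
        rw [triangle_next]
  rw [this, CharTwo.add_self_eq_zero]

theorem IsConnected.eq_of_invariant (h : T.IsConnected) {α : Type*} {f : D → α}
    (h1 : ∀ x, f (T.next x) = f x) (h2 : ∀ x, f (T.glue x) = f x) (x y : D) : f x = f y := by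
  have := h.2 {z | f z = f y} ⟨y, rfl⟩ fun z hz => ⟨(h1 z).trans hz, (h2 z).trans hz⟩
  exact (this ▸ Set.mem_univ x : x ∈ {z | f z = f y})

theorem finrank_le_finrank_range_add_one {K V W : Type*} [Field K] [AddCommGroup V]
    [AddCommGroup W] [Module K V] [Module K W] [FiniteDimensional K V]
    (L : V →ₗ[K] W) (v : V) (hL : ∀ u, L u = 0 → ∃ c : K, c • v = u) :
    Module.finrank K V ≤ Module.finrank K (LinearMap.range L) + 1 := by
  rw [← L.finrank_range_add_finrank_ker]
  refine Nat.add_le_add_left ?_ _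
  have hle : LinearMap.ker L ≤ Submodule.span K {v} := fun u hu =>
    Submodule.mem_span_singleton.2 (hL u hu)
  have h1 := finrank_span_le_card (R := K) ({v} : Set V)
  rw [Set.toFinset_singleton, Finset.card_singleton] at h1
  exact (Submodule.finrank_mono hle).trans h1

namespace IsTwicePuncturedDisk

variable {b : ℕ} {bd : ZMod b → D} {P Q : T.Vertex} (h : T.IsTwicePuncturedDisk bd P Q)
include h

theorem glue_bd (i : ZMod b) : T.glue (bd i) = bd i := by
  have : bd i ∈ {x | T.glue x = x} := h.range_bd ▸ Set.mem_range_self i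
  exact this

theorem exists_bd {x : D} (hx : T.glue x = x) : ∃ i, bd i = x := by
  have : x ∈ Set.range bd := h.range_bd ▸ hx
  exact this

theorem symm : T.IsTwicePuncturedDisk bd Q P :=
  { h with
    punctures_ne := h.punctures_ne.symm
    interior_iff := fun v => (h.interior_iff v).trans or_comm }

theorem interior_left : ¬ T.IsBoundaryVertex P := (h.interior_iff P).2 (Or.inl rfl)

theorem interior_right : ¬ T.IsBoundaryVertex Q := (h.interior_iff Q).2 (Or.inr rfl)

theorem boundary_of_ne {v : T.Vertex} (hP : v ≠ P) (hQ : v ≠ Q) : T.IsBoundaryVertex v := by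
  by_contra hv
  rcases (h.interior_iff v).1 hv with rfl | rfl
  exacts [hP rfl, hQ rfl]

theorem boundary_bd (i : ZMod b) : T.IsBoundaryVertex (T.origin (bd i)) :=
  ⟨bd i, h.glue_bd i, rfl⟩

omit h in
theorem boundary_origin {x : D} (hx : T.glue x = x) : T.IsBoundaryVertex (T.origin x) := ⟨x, hx, rfl⟩

theorem boundary_origin_next {x : D} (hx : T.glue x = x) :
    T.IsBoundaryVertex (T.origin (T.next x)) := by
  obtain ⟨i, rfl⟩ := h.exists_bd hx
  rw [← h.bd_succ]
  exact h.boundary_bd _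

theorem exists_origin_bd {v : T.Vertex} (hv : T.IsBoundaryVertex v) :
    ∃ i, T.origin (bd i) = v := by
  obtain ⟨x, hx, rfl⟩ := hv
  obtain ⟨i, rfl⟩ := h.exists_bd hx
  exact ⟨i, rfl⟩

theorem origin_bd_injective : Function.Injective fun i => T.origin (bd i) := fun i j hij =>
  h.bd_injective (eq_of_boundary_of_origin_eq (h.glue_bd i) (h.glue_bd j) hij)

theorem eq_of_boundary_invariant [NeZero b] {α : Type*} {g : T.Vertex → α}
    (hg : ∀ x, T.glue x = x → g (T.origin x) = g (T.origin (T.next x))) {v w : T.Vertex}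
    (hv : T.IsBoundaryVertex v) (hw : T.IsBoundaryVertex w) : g v = g w := by
  have key : ∀ n : ℕ, g (T.origin (bd (n : ZMod b))) = g (T.origin (bd 0)) := by
    intro n
    induction n with
    | zero => rw [Nat.cast_zero]
    | succ n ih => rw [Nat.cast_succ, h.bd_succ, ← hg _ (h.glue_bd _), ih]
  obtain ⟨i, rfl⟩ := h.exists_origin_bd hv
  obtain ⟨j, rfl⟩ := h.exists_origin_bd hw
  have hi := key i.val
  have hj := key j.val
  rw [ZMod.natCast_rightInverse] at hi hj
  rw [hi, hj]

theorem card_vertex [Finite D] [NeZero b] : Nat.card T.Vertex = b + 2 := by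
  have e : ZMod b ⊕ Bool ≃ T.Vertex := Equiv.ofBijective
    (Sum.elim (fun i => T.origin (bd i)) (fun s => if s then P else Q)) (by
      constructor
      · rintro (i | s) (j | t) hij
        · exact congrArg Sum.inl (h.origin_bd_injective hij)
        · exfalso
          have := h.boundary_bd i
          cases t <;> simp only [Sum.elim_inl, Sum.elim_inr] at hij <;> rw [hij] at this
          exacts [h.interior_right this, h.interior_left this]
        · exfalso
          have := h.boundary_bd j
          cases s <;> simp only [Sum.elim_inl, Sum.elim_inr] at hij <;> rw [← hij] at this
          exacts [h.interior_right this, h.interior_left this]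
        · cases s <;> cases t
          · rfl
          · exact absurd hij.symm h.punctures_ne
          · exact absurd hij h.punctures_ne
          · rfl
      · intro v
        by_cases hv : T.IsBoundaryVertex v
        · obtain ⟨i, hi⟩ := h.exists_origin_bd hv
          exact ⟨Sum.inl i, hi⟩
        · rcases (h.interior_iff v).1 hv with rfl | rfl
          exacts [⟨Sum.inr true, rfl⟩, ⟨Sum.inr false, rfl⟩])
  rw [← Nat.card_congr e, Nat.card_sum, Nat.card_zmod, Nat.card_eq_fintype_card, Fintype.card_bool]

theorem card_edge [Finite D] [NeZero b] : Nat.card T.Edge = Nat.card T.Triangle + b + 1 := by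
  have := h.euler
  rw [eulerChar, h.card_vertex] at this
  push_cast at this
  omega

omit h in
theorem exists_origin_eq (v : T.Vertex) : ∃ x, T.origin x = v := by
  induction v using Quot.ind with | _ x => exact ⟨x, rfl⟩

-- Exactness by counting dimensions. Let t be the number of triangles; Euler characteristic 1 gives
-- t + b + 1 edges. The conditions on `ε` have rank at least b + 2, so they leave dimension at most
-- t - 1, while the boundaries of sets of triangles already have dimension at least t - 1.
open Classical in
theorem exists_arcBoundary_eq [Finite D] [NeZero b] [Fintype T.Edge] (ε : T.Edge → ZMod 2)
    (hε : ∀ i, ε (T.edge (bd i)) = 0)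
    (hε' : ∀ g : T.Vertex → ZMod 2,
      (∀ x, T.glue x = x → g (T.origin x) = g (T.origin (T.next x))) →
        ∑ e, ε e * T.coboundary g e = 0) :
    ∃ f, T.arcBoundary f = ε := by
  have := Fintype.ofFinite D
  have : Fintype T.Triangle := Fintype.ofFinite _
  let cls : T.Vertex → Fin 3 := fun v => if v = P then 0 else if v = Q then 1 else 2
  have cls_bd : ∀ v, T.IsBoundaryVertex v → cls v = 2 := by
    intro v hv
    have h1 : v ≠ P := fun e => h.interior_left (e ▸ hv)
    have h2 : v ≠ Q := fun e => h.interior_right (e ▸ hv)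
    simp only [cls, if_neg h1, if_neg h2]
  let ind : Fin 3 → T.Vertex → ZMod 2 := fun j v => if cls v = j then 1 else 0
  have ind_bd : ∀ j x, T.glue x = x → ind j (T.origin x) = ind j (T.origin (T.next x)) := by
    intro j x hx
    simp only [ind, cls_bd _ (boundary_origin hx), cls_bd _ (h.boundary_origin_next hx)]
  -- The columns are the conditions: coboundaries of the indicators of P, of Q and of the whole
  -- boundary, then evaluation at the b boundary segments.
  let M : Matrix T.Edge (Fin 3 ⊕ ZMod b) (ZMod 2) := Matrix.of fun e => Sum.elim
    (fun j => T.coboundary (ind j) e) (fun i => if e = T.edge (bd i) then 1 else 0)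
  have M_mul : ∀ u x, M.mulVec u (T.edge x) =
      (u (Sum.inl (cls (T.origin x))) + u (Sum.inl (cls (T.origin (T.next x))))) +
        ∑ i, if T.edge x = T.edge (bd i) then u (Sum.inr i) else 0 := by
    intro u x
    simp only [Matrix.mulVec, dotProduct, Fintype.sum_sum_type, M, Matrix.of_apply, Sum.elim_inl,
      Sum.elim_inr, coboundary_edge, ind, add_mul, Finset.sum_add_distrib, ite_mul, one_mul,
      zero_mul, Finset.sum_ite_eq, Finset.mem_univ, if_true]
  have Mt_inl : ∀ c j, M.transpose.mulVec c (Sum.inl j) = ∑ e, c e * T.coboundary (ind j) e := by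
    intro c j
    simp only [Matrix.mulVec, dotProduct, M, Matrix.transpose_apply, Matrix.of_apply, Sum.elim_inl,
      mul_comm]
  have Mt_inr : ∀ c i, M.transpose.mulVec c (Sum.inr i) = c (T.edge (bd i)) := by
    intro c i
    simp only [Matrix.mulVec, dotProduct, M, Matrix.transpose_apply, Matrix.of_apply, Sum.elim_inr,
      ite_mul, one_mul, zero_mul, Finset.sum_ite_eq', Finset.mem_univ, if_true]
  -- The b + 3 columns satisfy at most one linear relation: the segment coefficients vanish, and by
  -- connectedness the three others agree.
  have rankM : b + 2 ≤ M.rank := by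
    have key := finrank_le_finrank_range_add_one M.mulVecLin
      (Sum.elim (fun _ => 1) (fun _ => 0)) (fun u hu => by
        have hu' : ∀ x, M.mulVec u (T.edge x) = 0 := fun x => congrFun hu _
        have hr : ∀ i, u (Sum.inr i) = 0 := by
          intro i
          have := hu' (bd i)
          rw [M_mul, cls_bd _ (h.boundary_bd i), cls_bd _ (h.boundary_origin_next (h.glue_bd i)),
            CharTwo.add_self_eq_zero, zero_add, Finset.sum_eq_single i] at this
          · simpa using this
          · intro j _ hj
            rw [if_neg]
            rw [edge_eq_iff, h.glue_bd]
            rintro (e | e) <;> exact hj (h.bd_injective e)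
          · simp
        have hl : ∀ x, u (Sum.inl (cls (T.origin x))) = u (Sum.inl (cls (T.origin (T.next x)))) := by
          intro x
          have := hu' x
          rw [M_mul, Finset.sum_eq_zero (fun i _ => by rw [hr, ite_self]), add_zero] at this
          exact CharTwo.add_eq_zero.1 this
        have hc : ∀ x y, u (Sum.inl (cls (T.origin x))) = u (Sum.inl (cls (T.origin y))) :=
          h.connected.eq_of_invariant (fun x => (hl x).symm) (fun x => by
            by_cases hx : T.glue x = x
            · rw [hx]
            · rw [T.origin_glue hx, ← hl])
        refine ⟨u (Sum.inl 0), ?_⟩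
        obtain ⟨x, hx⟩ := exists_origin_eq P
        have h0 : cls P = 0 := by simp [cls]
        have h1 : cls Q = 1 := by simp [cls, h.punctures_ne.symm]
        funext k
        rcases k with j | i
        · have : ∃ y, cls (T.origin y) = j := by
            fin_cases j
            · exact ⟨x, by rw [hx]; exact h0⟩
            · obtain ⟨y, hy⟩ := exists_origin_eq Q
              exact ⟨y, by rw [hy]; exact h1⟩
            · exact ⟨bd 0, cls_bd _ (h.boundary_bd 0)⟩
          obtain ⟨y, hy⟩ := this
          have := hc x y
          rw [hx, h0, hy] at this
          simp [this]
        · simp [hr])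
    rw [Module.finrank_fintype_fun_eq_card, Fintype.card_sum, Fintype.card_fin, ZMod.card] at key
    rw [Matrix.rank]
    omega
  have rank2 : Nat.card T.Triangle ≤
      Module.finrank (ZMod 2) (LinearMap.range T.arcBoundary) + 1 := by
    have key := finrank_le_finrank_range_add_one T.arcBoundary (fun _ => 1) (fun f hf => by
      obtain ⟨x⟩ := h.connected.1
      refine ⟨f (Quot.mk _ x), ?_⟩
      have hc : ∀ y z, f (Quot.mk _ y) = f (Quot.mk _ z) :=
        h.connected.eq_of_invariant (f := fun y => f (Quot.mk _ y))
          (fun y => by simp only [triangle_next]) (fun y => by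
            have := congrFun hf (T.edge y)
            rw [arcBoundary_edge] at this
            exact (CharTwo.add_eq_zero.1 this).symm)
      funext t
      induction t using Quot.ind with | _ y => ?_
      exact (mul_one _).trans (hc x y))
    rwa [Module.finrank_fintype_fun_eq_card, ← Nat.card_eq_fintype_card] at key
  have hker := M.transpose.mulVecLin.finrank_range_add_finrank_ker
  rw [Module.finrank_fintype_fun_eq_card, ← Nat.card_eq_fintype_card, h.card_edge] at hker
  have hrank : Module.finrank (ZMod 2) (LinearMap.range M.transpose.mulVecLin) = M.rank :=
    M.rank_transpose
  have hle : LinearMap.range T.arcBoundary ≤ LinearMap.ker M.transpose.mulVecLin := by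
    rintro _ ⟨f, rfl⟩
    refine LinearMap.mem_ker.2 (funext fun k => ?_)
    rcases k with j | i
    · change M.transpose.mulVec _ _ = _
      rw [Mt_inl]
      exact sum_arcBoundary_mul_coboundary f _ (ind_bd j)
    · change M.transpose.mulVec _ _ = _
      rw [Mt_inr, arcBoundary_edge, h.glue_bd, CharTwo.add_self_eq_zero]
      rfl
  -- The kernel has dimension at most (t + b + 1) - (b + 2) = t - 1.
  have heq := Submodule.eq_of_le_of_finrank_le hle (by omega)
  have hmem : ε ∈ LinearMap.ker M.transpose.mulVecLin := by
    refine LinearMap.mem_ker.2 (funext fun k => ?_)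
    rcases k with j | i
    · change M.transpose.mulVec _ _ = _
      rw [Mt_inl]
      exact hε' _ (ind_bd j)
    · change M.transpose.mulVec _ _ = _
      rw [Mt_inr, hε]
      rfl
  rw [← heq] at hmem
  exact hmem

/-- An arc whose end points agree, or both lie on the boundary, separates the surface. -/
theorem exists_cutsOff [Finite D] [NeZero b] {x : D} (hx : T.glue x ≠ x)
    (hxx : T.origin x = T.origin (T.next x) ∨
      T.IsBoundaryVertex (T.origin x) ∧ T.IsBoundaryVertex (T.origin (T.next x))) :
    ∃ S, T.CutsOff x S := by
  classical
  have := Fintype.ofFinite T.Edge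
  -- The arc is a cycle relative to the boundary: every admissible `g` takes equal values at its two
  -- ends.
  obtain ⟨f, hf⟩ := h.exists_arcBoundary_eq (Pi.single (T.edge x) 1) (fun i => by
      rw [Pi.single_eq_of_ne]
      rw [Ne, edge_eq_iff, h.glue_bd]
      rintro (rfl | rfl) <;> exact hx (h.glue_bd i)) (fun g hg => by
      simp only [Pi.single_apply, ite_mul, one_mul, zero_mul, Finset.sum_ite_eq', Finset.mem_univ,
        if_true, coboundary_edge]
      rw [CharTwo.add_eq_zero]
      rcases hxx with e | ⟨h1, h2⟩
      · rw [e]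
      · exact h.eq_of_boundary_invariant hg h1 h2)
  refine ⟨{y | f (Quot.mk _ y) = f (Quot.mk _ x)}, rfl, ?_, fun y hy => ?_, fun y hy hyx => ?_⟩
  · intro e
    have := congrFun hf (T.edge x)
    have e' : f (Quot.mk _ (T.glue x)) = f (Quot.mk _ x) := e
    rw [arcBoundary_edge, Pi.single_eq_same, e', CharTwo.add_self_eq_zero] at this
    exact zero_ne_one this
  · rw [Set.mem_ofPred_eq, triangle_next]
    exact hy
  · have h1 := congrFun hf (T.edge y)
    by_cases hyx' : y = T.glue x
    · rw [hyx', T.glue_glue]; rfl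
    · rw [arcBoundary_edge, Pi.single_eq_of_ne, CharTwo.add_eq_zero] at h1
      · exact h1.symm.trans hy
      · rw [Ne, edge_eq_iff]
        rintro (rfl | rfl)
        · exact hyx rfl
        · exact hyx' (T.glue_glue y).symm

/-- Two arcs joining the punctures bound a part of the surface. -/
theorem exists_bigon [Finite D] [NeZero b] {x y : D} (hxP : T.origin x = P)
    (hxQ : T.origin (T.next x) = Q) (hyP : T.origin y = P) (hyQ : T.origin (T.next y) = Q)
    (hxy : x ≠ y) :
    ∃ S : Set D, x ∈ S ∧ T.glue x ∉ S ∧ (∀ z, T.next z ∈ S ↔ z ∈ S) ∧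
      ∀ z, z ≠ x → z ≠ y → z ≠ T.glue x → z ≠ T.glue y → (T.glue z ∈ S ↔ z ∈ S) := by
  classical
  have := Fintype.ofFinite T.Edge
  have hx : T.glue x ≠ x := fun e => h.interior_left (hxP ▸ boundary_origin e)
  have hy : T.glue y ≠ y := fun e => h.interior_left (hyP ▸ boundary_origin e)
  have hyx : y ≠ T.glue x := by
    rintro rfl
    rw [T.origin_glue hx, hxQ] at hyP
    exact h.punctures_ne hyP.symm
  have hexy : T.edge x ≠ T.edge y := by
    rw [Ne, edge_eq_iff]
    rintro (e | e)
    exacts [hxy e.symm, hyx e]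
  -- Neither arc is a cycle alone, but they have the same ends, so their sum is one.
  obtain ⟨f, hf⟩ := h.exists_arcBoundary_eq (Pi.single (T.edge x) 1 + Pi.single (T.edge y) 1)
    (fun i => by
      rw [Pi.add_apply, Pi.single_eq_of_ne, Pi.single_eq_of_ne, add_zero]
      · rw [Ne, edge_eq_iff, h.glue_bd]
        rintro (rfl | rfl) <;> exact hy (h.glue_bd i)
      · rw [Ne, edge_eq_iff, h.glue_bd]
        rintro (rfl | rfl) <;> exact hx (h.glue_bd i)) (fun g hg => by
      simp only [Pi.add_apply, Pi.single_apply, add_mul, ite_mul, one_mul, zero_mul,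
        Finset.sum_add_distrib, Finset.sum_ite_eq', Finset.mem_univ, if_true, coboundary_edge]
      rw [hxP, hxQ, hyP, hyQ, CharTwo.add_self_eq_zero])
  refine ⟨{z | f (Quot.mk _ z) = f (Quot.mk _ x)}, rfl, ?_, fun z => ?_, fun z h1 h2 h3 h4 => ?_⟩
  · intro e
    have := congrFun hf (T.edge x)
    have e' : f (Quot.mk _ (T.glue x)) = f (Quot.mk _ x) := e
    rw [arcBoundary_edge, Pi.add_apply, Pi.single_eq_same, Pi.single_eq_of_ne hexy,
      e', CharTwo.add_self_eq_zero, add_zero] at this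
    exact zero_ne_one this
  · rw [Set.mem_ofPred_eq, triangle_next]
    rfl
  · have := congrFun hf (T.edge z)
    rw [arcBoundary_edge, Pi.add_apply, Pi.single_eq_of_ne, Pi.single_eq_of_ne, add_zero,
      CharTwo.add_eq_zero] at this
    · rw [Set.mem_ofPred_eq, Set.mem_ofPred_eq, this]
    · rw [Ne, edge_eq_iff]
      rintro (rfl | rfl)
      exacts [h2 rfl, h4 (T.glue_glue z).symm]
    · rw [Ne, edge_eq_iff]
      rintro (rfl | rfl)
      exacts [h1 rfl, h3 (T.glue_glue z).symm]

end IsTwicePuncturedDisk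

end TriangulatedSurface

/-! ### Loops and arcs at the punctures. -/

namespace TriangulatedSurface

variable {D : Type u} {T : TriangulatedSurface D}

/-- A part can be left only through its arc, and neither arc has a side in both parts. A nonempty
intersection would therefore be closed under gluing and be the whole surface. -/
theorem CutsOff.disjoint (hc : T.IsConnected) {x y : D} {R S : Set D} (hR : T.CutsOff x R)
    (hS : T.CutsOff y S) (hxy : x ≠ y) (hx : T.glue x ∉ S) (hy : T.glue y ∉ R) {z : D}
    (hzR : z ∈ R) : z ∉ S := by
  intro hzS
  have hxS : x ∉ S := fun e => hx (hS.glue x e hxy)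
  have hyR : y ∉ R := fun e => hy (hR.glue y e hxy.symm)
  have : R ∩ S = Set.univ := hc.2 _ ⟨z, hzR, hzS⟩ fun w hw =>
    ⟨⟨hR.next _ hw.1, hS.next _ hw.2⟩, hR.glue _ hw.1 (fun e => hxS (e ▸ hw.2)),
      hS.glue _ hw.2 (fun e => hyR (e ▸ hw.1))⟩
  exact hxS (this ▸ Set.mem_univ x : x ∈ R ∩ S).2

theorem eq_of_origin_eq_of_rot_fixed {x z : D} (hx : T.rot x = x) (h : T.origin x = T.origin z) :
    z = x :=
  ((T.sameCycle_of_origin_eq h).eq_of_left hx).symm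

/-- The vertex enclosed by a self-folded triangle has a single corner; exhibiting a second corner
there is the standard contradiction below. -/
theorem rot_prev_of_selfFolded {l : D} (hl : T.glue (T.next l) = T.prev l) :
    T.rot (T.prev l) = T.prev l := by
  rw [T.rot_apply, T.glue_eq_iff.2 hl.symm, T.next_next]

namespace IsTwicePuncturedDisk

variable {b : ℕ} {bd : ZMod b → D}

theorem ne_left {P Q : T.Vertex} (h : T.IsTwicePuncturedDisk bd P Q) {v : T.Vertex}
    (hv : T.IsBoundaryVertex v) : v ≠ P := fun e => h.interior_left (e ▸ hv)

theorem ne_right {P Q : T.Vertex} (h : T.IsTwicePuncturedDisk bd P Q) {v : T.Vertex}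
    (hv : T.IsBoundaryVertex v) : v ≠ Q := fun e => h.interior_right (e ▸ hv)

/-- A region without boundary vertices which is cut off by a loop is a self-folded triangle. -/
theorem selfFolded_of_cutsOff [Finite D] [NeZero b] (n : ℕ) : ∀ {P Q : T.Vertex}
    (_ : T.IsTwicePuncturedDisk bd P Q) {l : D} {S : Set D} (_ : S.ncard < n)
    (_ : T.CutsOff l S) (_ : T.origin l = P) (_ : T.origin (T.next l) = P)
    (_ : ∀ y ∈ S, ¬ T.IsBoundaryVertex (T.origin y)),
    T.glue (T.next l) = T.prev l ∧ T.origin (T.prev l) = Q := by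
  induction n with
  | zero => intro P Q h l S hn; exact absurd hn (Nat.not_lt_zero _)
  | succ n ih =>
    intro P Q h l S hn hS h1 h2 hb
    -- Any other loop at a puncture inside `S` cuts off, on the side away from `l`, a smaller part
    -- of `S`, to which the induction hypothesis applies.
    have key : ∀ {X Y : T.Vertex} (_ : T.IsTwicePuncturedDisk bd X Y) {l' : D} (_ : l' ∈ S)
        (_ : l' ≠ l) (_ : T.origin l' = X) (_ : T.origin (T.next l') = X),
        ∃ l'' R, (l'' = l' ∨ l'' = T.glue l') ∧ T.CutsOff l'' R ∧ l ∉ R ∧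
          T.glue (T.next l'') = T.prev l'' ∧ T.origin (T.prev l'') = Y := by
      intro X Y h' l' hl' hne h1' h2'
      have hg : T.glue l' ≠ l' := fun e => hb _ hl' (boundary_origin e)
      have sub : ∀ {l'' R}, T.CutsOff l'' R → T.glue l'' ∈ S → l'' ∈ S → l ∉ R →
          R ⊆ S ∧ R.ncard < n := by
        intro l'' R hR hg1 hg2 hlR
        have hsub : R ⊆ S := by
          intro z hz
          by_contra hzS
          refine hR.disjoint h.connected hS.compl ?_ (fun e => e hg1) ?_ hz hzS
          · rintro rfl
            exact hS.glue_notMem hg2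
          · rw [T.glue_glue]; exact hlR
        refine ⟨hsub, ?_⟩
        have : R.ncard < S.ncard :=
          Set.ncard_lt_ncard ⟨hsub, fun e => hlR (e hS.mem)⟩ (Set.toFinite _)
        omega
      have hgl' : T.glue l' ∈ S := hS.glue _ hl' hne
      obtain ⟨R, hR⟩ := h.exists_cutsOff hg (Or.inl (h1'.trans h2'.symm))
      by_cases hlR : l ∈ R
      · obtain ⟨s1, s2⟩ := sub hR.compl (by rw [T.glue_glue]; exact hl') hgl' (fun e => e hlR)
        obtain ⟨r1, r2⟩ := ih h' s2 hR.compl (by rw [T.origin_glue hg, h2'])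
          (by rw [T.origin_next_glue hg, h1']) (fun y hy => hb y (s1 hy))
        exact ⟨_, _, Or.inr rfl, hR.compl, fun e => e hlR, r1, r2⟩
      · obtain ⟨s1, s2⟩ := sub hR hgl' hl' hlR
        obtain ⟨r1, r2⟩ := ih h' s2 hR h1' h2' (fun y hy => hb y (s1 hy))
        exact ⟨_, _, Or.inl rfl, hR, hlR, r1, r2⟩
    have hnS : T.next l ∈ S := hS.next _ hS.mem
    have hpS : T.prev l ∈ S := hS.next _ hnS
    rcases (h.interior_iff _).1 (hb _ hpS) with hv | hv
    -- With third vertex P, the other two sides are loops too. Both would enclose the only corner at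
    -- Q, hence be the same side.
    · exfalso
      obtain ⟨l1, R1, e1, c1, n1, s1, o1⟩ := key h hnS (T.next_ne l) h2 hv
      obtain ⟨l2, R2, e2, c2, n2, s2, o2⟩ := key h hpS (T.prev_ne l) hv
        (by rw [T.next_prev, h1])
      have f1 : l1 = T.glue (T.next l) := by
        rcases e1 with rfl | e1
        · exact absurd (c1.next_iff.1 c1.mem) n1
        · exact e1
      have f2 : l2 = T.glue (T.prev l) := by
        rcases e2 with rfl | e2
        · exact absurd (c2.prev_iff.1 c2.mem) n2
        · exact e2
      have := eq_of_origin_eq_of_rot_fixed (rot_prev_of_selfFolded s1) (o1.trans o2.symm)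
      rw [T.prev_inj, f1, f2, T.glue_inj] at this
      exact T.prev_ne_next l this
    · refine ⟨?_, hv⟩
      -- Otherwise the triangle across `T.next l` joins Q to P, and its third vertex produces a loop
      -- at a puncture. That loop encloses a puncture with a single corner, but `l` and `T.prev l`
      -- are corners at P and Q outside it.
      by_contra hne
      have hw : T.glue (T.next l) ≠ T.next l := fun e => hb _ hnS (boundary_origin e)
      have hwS : T.glue (T.next l) ∈ S := hS.glue _ hnS (T.next_ne l)
      have ow1 : T.origin (T.glue (T.next l)) = Q := by rw [T.origin_glue hw]; exact hv
      have ow2 : T.origin (T.next (T.glue (T.next l))) = P := by rw [T.origin_next_glue hw, h2]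
      have fin : ∀ {l'' R}, T.CutsOff l'' R → l ∉ R → T.glue (T.next l'') = T.prev l'' →
          (T.origin (T.prev l'') = P ∨ T.origin (T.prev l'') = Q) → False := by
        intro l'' R c n s o
        have hp : T.prev l'' ∈ R := c.prev_iff.2 c.mem
        rcases o with o | o
        · have := eq_of_origin_eq_of_rot_fixed (rot_prev_of_selfFolded s) (o.trans h1.symm)
          exact n (this ▸ hp)
        · have := eq_of_origin_eq_of_rot_fixed (rot_prev_of_selfFolded s) (o.trans hv.symm)
          exact n (c.prev_iff.1 (this ▸ hp))
      rcases (h.interior_iff _).1 (hb _ (hS.prev_iff.2 hwS)) with hu | hu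
      · obtain ⟨l1, R1, e1, c1, n1, s1, o1⟩ := key h (hS.next _ hwS) (fun e =>
          hne (T.next_eq_iff.1 e)) ow2 hu
        exact fin c1 n1 s1 (Or.inr o1)
      · obtain ⟨l1, R1, e1, c1, n1, s1, o1⟩ := key h.symm (hS.prev_iff.2 hwS) (fun e => hw (by
          conv_rhs => rw [← e, T.next_prev])) hu (by rw [T.next_prev, ow1])
        exact fin c1 n1 s1 (Or.inl o1)

/-- The boundary is a single cycle: membership in `S` is preserved within the fan of a boundary
vertex and along each boundary segment. -/
theorem boundary_same_side [NeZero b] {P Q : T.Vertex} (h : T.IsTwicePuncturedDisk bd P Q)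
    {S : Set D} (hn : ∀ y, T.next y ∈ S ↔ y ∈ S)
    (hg : ∀ y, T.IsBoundaryVertex (T.origin y) → T.glue y ≠ y → (T.glue y ∈ S ↔ y ∈ S)) :
    (∀ y, T.IsBoundaryVertex (T.origin y) → y ∈ S) ∨
      ∀ y, T.IsBoundaryVertex (T.origin y) → y ∉ S := by
  have hv : ∀ {y z}, T.IsBoundaryVertex (T.origin y) → T.origin y = T.origin z →
      (y ∈ S ↔ z ∈ S) := fun hy hyz => T.mem_iff_of_origin_eq hyz fun w hw hw' => by
    rw [T.rot_apply, hn, hg w (hw ▸ hy) hw']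
  have key : ∀ n : ℕ, (bd (n : ZMod b) ∈ S ↔ bd 0 ∈ S) := by
    intro n
    induction n with
    | zero => rw [Nat.cast_zero]
    | succ n ih => rw [Nat.cast_succ, hv (h.boundary_bd _) (h.bd_succ _), hn, ih]
  have all : ∀ y, T.IsBoundaryVertex (T.origin y) → (y ∈ S ↔ bd 0 ∈ S) := by
    intro y hy
    obtain ⟨i, hi⟩ := h.exists_origin_bd hy
    have := key i.val
    rw [ZMod.natCast_rightInverse] at this
    rw [hv hy hi.symm, this]
  by_cases h0 : bd 0 ∈ S
  · exact Or.inl fun y hy => (all y hy).2 h0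
  · exact Or.inr fun y hy e => h0 ((all y hy).1 e)

/-- A loop at a puncture bounds a self-folded triangle. -/
theorem selfFolded_of_loop [Finite D] [NeZero b] {P Q : T.Vertex}
    (h : T.IsTwicePuncturedDisk bd P Q) {l : D} (h1 : T.origin l = P)
    (h2 : T.origin (T.next l) = P) :
    ∃ l', (l' = l ∨ l' = T.glue l) ∧ T.glue (T.next l') = T.prev l' ∧ T.origin l' = P ∧
      T.origin (T.next l') = P ∧ T.origin (T.prev l') = Q := by
  have hg : T.glue l ≠ l := fun e => h.interior_left (h1 ▸ boundary_origin e)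
  obtain ⟨S, hS⟩ := h.exists_cutsOff hg (Or.inl (h1.trans h2.symm))
  rcases h.boundary_same_side (fun _ => hS.next_iff) (fun y hy _ => hS.glue_iff
    (by rintro rfl; exact h.interior_left (h1 ▸ hy))
    (by rintro rfl; exact h.interior_left (h2 ▸ T.origin_glue hg ▸ hy))) with hb | hb
  · have h1' : T.origin (T.glue l) = P := by rw [T.origin_glue hg, h2]
    have h2' : T.origin (T.next (T.glue l)) = P := by rw [T.origin_next_glue hg, h1]
    obtain ⟨r1, r2⟩ := selfFolded_of_cutsOff _ h (Nat.lt_succ_self _) hS.compl h1' h2'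
      (fun y hy hy' => hy (hb y hy'))
    exact ⟨_, Or.inr rfl, r1, h1', h2', r2⟩
  · obtain ⟨r1, r2⟩ := selfFolded_of_cutsOff _ h (Nat.lt_succ_self _) hS h1 h2
      (fun y hy hy' => hb y hy' hy)
    exact ⟨_, Or.inl rfl, r1, h1, h2, r2⟩

/-- There are no loops at the punctures. -/
def NoLoops (T : TriangulatedSurface D) : Prop :=
  ∀ l, T.origin l = T.origin (T.next l) → T.IsBoundaryVertex (T.origin l)

/-- No arc joins the punctures. -/
def NoArc (T : TriangulatedSurface D) (P Q : T.Vertex) : Prop :=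
  ¬ ∃ x, T.origin x = P ∧ T.origin (T.next x) = Q

section
variable {P Q : T.Vertex} (h : T.IsTwicePuncturedDisk bd P Q)
include h

theorem glue_ne_left {x : D} (hx : T.origin x = P) : T.glue x ≠ x :=
  fun e => h.interior_left (hx ▸ boundary_origin e)

theorem glue_ne_next_left {x : D} (hx : T.origin (T.next x) = P) : T.glue x ≠ x :=
  fun e => h.interior_left (hx ▸ h.boundary_origin_next e)

theorem noArc_symm (hno : NoArc T P Q) : NoArc T Q P := by
  rintro ⟨x, h1, h2⟩
  have hg := h.glue_ne_next_left h2
  exact hno ⟨T.glue x, by rw [T.origin_glue hg, h2], by rw [T.origin_next_glue hg, h1]⟩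

theorem noLoops_of [Finite D] [NeZero b]
    (h1 : ∀ l, T.origin l = P → T.origin (T.next l) = P → False)
    (h2 : ∀ l, T.origin l = Q → T.origin (T.next l) = Q → False) : NoLoops T := by
  intro l hl
  by_contra hb
  rcases (h.interior_iff _).1 hb with e | e
  · exact h1 l e (hl ▸ e)
  · exact h2 l e (hl ▸ e)

/-- The radius of the self-folded triangle bounded by a loop would join the punctures. -/
theorem noLoops_of_noArc [Finite D] [NeZero b] (hno : NoArc T P Q) : NoLoops T := by
  refine h.noLoops_of (fun l h1 h2 => ?_) (fun l h1 h2 => ?_)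
  · obtain ⟨l', -, -, -, o2, o3⟩ := h.selfFolded_of_loop h1 h2
    exact hno ⟨_, o2, o3⟩
  · obtain ⟨l', -, -, o1, -, o3⟩ := h.symm.selfFolded_of_loop h1 h2
    exact hno ⟨_, o3, by rw [T.next_prev, o1]⟩

/-- A puncture enclosed by a loop has one corner, and its only arc leads to the other puncture, not
to the boundary. -/
theorem noLoops_of_joined [Finite D] [NeZero b]
    (hP : ∃ y, T.origin y = P ∧ T.IsBoundaryVertex (T.origin (T.next y)))
    (hQ : ∃ y, T.origin y = Q ∧ T.IsBoundaryVertex (T.origin (T.next y))) : NoLoops T := by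
  refine h.noLoops_of (fun l h1 h2 => ?_) (fun l h1 h2 => ?_)
  · obtain ⟨l', -, s, o1, -, o3⟩ := h.selfFolded_of_loop h1 h2
    obtain ⟨y, y1, y2⟩ := hQ
    obtain rfl := eq_of_origin_eq_of_rot_fixed (rot_prev_of_selfFolded s) (o3.trans y1.symm)
    rw [T.next_prev, o1] at y2
    exact h.interior_left y2
  · obtain ⟨l', -, s, o1, -, o3⟩ := h.symm.selfFolded_of_loop h1 h2
    obtain ⟨y, y1, y2⟩ := hP
    obtain rfl := eq_of_origin_eq_of_rot_fixed (rot_prev_of_selfFolded s) (o3.trans y1.symm)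
    rw [T.next_prev, o1] at y2
    exact h.interior_right y2

/-- An arc with end points on the boundary separates the punctures. -/
theorem separates (hper : ∀ x, ¬ T.IsPeripheral x) {e : D} {S : Set D} (hS : T.CutsOff e S)
    (h1 : T.IsBoundaryVertex (T.origin e)) (h2 : T.IsBoundaryVertex (T.origin (T.next e))) :
    (∀ z, T.origin z = P → z ∈ S) ∧ (∀ z, T.origin z = Q → z ∉ S) ∨
      (∀ z, T.origin z = P → z ∉ S) ∧ (∀ z, T.origin z = Q → z ∈ S) := by
  have hall : ∀ {y z}, ¬ T.IsBoundaryVertex (T.origin y) → T.origin y = T.origin z →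
      (y ∈ S ↔ z ∈ S) := fun {y z} hy hyz => hS.origin_iff hyz (fun e => hy (e ▸ h1))
        (fun e => hy (e ▸ h2))
  have hm : ∀ {X : T.Vertex} {y : D}, ¬ T.IsBoundaryVertex X → T.origin y = X → ∀ z,
      T.origin z = X → (z ∈ S ↔ y ∈ S) := by
    rintro X y hX rfl z hz
    exact hall (hz ▸ hX) hz
  obtain ⟨p, hp⟩ := exists_origin_eq P
  obtain ⟨q, hq⟩ := exists_origin_eq Q
  -- With both punctures on one side, the other side has only boundary vertices and the arc is
  -- peripheral.
  by_cases hpS : p ∈ S <;> by_cases hqS : q ∈ S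
  · exfalso
    refine hper _ (hS.compl.isPeripheral fun y hy => h.boundary_of_ne ?_ ?_)
    · exact fun e => hy ((hm h.interior_left hp y e).2 hpS)
    · exact fun e => hy ((hm h.interior_right hq y e).2 hqS)
  · exact Or.inl ⟨fun z hz => (hm h.interior_left hp z hz).2 hpS,
      fun z hz e => hqS ((hm h.interior_right hq z hz).1 e)⟩
  · exact Or.inr ⟨fun z hz e => hpS ((hm h.interior_left hp z hz).1 e),
      fun z hz => (hm h.interior_right hq z hz).2 hqS⟩
  · exfalso
    refine hper _ (hS.isPeripheral fun y hy => h.boundary_of_ne ?_ ?_)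
    · exact fun e => hpS ((hm h.interior_left hp y e).1 hy)
    · exact fun e => hqS ((hm h.interior_right hq y e).1 hy)

/-- A triangle whose vertices lie on the boundary has a boundary segment as a side. -/
theorem exists_boundary_side [Finite D] [NeZero b] (hper : ∀ x, ¬ T.IsPeripheral x) {t : D}
    (h0 : T.IsBoundaryVertex (T.origin t)) (h1 : T.IsBoundaryVertex (T.origin (T.next t)))
    (h2 : T.IsBoundaryVertex (T.origin (T.prev t))) :
    T.glue t = t ∨ T.glue (T.next t) = T.next t ∨ T.glue (T.prev t) = T.prev t := by
  by_contra! hne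
  obtain ⟨n0, n1, n2⟩ := hne
  obtain ⟨p, hp⟩ := exists_origin_eq P
  obtain ⟨q, hq⟩ := exists_origin_eq Q
  -- If all three sides were arcs, the regions beyond them would be disjoint and each would contain
  -- a puncture, but there are only two.
  have key : ∀ e, T.glue e ≠ e → T.IsBoundaryVertex (T.origin e) →
      T.IsBoundaryVertex (T.origin (T.next e)) → ∃ R, T.CutsOff (T.glue e) R ∧ (p ∈ R ∨ q ∈ R) := by
    intro e he e1 e2
    obtain ⟨S, hS⟩ := h.exists_cutsOff he (Or.inr ⟨e1, e2⟩)
    refine ⟨Sᶜ, hS.compl, ?_⟩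
    rcases h.separates hper hS e1 e2 with ⟨-, h'⟩ | ⟨h', -⟩
    · exact Or.inr (h' q hq)
    · exact Or.inl (h' p hp)
  obtain ⟨R0, c0, m0⟩ := key _ n0 h0 h1
  obtain ⟨R1, c1, m1⟩ := key _ n1 h1 h2
  obtain ⟨R2, c2, m2⟩ := key _ n2 h2 (by rwa [T.next_prev])
  have a0 : t ∉ R0 := by have := c0.glue_notMem; rwa [T.glue_glue] at this
  have a1 : t ∉ R1 := by have := c1.glue_notMem; rwa [T.glue_glue, c1.next_iff] at this
  have a2 : t ∉ R2 := by have := c2.glue_notMem; rwa [T.glue_glue, c2.prev_iff] at this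
  have d : ∀ {e e' : D} {R R' : Set D}, T.CutsOff (T.glue e) R → T.CutsOff (T.glue e') R' →
      e ≠ e' → e ∉ R' → e' ∉ R → ∀ z, z ∈ R → z ∉ R' := fun hR hR' hne he he' z hz =>
    hR.disjoint h.connected hR' (fun e => hne (T.glue_inj.1 e)) (by rwa [T.glue_glue])
      (by rwa [T.glue_glue]) hz
  have d01 := d c0 c1 (T.next_ne t).symm a1 (by rwa [c0.next_iff])
  have d02 := d c0 c2 (T.prev_ne t).symm a2 (by rwa [c0.prev_iff])
  have d12 := d c1 c2 (T.prev_ne_next t).symm (by rwa [c2.next_iff]) (by rwa [c1.prev_iff])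
  have := d01 p
  have := d02 p
  have := d12 p
  have := d01 q
  have := d02 q
  have := d12 q
  tauto

theorem boundary_of_corner (hl : NoLoops T) (hno : NoArc T P Q) {z : D} (hz : T.origin z = P) :
    T.IsBoundaryVertex (T.origin (T.next z)) ∧ T.IsBoundaryVertex (T.origin (T.prev z)) := by
  constructor
  · refine h.boundary_of_ne (fun e => ?_) (fun e => hno ⟨z, hz, e⟩)
    exact h.interior_left (hz ▸ hl z (hz.trans e.symm))
  · refine h.boundary_of_ne (fun e => ?_)
      (fun e => h.noArc_symm hno ⟨T.prev z, e, by rw [T.next_prev, hz]⟩)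
    exact h.interior_left (e ▸ hl (T.prev z) (by rw [T.next_prev, hz, e]))

/-- At a puncture, at most one corner has an arc as its opposite side. -/
theorem corner_unique [Finite D] [NeZero b] (hper : ∀ x, ¬ T.IsPeripheral x)
    (hno : NoArc T P Q) {z z' : D} (hz : T.origin z = P) (hz' : T.origin z' = P)
    (hg : T.glue (T.next z) ≠ T.next z) (hg' : T.glue (T.next z') ≠ T.next z') : z = z' := by
  by_contra hne
  have hl := h.noLoops_of_noArc hno
  have key : ∀ y, T.origin y = P → T.glue (T.next y) ≠ T.next y → ∃ S, T.CutsOff (T.next y) S ∧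
      (∀ x, T.origin x = P → x ∈ S) ∧ (∀ x, T.origin x = Q → x ∉ S) := by
    intro y hy hgy
    have hb := h.boundary_of_corner hl hno hy
    obtain ⟨S, hS⟩ := h.exists_cutsOff hgy (Or.inr hb)
    rcases h.separates hper hS hb.1 hb.2 with h' | h'
    · exact ⟨S, hS, h'⟩
    · exact absurd (hS.next_iff.1 hS.mem) (h'.1 y hy)
  obtain ⟨S, hS, SP, SQ⟩ := key z hz hg
  obtain ⟨R, hR, RP, RQ⟩ := key z' hz' hg'
  -- The region between the two opposite arcs contains neither P, which lies in `R`, nor Q, which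
  -- lies outside `S`; so one of the arcs is peripheral.
  have hX : T.CutsOff (T.glue (T.next z')) (Rᶜ ∩ S) :=
    { mem := ⟨hR.compl.mem, hS.glue _ (hS.next_iff.2 (SP z' hz')) fun e =>
        hne (T.next_inj.1 e).symm⟩
      glue_notMem := fun e => hR.compl.glue_notMem e.1
      next := fun y hy => ⟨hR.compl.next y hy.1, hS.next y hy.2⟩
      glue := fun y hy hy' => ⟨hR.compl.glue y hy.1 hy', hS.glue y hy.2 fun e =>
        hy.1 (e ▸ hR.next_iff.2 (RP z hz))⟩ }
  exact hper _ (hX.isPeripheral fun y hy => h.boundary_of_ne (fun e => hy.1 (RP y e))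
    (fun e => SQ y e hy.2))

/-- At most one arc joins the punctures if there are no loops at them. -/
theorem arc_unique [Finite D] [NeZero b] (hl : NoLoops T) {x y : D} (hxP : T.origin x = P)
    (hxQ : T.origin (T.next x) = Q) (hyP : T.origin y = P) (hyQ : T.origin (T.next y) = Q) :
    x = y := by
  by_contra hxy
  have hx := h.glue_ne_left hxP
  have hy := h.glue_ne_left hyP
  obtain ⟨S, h1, h2, h3, h4⟩ := h.exists_bigon hxP hxQ hyP hyQ hxy
  -- All boundary vertices lie on one side of the bigon. On the other side, the triangle along `x`
  -- has its third vertex at a puncture, which makes one of its sides a loop.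
  rcases h.boundary_same_side h3 (fun z hz _ => h4 z
    (by rintro rfl; exact h.ne_left hz hxP) (by rintro rfl; exact h.ne_left hz hyP)
    (by rintro rfl; exact h.ne_right hz (by rw [T.origin_glue hx, hxQ]))
    (by rintro rfl; exact h.ne_right hz (by rw [T.origin_glue hy, hyQ]))) with hb | hb
  · have o1 : T.origin (T.glue x) = Q := by rw [T.origin_glue hx, hxQ]
    have o2 : T.origin (T.next (T.glue x)) = P := by rw [T.origin_next_glue hx, hxP]
    have := mt (hb (T.prev (T.glue x))) (by rwa [prev, h3, h3])
    rcases (h.interior_iff _).1 this with e | e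
    · exact h.interior_left (o2 ▸ hl _ (o2.trans e.symm))
    · exact h.interior_right (e ▸ hl (T.prev (T.glue x)) (by rw [e, T.next_prev, o1]))
  · have : ¬ T.IsBoundaryVertex (T.origin (T.prev x)) :=
      fun e => hb (T.prev x) e (by rwa [prev, h3, h3])
    rcases (h.interior_iff _).1 this with e | e
    · exact h.interior_left (e ▸ hl (T.prev x) (by rw [e, T.next_prev, hxP]))
    · exact h.interior_right (hxQ ▸ hl _ (hxQ.trans e.symm))

/-- If an arc joins the punctures, an edge with both ends on the boundary is a boundary segment. -/
theorem glue_eq_of_arc [Finite D] [NeZero b] (hper : ∀ x, ¬ T.IsPeripheral x) {x e : D}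
    (hx : T.origin x = P) (hx' : T.origin (T.next x) = Q) (h1 : T.IsBoundaryVertex (T.origin e))
    (h2 : T.IsBoundaryVertex (T.origin (T.next e))) : T.glue e = e := by
  by_contra hg
  obtain ⟨S, hS⟩ := h.exists_cutsOff hg (Or.inr ⟨h1, h2⟩)
  -- The triangle of `x` has corners at both punctures, yet lies on one side of the arc.
  rcases h.separates hper hS h1 h2 with h' | h'
  · exact h'.2 _ hx' (hS.next_iff.2 (h'.1 _ hx))
  · exact h'.1 _ hx (hS.next_iff.1 (h'.2 _ hx'))

end

end IsTwicePuncturedDisk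

end TriangulatedSurface

/-! ### Friezes and continuants -/

/-- The matrix whose products have continuants as entries. -/
def continuantMatrix (a : ℤ) : Matrix (Fin 2) (Fin 2) ℤ := !![a, -1; 1, 0]

/-- The product of the continuant matrices of `a i`, …, `a (i + n - 1)`. -/
def continuantProd (a : ℤ → ℤ) (i : ℤ) : ℕ → Matrix (Fin 2) (Fin 2) ℤ
  | 0 => 1
  | n + 1 => continuantProd a i n * continuantMatrix (a (i + n))

/-- The frieze of continuants with quiddity sequence `a`. -/
def continuantFrieze (a : ℤ → ℤ) : ℕ → ℤ → ℤ
  | 0, _ => 0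
  | 1, _ => 1
  | r + 2, i => a (i + r) * continuantFrieze a (r + 1) i - continuantFrieze a r i

/-- One identity gives both frieze properties: determinant 1 is the diamond rule, and the trace is
the difference defining growth. -/
theorem continuantProd_succ (a : ℤ → ℤ) (i : ℤ) (n : ℕ) :
    continuantProd a i (n + 1) =
      !![continuantFrieze a (n + 2) i, -continuantFrieze a (n + 1) i;
        continuantFrieze a (n + 1) (i + 1), -continuantFrieze a n (i + 1)] := by
  induction n with
  | zero => simp [continuantProd, continuantMatrix, continuantFrieze]
  | succ n ih =>
    rw [continuantProd, ih, continuantMatrix, Matrix.mul_fin_two]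
    have e : i + ((n + 1 : ℕ) : ℤ) = i + 1 + n := by push_cast; ring
    have h1 : continuantFrieze a (n + 1 + 2) i = a (i + ((n + 1 : ℕ) : ℤ)) *
      continuantFrieze a (n + 2) i - continuantFrieze a (n + 1) i := rfl
    have h2 : continuantFrieze a (n + 1 + 1) (i + 1) = a (i + 1 + n) *
      continuantFrieze a (n + 1) (i + 1) - continuantFrieze a n (i + 1) := rfl
    rw [h1, h2, e]
    congr 1
    ext j k
    fin_cases j <;> fin_cases k <;> simp <;> ring

theorem det_continuantProd (a : ℤ → ℤ) (i : ℤ) (n : ℕ) : (continuantProd a i n).det = 1 := by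
  induction n with
  | zero => exact Matrix.det_one
  | succ n ih =>
    rw [continuantProd, Matrix.det_mul, ih, continuantMatrix, Matrix.det_fin_two_of]
    ring

theorem continuantFrieze_diamond (a : ℤ → ℤ) (r : ℕ) (i : ℤ) :
    continuantFrieze a (r + 1) i * continuantFrieze a (r + 1) (i + 1) -
      continuantFrieze a r (i + 1) * continuantFrieze a (r + 2) i = 1 := by
  have := det_continuantProd a i (r + 1)
  rw [continuantProd_succ, Matrix.det_fin_two_of] at this
  linarith

theorem continuantFrieze_growth (a : ℤ → ℤ) (i : ℤ) (n : ℕ) :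
    (continuantProd a i (n + 1)).trace =
      continuantFrieze a (n + 2) i - continuantFrieze a n (i + 1) := by
  rw [continuantProd_succ, Matrix.trace_fin_two_of]
  ring

/-- With coefficients at least 2 the recursion is convex: each increment is at least the previous
one, and the first is 1. -/
theorem continuantFrieze_mono {a : ℤ → ℤ} (ha : ∀ i, 2 ≤ a i) (r : ℕ) (i : ℤ) :
    0 ≤ continuantFrieze a r i ∧ continuantFrieze a r i + 1 ≤ continuantFrieze a (r + 1) i := by
  induction r with
  | zero => simp [continuantFrieze]
  | succ r ih =>
    obtain ⟨h1, h2⟩ := ih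
    refine ⟨by linarith, ?_⟩
    rw [continuantFrieze]
    nlinarith [ha (i + r)]

theorem isFriezeOf_continuantFrieze {b : ℕ} {a : ZMod b → ℕ} (ha : ∀ i, 2 ≤ a i) :
    IsFriezeOf a (continuantFrieze fun i => (a (i : ZMod b) : ℤ)) := by
  have ha' : ∀ i : ℤ, 2 ≤ (a (i : ZMod b) : ℤ) := fun i => by exact_mod_cast ha _
  refine ⟨⟨fun _ => rfl, fun _ => rfl, fun r i => ?_, continuantFrieze_diamond _⟩, fun i => ?_⟩
  · have h1 := continuantFrieze_mono ha' (r + 1) i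
    exact lt_of_lt_of_le (by linarith) h1.2
  · simp [continuantFrieze]

theorem IsFriezeOf.unique {b : ℕ} {a : ZMod b → ℕ} {F G : ℕ → ℤ → ℤ} (hF : IsFriezeOf a F)
    (hG : IsFriezeOf a G) : F = G := by
  have key : ∀ r, F r = G r ∧ F (r + 1) = G (r + 1) := by
    intro r
    induction r with
    | zero =>
      exact ⟨funext fun i => by rw [hF.1.row_zero, hG.1.row_zero],
        funext fun i => by rw [zero_add, hF.1.row_one, hG.1.row_one]⟩
    | succ r ih =>
      refine ⟨ih.2, funext fun i => ?_⟩
      cases r with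
      | zero => exact (hF.2 i).trans (hG.2 i).symm
      | succ r =>
        have h1 := hF.1.diamond (r + 1) i
        have h2 := hG.1.diamond (r + 1) i
        -- The diamond rule determines the bottom entry once the top entry is nonzero. Under the row
        -- of zeros this fails, which is why the quiddity row is treated separately.
        have hpos : 0 < G (r + 1) (i + 1) := by
          cases r with
          | zero => rw [zero_add, hG.1.row_one]; exact one_pos
          | succ r => exact hG.1.pos r _
        rw [ih.1, ih.2] at h1
        exact mul_left_cancel₀ hpos.ne' (by linarith)
  exact funext fun r => (key r).1

theorem exists_unique_frieze {b : ℕ} (hb : 1 ≤ b) {a : ZMod b → ℕ} (ha : ∀ i, 2 ≤ a i) {s : ℤ}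
    (hs : ∀ i : ℤ, (continuantProd (fun j => (a (j : ZMod b) : ℤ)) i b).trace = s) :
    (∃! F : ℕ → ℤ → ℤ, IsFriezeOf a F) ∧
      ∀ F : ℕ → ℤ → ℤ, IsFriezeOf a F → HasGrowthCoefficient F b s := by
  have h := isFriezeOf_continuantFrieze ha
  refine ⟨⟨_, h, fun F hF => hF.unique h⟩, fun F hF i => ?_⟩
  obtain ⟨n, rfl⟩ : ∃ n, b = n + 1 := ⟨b - 1, by omega⟩
  rw [hF.unique h, ← hs i, continuantFrieze_growth]
  rfl

/-! ### Words along the boundary of a surface -/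

namespace TriangulatedSurface

variable {D : Type u} (T : TriangulatedSurface D)

/-- The matrix by which a corner of a triangle contributes to a word. -/
def cornerMatrix : Matrix (Fin 2) (Fin 2) ℤ := !![1, 1; 0, 1]

/-- The matrix by which a boundary segment contributes to a word. -/
def segmentMatrix : Matrix (Fin 2) (Fin 2) ℤ := !![0, -1; 1, 0]

theorem cornerMatrix_pow (n : ℕ) : cornerMatrix ^ n = !![1, (n : ℤ); 0, 1] := by
  induction n with
  | zero => simp [Matrix.one_fin_two]
  | succ n ih => rw [pow_succ, ih, cornerMatrix, Matrix.mul_fin_two]; simp [add_comm]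

/-- A boundary vertex with n corners, together with the segment starting there, contributes one
continuant matrix. -/
theorem cornerMatrix_pow_mul (n : ℕ) :
    cornerMatrix ^ n * segmentMatrix = continuantMatrix n := by
  rw [cornerMatrix_pow, segmentMatrix, continuantMatrix, Matrix.mul_fin_two]
  simp

open Classical in
/-- The contribution of the corner at the start of `x` and, if it is a boundary segment, of `x`. -/
noncomputable def weight (x : D) : Matrix (Fin 2) (Fin 2) ℤ :=
  if T.glue x = x then cornerMatrix * segmentMatrix else cornerMatrix

theorem weight_of_eq {x : D} (h : T.glue x = x) : T.weight x = cornerMatrix * segmentMatrix :=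
  if_pos h

theorem weight_of_ne {x : D} (h : T.glue x ≠ x) : T.weight x = cornerMatrix := if_neg h

/-- The product of the contributions of `n` consecutive corners. -/
noncomputable def word : ℕ → D → Matrix (Fin 2) (Fin 2) ℤ
  | 0, _ => 1
  | n + 1, x => T.weight x * word n (T.rot x)

theorem word_succ' (n : ℕ) (x : D) : T.word (n + 1) x = T.word n x * T.weight (T.rot^[n] x) := by
  induction n generalizing x with
  | zero => simp [word]
  | succ n ih => rw [word, ih, word, mul_assoc, Function.iterate_succ_apply]

/-- The trace of the word along the cycle of `x`. -/
noncomputable def wordTrace (x : D) : ℤ := (T.word (Function.minimalPeriod T.rot x) x).trace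

theorem wordTrace_rot [Finite D] (x : D) : T.wordTrace (T.rot x) = T.wordTrace x := by
  have hx := T.rot.injective.mem_periodicPts x
  rw [wordTrace, wordTrace, Function.minimalPeriod_apply hx]
  obtain ⟨k, hk⟩ : ∃ k, Function.minimalPeriod T.rot x = k + 1 :=
    ⟨_, (Nat.succ_pred_eq_of_pos (Function.minimalPeriod_pos_of_mem_periodicPts hx)).symm⟩
  rw [hk, word_succ', word, Matrix.trace_mul_comm, ← Function.iterate_succ_apply, Nat.succ_eq_add_one,
    ← hk, Function.iterate_minimalPeriod]

theorem wordTrace_eq_of_sameCycle [Finite D] {x y : D} (h : T.rot.SameCycle x y) :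
    T.wordTrace x = T.wordTrace y := by
  obtain ⟨n, hn⟩ := h.exists_nat_pow_eq
  rw [Equiv.Perm.coe_pow] at hn
  subst hn
  induction n with
  | zero => rfl
  | succ n ih =>
    rw [Function.iterate_succ_apply', wordTrace_rot]
    exact ih ⟨n, by rw [zpow_natCast, Equiv.Perm.coe_pow]⟩

/-- A sequence of consecutive corners from `s` to `y` which does not return to `s`, with the
product of the contributions of all corners except `y`. -/
inductive Path (s : D) : D → Matrix (Fin 2) (Fin 2) ℤ → Prop
  | refl : Path s s 1
  | step {y : D} {M : Matrix (Fin 2) (Fin 2) ℤ} (p : Path s y M) (h : T.rot y ≠ s) :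
      Path s (T.rot y) (M * T.weight y)

variable {T}

theorem Path.exists_word {s y : D} {M : Matrix (Fin 2) (Fin 2) ℤ} (p : T.Path s y M) :
    ∃ n, T.rot^[n] s = y ∧ T.word n s = M ∧ ∀ k, 0 < k → k ≤ n → T.rot^[k] s ≠ s := by
  induction p with
  | refl => exact ⟨0, rfl, rfl, fun k h1 h2 => absurd h1 (by omega)⟩
  | @step y M p h ih =>
    obtain ⟨n, h1, h2, h3⟩ := ih
    refine ⟨n + 1, by rw [Function.iterate_succ_apply', h1], by rw [word_succ', h1, h2],
      fun k hk hk' => ?_⟩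
    rcases Nat.lt_or_ge n k with hlt | hle
    · obtain rfl : k = n + 1 := by omega
      rw [Function.iterate_succ_apply', h1]
      exact h
    · exact h3 k hk hle

/-- Since the path avoids returning to `s`, closing it up traverses the cycle exactly once, so its
length is the minimal period. -/
theorem Path.wordTrace_eq {s y : D} {M : Matrix (Fin 2) (Fin 2) ℤ} (p : T.Path s y M)
    (h : T.rot y = s) : T.wordTrace s = (M * T.weight y).trace := by
  obtain ⟨n, h1, h2, h3⟩ := p.exists_word
  have hp : T.rot^[n + 1] s = s := by rw [Function.iterate_succ_apply', h1, h]
  have hm : Function.minimalPeriod T.rot s = n + 1 := by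
    refine le_antisymm (Function.IsPeriodicPt.minimalPeriod_le (Nat.succ_pos n) hp) ?_
    by_contra! hlt
    exact h3 _ (Function.minimalPeriod_pos_of_mem_periodicPts ⟨n + 1, Nat.succ_pos n, hp⟩)
      (by omega) Function.iterate_minimalPeriod
  rw [wordTrace, hm, word_succ', h1, h2]

theorem Path.fan {s x y : D} {M : Matrix (Fin 2) (Fin 2) ℤ} (p : T.Path s x M) {n : ℕ}
    (hf : T.FanEnds x y n) (hs : ∀ j, 0 < j → j ≤ n → T.rot^[j] x ≠ s) :
    T.Path s y (M * cornerMatrix ^ n) := by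
  have key : ∀ j ≤ n, T.Path s (T.rot^[j] x) (M * cornerMatrix ^ j) := by
    intro j hj
    induction j with
    | zero => simpa using p
    | succ j ih =>
      have := (ih (by omega)).step (by
        rw [← Function.iterate_succ_apply' T.rot j x]; exact hs (j + 1) (by omega) hj)
      rwa [T.weight_of_ne (hf.2.2 j (by omega)), mul_assoc, ← pow_succ,
        ← Function.iterate_succ_apply' T.rot j x] at this
  exact hf.1 ▸ key n le_rfl

namespace IsTwicePuncturedDisk

variable {b : ℕ} {bd : ZMod b → D} {P Q : T.Vertex} (h : T.IsTwicePuncturedDisk bd P Q)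
include h

theorem rot_bd (i : ZMod b) : T.rot (bd i) = T.next (bd i) := by rw [T.rot_apply, h.glue_bd]

theorem exists_fanEnds (i : ZMod b) : ∃ n, T.FanEnds (T.next (bd i)) (bd (i + 1)) n ∧
    T.cornerCount (T.origin (bd (i + 1))) = n + 1 := by
  obtain ⟨n, hn⟩ := FanEnds.exists_of_origin_eq (h.bd_succ i) ⟨0, FanEnds.zero (h.glue_bd (i + 1))⟩
  exact ⟨n, hn, by rw [h.bd_succ, hn.cornerCount (by rw [T.prev_next, h.glue_bd])]⟩

/-- A vertex with one corner belongs to a triangle with two consecutive boundary segments. Its third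
side is peripheral, unless the triangle is the whole surface, which then has no puncture. -/
theorem two_le_cornerCount (hper : ∀ x, ¬ T.IsPeripheral x) (i : ZMod b) :
    2 ≤ T.cornerCount (T.origin (bd i)) := by
  obtain ⟨j, rfl⟩ : ∃ j, i = j + 1 := ⟨i - 1, by ring⟩
  obtain ⟨n, hn, hc⟩ := h.exists_fanEnds j
  rcases Nat.eq_zero_or_pos n with rfl | hpos
  · exfalso
    have e : T.next (bd j) = bd (j + 1) := hn.1
    have hS : ∀ y, T.SameTriangle (bd j) y → T.IsBoundaryVertex (T.origin y) := by
      rintro y (rfl | rfl | rfl)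
      · exact h.boundary_bd j
      · exact h.boundary_origin_next (h.glue_bd j)
      · rw [← T.next_next, e]
        exact h.boundary_origin_next (h.glue_bd _)
    have hg : ∀ y, T.SameTriangle (bd j) y → y ≠ T.prev (bd j) → T.glue y = y := by
      rintro y (rfl | rfl | rfl) hy
      · exact h.glue_bd j
      · rw [e, h.glue_bd]
      · exact absurd rfl hy
    by_cases hp : T.SameTriangle (bd j) (T.glue (T.prev (bd j)))
    · have : {y | T.SameTriangle (bd j) y} = Set.univ := by
        refine h.connected.2 _ ⟨bd j, T.sameTriangle_refl (bd j)⟩ fun y hy => ⟨hy.next, ?_⟩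
        by_cases hy' : y = T.prev (bd j)
        · rw [hy']; exact hp
        · rw [Set.mem_ofPred_eq, hg y hy hy']; exact hy
      obtain ⟨p, hp⟩ := exists_origin_eq P
      exact h.interior_left (hp ▸ hS p (this ▸ Set.mem_univ p : p ∈ {y | T.SameTriangle (bd j) y}))
    · have hcut : T.CutsOff (T.prev (bd j)) {y | T.SameTriangle (bd j) y} :=
        ⟨Or.inr (Or.inr rfl), hp, fun y hy => hy.next, fun y hy hy' => by
          rw [hg y hy hy']; exact hy⟩
      exact hper _ (hcut.isPeripheral hS)
  · omega

theorem wordTrace_eq_of_boundary [Finite D] [NeZero b] {x y : D}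
    (hx : T.IsBoundaryVertex (T.origin x)) (hy : T.IsBoundaryVertex (T.origin y)) :
    T.wordTrace x = T.wordTrace y := by
  have key : ∀ n : ℕ, T.wordTrace (bd (n : ZMod b)) = T.wordTrace (bd 0) := by
    intro n
    induction n with
    | zero => rw [Nat.cast_zero]
    | succ n ih =>
      rw [Nat.cast_succ, T.wordTrace_eq_of_sameCycle (T.sameCycle_of_origin_eq (h.bd_succ _)),
        ← h.rot_bd, wordTrace_rot, ih]
  have all : ∀ z, T.IsBoundaryVertex (T.origin z) → T.wordTrace z = T.wordTrace (bd 0) := by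
    intro z hz
    obtain ⟨i, hi⟩ := h.exists_origin_bd hz
    have := key i.val
    rw [ZMod.natCast_rightInverse] at this
    rw [T.wordTrace_eq_of_sameCycle (T.sameCycle_of_origin_eq hi.symm), this]
  rw [all x hx, all y hy]

theorem trace_continuantProd [Finite D] [NeZero b] {x : D}
    (hx : T.IsBoundaryVertex (T.origin x)) (i : ℤ) :
    (continuantProd (fun j : ℤ => (T.cornerCount (T.origin (bd (j : ZMod b))) : ℤ)) i b).trace =
      T.wordTrace x := by
  set a : ℤ → ℤ := fun j : ℤ => (T.cornerCount (T.origin (bd (j : ZMod b))) : ℤ) with ha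
  -- The first corner at vertex i follows the segment i - 1, so the word is read from `T.next (bd
  -- c)`.
  set c : ZMod b := (i : ZMod b) - 1 with hc
  set s := T.next (bd c) with hs
  have hfan : ∀ (n : ℕ) {M}, n < b → T.Path s (T.next (bd (c + n))) M →
      ∃ M', T.Path s (bd (c + (n + 1 : ℕ))) M' ∧
        M' * T.weight (bd (c + (n + 1 : ℕ))) = M * continuantMatrix (a (i + n)) := by
    intro n M hn p
    obtain ⟨m, hm, hcc⟩ := h.exists_fanEnds (c + n)
    have e : c + (n : ZMod b) + 1 = c + ((n + 1 : ℕ) : ZMod b) := by push_cast; ring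
    have e' : ((i + n : ℤ) : ZMod b) = c + (n : ZMod b) + 1 := by rw [hc]; push_cast; ring
    rw [e] at hm
    refine ⟨_, p.fan hm fun j hj hj' hjs => ?_, ?_⟩
    · rcases Nat.eq_zero_or_pos n with rfl | hpos
      · rw [Nat.cast_zero, add_zero] at hjs hm
        have := hm.injOn hj' (Nat.zero_le m) hjs
        omega
      -- Returning to `s` would identify the vertices c + n + 1 and c + 1, which differ for 0 < n <
      -- b.
      · have h1 := hm.origin_iterate hj'
        rw [hjs, hs, ← h.bd_succ, ← h.bd_succ] at h1
        have h2 := h.origin_bd_injective h1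
        have h3 : (n : ZMod b) = 0 := by linear_combination -h2
        rw [ZMod.natCast_eq_zero_iff] at h3
        exact absurd (Nat.le_of_dvd hpos h3) (by omega)
    · rw [T.weight_of_eq (h.glue_bd _), mul_assoc, ← mul_assoc (cornerMatrix ^ m), ← pow_succ,
        cornerMatrix_pow_mul, ha, ← hcc]
      simp only [e']
  have hpath : ∀ n : ℕ, n < b → T.Path s (T.next (bd (c + n))) (continuantProd a i n) := by
    intro n hn
    induction n with
    | zero =>
      rw [Nat.cast_zero, add_zero]
      exact Path.refl
    | succ n ih =>
      obtain ⟨M', p, hM⟩ := hfan n (by omega) (ih (by omega))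
      have := p.step (by
        rw [h.rot_bd, hs, Ne, T.next_inj]
        intro e
        have h2 := h.bd_injective e
        have h3 : ((n + 1 : ℕ) : ZMod b) = 0 := by linear_combination h2
        rw [ZMod.natCast_eq_zero_iff] at h3
        exact absurd (Nat.le_of_dvd (Nat.succ_pos n) h3) (by omega))
      rwa [hM, h.rot_bd] at this
  obtain ⟨n, hn⟩ : ∃ n, b = n + 1 := ⟨b - 1, by have := NeZero.pos b; omega⟩
  obtain ⟨M', p, hM⟩ := hfan n (by omega) (hpath n (by omega))
  have e0 : c + ((n + 1 : ℕ) : ZMod b) = c := by rw [← hn, ZMod.natCast_self, add_zero]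
  have := p.wordTrace_eq (by rw [e0, h.rot_bd])
  rw [hM] at this
  have hcp : continuantProd a i b = continuantProd a i n * continuantMatrix (a (i + n)) := by
    rw [hn]; rfl
  rw [hcp, ← this]
  exact h.wordTrace_eq_of_boundary (by rw [hs, ← h.bd_succ]; exact h.boundary_bd _) hx

end IsTwicePuncturedDisk

end TriangulatedSurface

/-! ### Walking around a puncture. -/

namespace TriangulatedSurface

variable {D : Type u} {T : TriangulatedSurface D}

/-- The contribution of a triangle at a puncture whose opposite side is a boundary segment. -/
def starMatrix : Matrix (Fin 2) (Fin 2) ℤ := !![2, -1; 1, 0]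

theorem starMatrix_eq : cornerMatrix * (cornerMatrix * segmentMatrix) = starMatrix := by
  simp [cornerMatrix, segmentMatrix, starMatrix]

/-- `starMatrix` is the identity plus a matrix of square zero, so its powers are linear in the
exponent. This is how p and q enter the trace. -/
theorem starMatrix_pow (n : ℕ) : starMatrix ^ n = !![(n : ℤ) + 1, -n; n, 1 - n] := by
  induction n with
  | zero => simp [Matrix.one_fin_two]
  | succ n ih =>
    rw [pow_succ, ih, starMatrix, Matrix.mul_fin_two]
    push_cast
    congr 1
    ext j k
    fin_cases j <;> fin_cases k <;> simp <;> ring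

theorem rot_iterate_symm (k : ℕ) (z : D) : T.rot^[k] (T.rot.symm^[k] z) = z :=
  Function.LeftInverse.iterate (T.rot.apply_symm_apply) k z

theorem rot_symm_iterate_ne {k j : ℕ} {z : D} (h0 : 0 < k + j)
    (h : k + j < Function.minimalPeriod T.rot z) : T.rot.symm^[k] z ≠ T.rot^[j] z := by
  intro e
  have := rot_iterate_symm (T := T) k z
  rw [e, ← Function.iterate_add_apply] at this
  exact absurd (Function.IsPeriodicPt.minimalPeriod_le h0 this) (by omega)

theorem rot_symm_iterate_eq {k j : ℕ} {z : D} (h : k + j = Function.minimalPeriod T.rot z) :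
    T.rot.symm^[k] z = T.rot^[j] z := by
  apply T.rot.injective.iterate k
  rw [rot_iterate_symm, ← Function.iterate_add_apply, h, Function.iterate_minimalPeriod]

namespace IsTwicePuncturedDisk

variable {b : ℕ} {bd : ZMod b → D} {P Q : T.Vertex} (h : T.IsTwicePuncturedDisk bd P Q)
include h

theorem minimalPeriod_eq [Finite D] {z : D} (hz : T.origin z = P) :
    Function.minimalPeriod T.rot z = T.cornerCount P := by
  rw [← hz, cornerCount_interior (hz ▸ h.interior_left)]

theorem origin_rot_symm {z : D} (hz : T.origin z = P) (k : ℕ) :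
    T.origin (T.rot.symm^[k] z) = P := by
  induction k with
  | zero => exact hz
  | succ k ih =>
    rw [Function.iterate_succ_apply', T.rot_symm_apply, T.origin_glue, T.next_prev, ih]
    exact h.glue_ne_next_left (by rw [T.next_prev, ih])

/-- Walking around the puncture `P`. -/
theorem path_star {s z : D} {M : Matrix (Fin 2) (Fin 2) ℤ} (hs : T.glue s ≠ s)
    (hz : T.origin z = P) (p : T.Path s (T.prev z) M) (K : ℕ)
    (hK : ∀ k, 0 < k → k ≤ K → T.glue (T.next (T.rot.symm^[k] z)) = T.next (T.rot.symm^[k] z) ∧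
      T.prev (T.rot.symm^[k] z) ≠ s) :
    ∃ y, T.Path s y (M * starMatrix ^ K) ∧ T.rot y = T.next (T.rot.symm^[K + 1] z) ∧
      T.weight y = cornerMatrix := by
  have hw : ∀ k, T.weight (T.prev (T.rot.symm^[k] z)) = cornerMatrix := fun k =>
    T.weight_of_ne (h.glue_ne_next_left (by rw [T.next_prev, h.origin_rot_symm hz]))
  -- The boundary walk goes counterclockwise around P, whereas `rot` turns clockwise at a vertex;
  -- hence the inverse permutation.
  have hr : ∀ k, T.rot (T.prev (T.rot.symm^[k] z)) = T.next (T.rot.symm^[k + 1] z) := fun k => by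
    rw [Function.iterate_succ_apply' T.rot.symm, T.rot_symm_apply, T.rot_apply]
  refine ⟨_, ?_, hr K, hw K⟩
  induction K with
  | zero => simpa using p
  | succ K ih =>
    obtain ⟨k1, k2⟩ := hK (K + 1) (Nat.succ_pos K) le_rfl
    have p1 := (ih fun k hk hk' => hK k hk (by omega)).step (by
      rw [hr]; intro e; rw [e] at k1; exact hs k1)
    rw [hr, hw] at p1
    have hr' : T.rot (T.next (T.rot.symm^[K + 1] z)) = T.prev (T.rot.symm^[K + 1] z) := by
      rw [T.rot_apply, k1, T.next_next]
    have p2 := p1.step (by rw [hr']; exact k2)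
    rwa [hr', T.weight_of_eq k1, mul_assoc, mul_assoc, starMatrix_eq, ← pow_succ] at p2

/-! ### The word if an arc joins the punctures -/

theorem apex_boundary (hl : NoLoops T) {x : D} (hx : T.origin x = P) (hx' : T.origin (T.next x) = Q) :
    T.IsBoundaryVertex (T.origin (T.prev x)) := by
  refine h.boundary_of_ne (fun e => ?_) (fun e => ?_)
  · exact h.interior_left (e ▸ hl (T.prev x) (by rw [T.next_prev, e, hx]))
  · exact h.interior_right (hx' ▸ hl (T.next x) (hx'.trans e.symm))

theorem two_le_cornerCount_of_arc [Finite D] (hl : NoLoops T) {x : D} (hx : T.origin x = P)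
    (hx' : T.origin (T.next x) = Q) : 2 ≤ T.cornerCount P := by
  rw [← h.minimalPeriod_eq hx]
  have hpos := Function.minimalPeriod_pos_of_mem_periodicPts (T.rot.injective.mem_periodicPts x)
  by_contra! hlt
  have h1 : T.rot x = x := Function.minimalPeriod_eq_one_iff_isFixedPt.1
    (show Function.minimalPeriod T.rot x = 1 by omega)
  rw [T.rot_apply, T.next_eq_iff] at h1
  have := T.origin_glue (h.glue_ne_left hx)
  rw [h1, hx'] at this
  exact h.ne_right (h.apex_boundary hl hx hx') this

theorem path_star_of_arc [Finite D] [NeZero b] (hper : ∀ x, ¬ T.IsPeripheral x) (hl : NoLoops T)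
    {x s : D} {M : Matrix (Fin 2) (Fin 2) ℤ} (hx : T.origin x = P) (hx' : T.origin (T.next x) = Q)
    (hs : T.glue s ≠ s) (hs' : ∀ z, T.origin z = P → z ≠ x → T.prev z ≠ s)
    (p : T.Path s (T.prev x) M) :
    ∃ y, T.Path s y (M * starMatrix ^ (T.cornerCount P - 2)) ∧ T.rot y = T.prev (T.glue x) ∧
      T.weight y = cornerMatrix := by
  have h2 := h.two_le_cornerCount_of_arc hl hx hx'
  -- Only the two corners at P next to the arc, `x` and `T.rot x`, are not opposite to a boundary
  -- segment.
  obtain ⟨y, y1, y2, y3⟩ := h.path_star hs hx p (T.cornerCount P - 2) (fun k hk hk' => by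
    have o := h.origin_rot_symm hx k
    have n0 : T.rot.symm^[k] x ≠ x := rot_symm_iterate_ne (j := 0) (by omega)
      (by rw [h.minimalPeriod_eq hx]; omega)
    have n1 : T.rot.symm^[k] x ≠ T.rot x := rot_symm_iterate_ne (j := 1) (by omega)
      (by rw [h.minimalPeriod_eq hx]; omega)
    set z := T.rot.symm^[k] x
    refine ⟨h.glue_eq_of_arc hper hx hx' ?_ ?_, hs' z o n0⟩
    · refine h.boundary_of_ne (fun e => ?_) (fun e => n0 (h.arc_unique hl o e hx hx'))
      exact h.interior_left (o ▸ hl z (o.trans e.symm))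
    · have hg : T.glue (T.prev z) ≠ T.prev z := h.glue_ne_next_left (by rw [T.next_prev, o])
      refine h.boundary_of_ne (fun e => ?_) (fun e => n1 ?_)
      · exact h.interior_left (e ▸ hl (T.prev z) (by rw [T.next_prev, o]; exact e))
      · have := h.arc_unique hl (x := T.glue (T.prev z)) (by rw [T.origin_glue hg, T.next_prev, o])
          (by rw [T.origin_next_glue hg]; exact e) hx hx'
        rw [T.rot_apply, ← T.glue_eq_iff.1 this, T.next_prev])
  refine ⟨y, y1, ?_, y3⟩
  rw [y2, rot_symm_iterate_eq (j := 1) (by rw [h.minimalPeriod_eq hx]; omega)]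
  rfl

theorem wordTrace_of_arc [Finite D] [NeZero b] (hper : ∀ x, ¬ T.IsPeripheral x) (hl : NoLoops T)
    {x : D} (hx : T.origin x = P) (hx' : T.origin (T.next x) = Q) :
    T.wordTrace (T.prev x) = T.cornerCount P * T.cornerCount Q - 2 := by
  have hg := h.glue_ne_left hx
  have ho : T.origin (T.glue x) = Q := by rw [T.origin_glue hg, hx']
  have ho' : T.origin (T.next (T.glue x)) = P := by rw [T.origin_next_glue hg, hx]
  have hs : T.glue (T.prev x) ≠ T.prev x := h.glue_ne_next_left (by rw [T.next_prev, hx])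
  have h2 := h.two_le_cornerCount_of_arc hl hx hx'
  have h3 := h.symm.two_le_cornerCount_of_arc hl ho ho'
  obtain ⟨y, y1, y2, y3⟩ := h.path_star_of_arc hper hl hx hx' hs
    (fun z _ hne e => hne (T.prev_inj.1 e)) Path.refl
  have p1 := y1.step (by rw [y2, Ne, T.prev_inj]; exact hg)
  rw [y2, y3] at p1
  obtain ⟨z, z1, z2, z3⟩ := h.symm.path_star_of_arc hper hl ho ho' hs
    (fun z hz _ e => h.punctures_ne (by rw [← hx, ← hz, T.prev_inj.1 e])) p1
  rw [z1.wordTrace_eq (by rw [z2, T.glue_glue]), z3]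
  obtain ⟨K, hK⟩ : ∃ K, T.cornerCount P = K + 2 := ⟨T.cornerCount P - 2, by omega⟩
  obtain ⟨L, hL⟩ : ∃ L, T.cornerCount Q = L + 2 := ⟨T.cornerCount Q - 2, by omega⟩
  rw [hK, hL, Nat.add_sub_cancel, Nat.add_sub_cancel, starMatrix_pow, starMatrix_pow, one_mul,
    cornerMatrix, Matrix.mul_fin_two, Matrix.mul_fin_two, Matrix.mul_fin_two, Matrix.trace_fin_two_of]
  push_cast
  ring

/-! ### The word if there is a self-folded triangle around a puncture -/

/-- Q has one corner. At P, the four consecutive corners `g`, `x`, `l`, `T.next g` belong to the two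
triangles along the loop, and the other p - 4 are opposite to boundary segments. The word is
`starMatrix`^(p-4) U, of trace p - 2. -/
theorem wordTrace_of_selfFolded [Finite D] [NeZero b] (hper : ∀ x, ¬ T.IsPeripheral x)
    {x : D} (hx : T.glue x = T.next x) (o0 : T.origin x = P) (o1 : T.origin (T.next x) = Q) :
    ∃ s, T.IsBoundaryVertex (T.origin s) ∧
      T.wordTrace s = T.cornerCount P * T.cornerCount Q - 2 := by
  have hx' : T.glue (T.next x) = x := T.glue_eq_iff.2 hx.symm
  have hfix : T.rot (T.next x) = T.next x := by rw [T.rot_apply, hx']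
  have hQ : T.cornerCount Q = 1 := by
    rw [← h.symm.minimalPeriod_eq o1]
    exact Function.minimalPeriod_eq_one_iff_isFixedPt.2 hfix
  have hQ' : ∀ z, T.origin z = Q → z = T.next x := fun z hz =>
    eq_of_origin_eq_of_rot_fixed hfix (o1.trans hz.symm)
  have hgx : T.glue x ≠ x := by rw [hx]; exact T.next_ne x
  have o2 : T.origin (T.prev x) = P := by
    rw [← T.next_next, ← hx, T.origin_next_glue hgx, o0]
  obtain ⟨l, hl⟩ : ∃ l, l = T.prev x := ⟨_, rfl⟩
  obtain ⟨g, hg⟩ : ∃ g, g = T.glue l := ⟨_, rfl⟩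
  have hnl : T.next l = x := by rw [hl, T.next_prev]
  have hgl : T.glue l ≠ l := h.glue_ne_left (hl ▸ o2)
  have hgg : T.glue g = l := by rw [hg, T.glue_glue]
  have og : T.origin g = P := by rw [hg, T.origin_glue hgl, hnl, o0]
  have ong : T.origin (T.next g) = P := by rw [hg, T.origin_next_glue hgl, hl, o2]
  have hloop : ∀ z, T.origin z = P → T.origin (T.next z) = P → z = l ∨ z = g := by
    intro z hz hz'
    obtain ⟨l', e, s, -, -, o⟩ := h.selfFolded_of_loop hz hz'
    have : l' = l := by
      rw [hl, ← T.next_next, ← hQ' _ o, T.next_prev]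
    rcases e with e | e
    · exact Or.inl (e.symm.trans this)
    · right
      rw [hg, ← this, e, T.glue_glue]
  have hne1 : x ≠ g := by
    intro e
    have := hgg
    rw [← e, hx, hl] at this
    exact T.prev_ne_next x this.symm
  have hne2 : l ≠ g := fun e => hgl (hg ▸ e.symm)
  have r1 : T.rot g = x := by rw [T.rot_apply, hgg, hnl]
  have r2 : T.rot x = l := by rw [T.rot_apply, hx, hl, T.next_next]
  have r3 : T.rot l = T.next g := by rw [T.rot_apply, hg]
  have apex : T.IsBoundaryVertex (T.origin (T.prev g)) := by
    refine h.boundary_of_ne (fun e => ?_) (fun e => ?_)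
    · rcases hloop _ e (by rw [T.next_prev, og]) with e' | e'
      · rw [hl, T.prev_inj] at e'
        exact hne1 e'.symm
      · exact T.prev_ne g e'
    · have := hQ' _ e
      rw [← T.next_prev g, this, T.next_next, ← hl] at hne2
      exact hne2 rfl
  have hs : T.glue (T.prev g) ≠ T.prev g := h.glue_ne_next_left (by rw [T.next_prev, og])
  have hp := h.minimalPeriod_eq og
  have h4 : 4 ≤ T.cornerCount P := by
    rw [← hp]
    have hpos := Function.minimalPeriod_pos_of_mem_periodicPts (T.rot.injective.mem_periodicPts g)
    have hper' := Function.iterate_minimalPeriod (f := T.rot) (x := g)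
    by_contra! hlt
    generalize Function.minimalPeriod T.rot g = n at *
    interval_cases n
    · exact hne1 (r1.symm.trans hper')
    · rw [Function.iterate_succ_apply, r1] at hper'
      exact hne2 (r2.symm.trans hper')
    · rw [Function.iterate_succ_apply, Function.iterate_succ_apply, r1, r2] at hper'
      exact T.next_ne g (r3.symm.trans hper')
  obtain ⟨y, y1, y2, y3⟩ := h.path_star hs og Path.refl (T.cornerCount P - 4) (fun k hk hk' => by
    have o := h.origin_rot_symm og k
    have n0 : T.rot.symm^[k] g ≠ g := rot_symm_iterate_ne (j := 0) (by omega) (by omega)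
    have n1 : T.rot.symm^[k] g ≠ T.rot^[1] g := rot_symm_iterate_ne (by omega) (by omega)
    have n2 : T.rot.symm^[k] g ≠ T.rot^[2] g := rot_symm_iterate_ne (by omega) (by omega)
    have n3 : T.rot.symm^[k] g ≠ T.rot^[3] g := rot_symm_iterate_ne (by omega) (by omega)
    simp only [Function.iterate_succ_apply, Function.iterate_zero_apply, r1, r2, r3] at n1 n2 n3
    set z := T.rot.symm^[k] g
    refine ⟨h.glue_eq_of_arc hper o0 o1 ?_ ?_, fun e => n0 (T.prev_inj.1 e)⟩
    · refine h.boundary_of_ne (fun e => ?_) (fun e => n1 (T.next_inj.1 (hQ' _ e)))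
      rcases hloop z o e with e | e
      exacts [n2 e, n0 e]
    · rw [T.next_next]
      refine h.boundary_of_ne (fun e => ?_) (fun e => n2 ?_)
      · rcases hloop _ e (by rw [T.next_prev, o]) with e | e
        · exact n1 (by rw [← T.next_prev z, e, hnl])
        · exact n3 (by rw [← T.next_prev z, e])
      · rw [← T.next_prev z, hQ' _ e, hl, T.next_next])
  refine ⟨T.prev g, apex, ?_⟩
  rw [y1.wordTrace_eq (by
    rw [y2, rot_symm_iterate_eq (j := 3) (by omega)]
    simp only [Function.iterate_succ_apply, Function.iterate_zero_apply, r1, r2, r3, T.next_next]),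
    y3, hQ]
  obtain ⟨K, hK⟩ : ∃ K, T.cornerCount P = K + 4 := ⟨T.cornerCount P - 4, by omega⟩
  rw [hK, Nat.add_sub_cancel, starMatrix_pow, one_mul, cornerMatrix, Matrix.mul_fin_two,
    Matrix.trace_fin_two_of]
  push_cast
  ring

end IsTwicePuncturedDisk

end TriangulatedSurface

/-! ### The word along a crossing curve. -/

namespace TriangulatedSurface

variable {D : Type u} {T : TriangulatedSurface D}

/-- A product of elementary matrices. -/
def turnMatrix (d : Bool) : Matrix (Fin 2) (Fin 2) ℤ := if d then !![1, 1; 0, 1] else !![1, 0; 1, 1]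

/-- The product of the elementary matrices given by a sequence of `n` turns. -/
def turnProd (d : ℕ → Bool) : ℕ → Matrix (Fin 2) (Fin 2) ℤ
  | 0 => 1
  | n + 1 => turnProd d n * turnMatrix (d n)

theorem turnProd_succ' (d : ℕ → Bool) (n : ℕ) :
    turnProd d (n + 1) = turnMatrix (d 0) * turnProd (fun i => d (i + 1)) n := by
  induction n with
  | zero => simp [turnProd]
  | succ n ih => rw [turnProd, ih, turnProd, mul_assoc]

theorem turnMatrix_not (d : Bool) : turnMatrix (!d) = (turnMatrix d).transpose := by
  cases d <;> ext i j <;> fin_cases i <;> fin_cases j <;> rfl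

/-- Going backwards reverses the order of the turns and exchanges left and right, that is, upper and
lower elementary matrices. -/
theorem turnProd_reverse (d : ℕ → Bool) (n : ℕ) :
    turnProd (fun i => !d (n - 1 - i)) n = (turnProd d n).transpose := by
  induction n with
  | zero => simp [turnProd]
  | succ n ih =>
    rw [turnProd_succ', turnProd, Matrix.transpose_mul, ← ih, ← turnMatrix_not]
    congr 2
    funext i
    congr 2
    omega

theorem det_turnProd (d : ℕ → Bool) (n : ℕ) : (turnProd d n).det = 1 := by
  induction n with
  | zero => exact Matrix.det_one
  | succ n ih =>
    rw [turnProd, Matrix.det_mul, ih, turnMatrix]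
    cases d n <;> simp [Matrix.det_fin_two_of]

theorem turnProd_congr {d d' : ℕ → Bool} {n : ℕ} (h : ∀ i < n, d i = d' i) :
    turnProd d n = turnProd d' n := by
  induction n with
  | zero => rfl
  | succ n ih => rw [turnProd, turnProd, ih fun i hi => h i (by omega), h n (by omega)]

/-- The sum of the entries of a matrix. -/
def entrySum (M : Matrix (Fin 2) (Fin 2) ℤ) : ℤ := M 0 0 + M 0 1 + M 1 0 + M 1 1

/-- `starMatrix`^n U² = J + (n+1)E with J = [[0,1],[-1,0]] and E the matrix of ones. Since R J Rᵗ =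
J and the entries of J sum to zero, only tr J² = -2 and the term in E twice survive; the latter
gives the square of the entry sum. -/
theorem trace_two_stars (R : Matrix (Fin 2) (Fin 2) ℤ) (hR : R.det = 1) (p q : ℕ) :
    (cornerMatrix * R * starMatrix ^ p * cornerMatrix * cornerMatrix * R.transpose *
      starMatrix ^ q * cornerMatrix).trace = entrySum R ^ 2 * (q + 1 : ℕ) * (p + 1 : ℕ) - 2 := by
  rw [Matrix.det_fin_two] at hR
  rw [Matrix.eta_fin_two R, starMatrix_pow, starMatrix_pow, cornerMatrix,
    show (!![R 0 0, R 0 1; R 1 0, R 1 1]).transpose = !![R 0 0, R 1 0; R 0 1, R 1 1] by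
      ext i j; fin_cases i <;> fin_cases j <;> rfl]
  simp only [Matrix.mul_fin_two, Matrix.trace_fin_two_of, entrySum, Matrix.of_apply,
    Matrix.cons_val_zero, Matrix.cons_val_one, Matrix.cons_val', Matrix.cons_val_fin_one]
  generalize R 0 0 = α at *
  generalize R 0 1 = β at *
  generalize R 1 0 = γ at *
  generalize R 1 1 = δ at *
  push_cast
  linear_combination (-2) * hR

namespace CrossingCurve

variable {P Q : T.Vertex} (c : T.CrossingCurve P Q)

/-- The sides of a crossing curve, indexed by natural numbers. -/
def sideAt (n : ℕ) : D := c.side ⟨min n c.m, by omega⟩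

theorem sideAt_val (i : Fin (c.m + 1)) : c.sideAt i.1 = c.side i := by
  unfold sideAt
  congr 1
  apply Fin.ext
  simp only
  omega

theorem sideAt_zero : c.sideAt 0 = c.side 0 := c.sideAt_val 0

theorem sideAt_last : c.sideAt c.m = c.side (Fin.last c.m) := c.sideAt_val (Fin.last c.m)

theorem glue_sideAt_ne (n : ℕ) : T.glue (c.sideAt n) ≠ c.sideAt n := c.glued _

theorem step_sideAt {n : ℕ} (hn : n < c.m) : c.sideAt (n + 1) = T.next (T.glue (c.sideAt n)) ∨
    c.sideAt (n + 1) = T.prev (T.glue (c.sideAt n)) := by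
  have := c.step ⟨n, hn⟩
  rwa [← c.sideAt_val, ← c.sideAt_val] at this

theorem sameTriangle_step {n : ℕ} (hn : n < c.m) :
    T.SameTriangle (T.glue (c.sideAt n)) (c.sideAt (n + 1)) := Or.inr (c.step_sideAt hn)

theorem distinct_sideAt {i j : ℕ} (hi : i ≤ c.m) (hj : j ≤ c.m)
    (h : T.SameTriangle (c.sideAt i) (c.sideAt j)) : i = j := by
  by_contra hne
  exact c.distinct ⟨i, by omega⟩ ⟨j, by omega⟩ (fun e => hne (congrArg Fin.val e))
    (by rwa [← c.sideAt_val, ← c.sideAt_val])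

theorem sideAt_glue {i j : ℕ} (hi : i ≤ c.m) (hj : j ≤ c.m)
    (h : T.SameTriangle (c.sideAt i) (T.glue (c.sideAt j))) : j < c.m ∧ i = j + 1 := by
  rcases Nat.lt_or_ge j c.m with hlt | hge
  · exact ⟨hlt, c.distinct_sideAt hi (by omega) (h.trans (c.sameTriangle_step hlt))⟩
  · obtain rfl : j = c.m := by omega
    exfalso
    refine c.distinct_last ⟨i, by omega⟩ ?_
    rwa [← c.sideAt_val, ← c.sideAt_last]

theorem glue_sideAt_glue {i j : ℕ} (hi : i ≤ c.m) (hj : j ≤ c.m)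
    (h : T.SameTriangle (T.glue (c.sideAt i)) (T.glue (c.sideAt j))) : i = j := by
  rcases Nat.lt_or_ge i c.m with hlt | hge
  · have := c.sideAt_glue (i := i + 1) (by omega) hj ((c.sameTriangle_step hlt).symm.trans h)
    omega
  · rcases Nat.lt_or_ge j c.m with hlt' | hge'
    · have := c.sideAt_glue (i := j + 1) (by omega) hi ((c.sameTriangle_step hlt').symm.trans h.symm)
      omega
    · omega

theorem glue_sideAt_ne_sideAt {i j : ℕ} (hi : i ≤ c.m) (hj : j ≤ c.m) :
    T.glue (c.sideAt i) ≠ c.sideAt j := by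
  intro e
  obtain ⟨h1, rfl⟩ := c.sideAt_glue hj hi (by rw [e]; exact T.sameTriangle_refl _)
  rcases c.step_sideAt h1 with h2 | h2 <;> rw [← e] at h2
  · exact T.next_ne _ h2.symm
  · exact T.prev_ne _ h2.symm

/-- The same curve, traversed from `Q` to `P`. -/
def reverse : T.CrossingCurve Q P where
  m := c.m
  side i := T.glue (c.side i.rev)
  start := by rw [Fin.rev_zero]; exact c.finish
  glued i := T.glue_glue_ne (c.glued _)
  step i := by
    rw [Fin.rev_succ, Fin.rev_castSucc, T.glue_glue]
    rcases c.step i.rev with h | h <;> rw [h]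
    · right; rw [T.prev_next]
    · left; rw [T.next_prev]
  finish := by rw [T.glue_glue, Fin.rev_last]; exact c.start
  distinct i j hij h := by
    rw [← c.sideAt_val, ← c.sideAt_val] at h
    have := c.glue_sideAt_glue (by omega) (by omega) h
    exact hij (Fin.rev_injective (Fin.ext this))
  distinct_last i h := by
    rw [T.glue_glue, Fin.rev_last, ← c.sideAt_val, ← c.sideAt_zero] at h
    have := c.sideAt_glue (Nat.zero_le _) (by omega) h.symm
    omega

theorem reverse_sideAt {n : ℕ} (hn : n ≤ c.m) :
    c.reverse.sideAt n = T.glue (c.sideAt (c.m - n)) := by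
  have h1 := c.reverse.sideAt_val ⟨n, Nat.lt_succ_of_le hn⟩
  have h2 := c.sideAt_val (Fin.rev ⟨n, Nat.lt_succ_of_le hn⟩)
  simp only [Fin.val_rev] at h1 h2
  rw [h1, show c.m - n = c.m + 1 - (n + 1) by omega, h2]
  rfl

open Classical in
/-- The turns of the curve: `true` if it turns right after crossing the side `n`. -/
noncomputable def turn (n : ℕ) : Bool := decide (c.sideAt (n + 1) = T.next (T.glue (c.sideAt n)))

theorem turn_eq_false {n : ℕ} (hn : n < c.m) (h : c.turn n = false) :
    c.sideAt (n + 1) = T.prev (T.glue (c.sideAt n)) :=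
  (c.step_sideAt hn).resolve_left (by simpa [turn] using h)

theorem turn_eq_true {n : ℕ} (h : c.turn n = true) :
    c.sideAt (n + 1) = T.next (T.glue (c.sideAt n)) := by simpa [turn] using h

theorem turn_reverse {n : ℕ} (hn : n < c.m) : c.reverse.turn n = !c.turn (c.m - 1 - n) := by
  have e : c.m - n = c.m - 1 - n + 1 := by omega
  have e1 : c.m - (n + 1) = c.m - 1 - n := by omega
  have h1 := c.reverse_sideAt (n := n) (by omega)
  have h2 := c.reverse_sideAt (n := n + 1) hn
  rw [e] at h1
  rw [e1] at h2
  cases ht : c.turn (c.m - 1 - n)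
  · have := c.turn_eq_false (by omega) ht
    simp only [turn, h1, h2, T.glue_glue, Bool.not_false, decide_eq_true_eq]
    rw [this, T.next_prev]
  · have := c.turn_eq_true ht
    simp only [turn, h1, h2, T.glue_glue, Bool.not_true, decide_eq_false_iff_not]
    rw [this, T.next_next]
    exact (T.prev_ne _).symm

/-- The sum of the entries of the product of the turns. -/
noncomputable def turnSum : ℤ := entrySum (turnProd c.turn c.m)

end CrossingCurve

namespace IsTwicePuncturedDisk

variable {b : ℕ} {bd : ZMod b → D} {P Q : T.Vertex} (h : T.IsTwicePuncturedDisk bd P Q)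
  (hper : ∀ x, ¬ T.IsPeripheral x) (hno : NoArc T P Q) (c : T.CrossingCurve P Q)
include h hno

theorem boundary_sideAt_zero [Finite D] [NeZero b] :
    T.IsBoundaryVertex (T.origin (c.sideAt 0)) ∧
      T.IsBoundaryVertex (T.origin (T.next (c.sideAt 0))) := by
  have := h.boundary_of_corner (h.noLoops_of_noArc hno) hno c.start
  rw [T.next_prev, T.prev_prev] at this
  rw [c.sideAt_zero]
  exact this

include hper

/-- The first crossed arc cuts off a part containing all corners at P. The curve never crosses it
again, so it never returns to that part. -/
theorem origin_ne_of_pos [Finite D] [NeZero b] {n : ℕ} (hn : n ≤ c.m) :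
    (0 < n → ∀ y, T.SameTriangle (c.sideAt n) y → T.origin y ≠ P) ∧
      ∀ y, T.SameTriangle (T.glue (c.sideAt n)) y → T.origin y ≠ P := by
  have hb := h.boundary_sideAt_zero hno c
  obtain ⟨S, hS⟩ := h.exists_cutsOff (c.glue_sideAt_ne 0) (Or.inr hb)
  have hP : ∀ z, T.origin z = P → z ∈ S := by
    rcases h.separates hper hS hb.1 hb.2 with h' | h'
    · exact h'.1
    · exact absurd (hS.prev_iff.2 hS.mem) (h'.1 _ (by rw [c.sideAt_zero]; exact c.start))
  have key : ∀ n ≤ c.m, (0 < n → c.sideAt n ∉ S) ∧ T.glue (c.sideAt n) ∉ S := by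
    intro n hn
    induction n with
    | zero => exact ⟨fun e => absurd e (lt_irrefl 0), hS.glue_notMem⟩
    | succ n ih =>
      have h1 : c.sideAt (n + 1) ∉ S := fun e =>
        (ih (by omega)).2 ((hS.sameTriangle (c.sameTriangle_step (by omega))).2 e)
      refine ⟨fun _ => h1, fun e => h1 ?_⟩
      refine (hS.glue_iff ?_ ?_).1 e
      · intro e
        have := c.distinct_sideAt hn (Nat.zero_le _) (by rw [e]; exact T.sameTriangle_refl _)
        omega
      · exact fun e => c.glue_sideAt_ne_sideAt (Nat.zero_le _) hn e.symm
  exact ⟨fun hpos y hy e => (key n hn).1 hpos ((hS.sameTriangle hy).2 (hP y e)),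
    fun y hy e => (key n hn).2 ((hS.sameTriangle hy).2 (hP y e))⟩

theorem boundary_of_step [Finite D] [NeZero b] {n : ℕ} (hn : n < c.m) {y : D}
    (hy : T.SameTriangle (c.sideAt (n + 1)) y) : T.IsBoundaryVertex (T.origin y) := by
  refine h.boundary_of_ne ((h.origin_ne_of_pos hper hno c hn).1 (Nat.succ_pos n) y hy) ?_
  refine (h.symm.origin_ne_of_pos hper (h.noArc_symm hno) c.reverse (n := c.m - (n + 1))
    (by simp [CrossingCurve.reverse])).2 y ?_
  rw [c.reverse_sideAt (by omega), T.glue_glue, show c.m - (c.m - (n + 1)) = n + 1 by omega]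
  exact hy

/-- The third side of a triangle with two crossed sides is a boundary segment. -/
theorem glue_third_side [Finite D] [NeZero b] {n : ℕ} (hn : n < c.m) :
    (c.turn n = true → T.glue (T.next (c.sideAt (n + 1))) = T.next (c.sideAt (n + 1))) ∧
      (c.turn n = false → T.glue (T.prev (c.sideAt (n + 1))) = T.prev (c.sideAt (n + 1))) := by
  have hb : ∀ {y}, T.SameTriangle (c.sideAt (n + 1)) y → _ := h.boundary_of_step hper hno c hn
  have h3 := h.exists_boundary_side hper (hb (T.sameTriangle_refl _))
    (hb (T.sameTriangle_refl _).next) (hb (T.sameTriangle_refl _).prev)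
  have h0 := c.glue_sideAt_ne (n + 1)
  have h1 := T.glue_glue_ne (c.glue_sideAt_ne n)
  constructor
  · intro ht
    have e : T.prev (c.sideAt (n + 1)) = T.glue (c.sideAt n) := by
      rw [c.turn_eq_true ht, T.prev_next]
    rw [e] at h3
    tauto
  · intro ht
    have e : T.next (c.sideAt (n + 1)) = T.glue (c.sideAt n) := by
      rw [c.turn_eq_false hn ht, T.next_prev]
    rw [e] at h3
    tauto

/-- The walk follows the right side of the curve. A right turn adds one corner, U; a left turn also
meets the boundary segment on the right, giving USU, the lower elementary matrix. The factor U of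
the current corner is kept on both sides so that the product telescopes. -/
theorem path_curve [Finite D] [NeZero b] {s : D} {M : Matrix (Fin 2) (Fin 2) ℤ}
    (hs : T.glue s ≠ s) (hs' : ∀ n, 0 < n → n ≤ c.m → c.sideAt n ≠ s)
    (p : T.Path s (c.sideAt 0) M) {n : ℕ} (hn : n ≤ c.m) :
    ∃ M', T.Path s (c.sideAt n) M' ∧ M' * cornerMatrix = M * cornerMatrix * turnProd c.turn n := by
  induction n with
  | zero => exact ⟨M, p, by rw [turnProd, mul_one]⟩
  | succ n ih =>
    obtain ⟨M', p', hM⟩ := ih (by omega)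
    have h3 := h.glue_third_side hper hno c hn
    have w := T.weight_of_ne (c.glue_sideAt_ne n)
    have hns := hs' (n + 1) (Nat.succ_pos n) hn
    rw [turnProd, ← mul_assoc, ← hM]
    cases ht : c.turn n
    · have e := c.turn_eq_false hn ht
      have hb := h3.2 ht
      have r1 : T.rot (c.sideAt n) = T.prev (c.sideAt (n + 1)) := by
        rw [e, T.prev_prev, T.rot_apply]
      have r2 : T.rot (T.prev (c.sideAt (n + 1))) = c.sideAt (n + 1) := by
        rw [T.rot_apply, hb, T.next_prev]
      have p1 := p'.step (by rw [r1]; intro e'; rw [e'] at hb; exact hs hb)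
      rw [r1, w] at p1
      have p2 := p1.step (by rw [r2]; exact hns)
      rw [r2, T.weight_of_eq hb] at p2
      refine ⟨_, p2, ?_⟩
      simp only [mul_assoc]
      congr 2
      simp [cornerMatrix, segmentMatrix, turnMatrix]
    · have e := c.turn_eq_true ht
      have r1 : T.rot (c.sideAt n) = c.sideAt (n + 1) := e.symm
      have p1 := p'.step (by rw [r1]; exact hns)
      rw [r1, w] at p1
      exact ⟨_, p1, by rw [turnMatrix, if_pos rfl]; rfl⟩

/-- By `corner_unique`, the corner where the curve ends is the only one at Q opposite to an arc,
whence the exponent q - 1. -/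
theorem path_curve_star [Finite D] [NeZero b] {s : D} {M : Matrix (Fin 2) (Fin 2) ℤ}
    (hs : T.glue s ≠ s) (hs1 : T.IsBoundaryVertex (T.origin (T.next s)))
    (hs' : ∀ n, 0 < n → n ≤ c.m → c.sideAt n ≠ s) (p : T.Path s (c.sideAt 0) M) :
    ∃ y, T.Path s y (M * cornerMatrix * turnProd c.turn c.m *
        starMatrix ^ (T.cornerCount Q - 1)) ∧
      T.rot y = T.glue (c.sideAt c.m) ∧ T.weight y = cornerMatrix := by
  obtain ⟨M', p', hM⟩ := h.path_curve hper hno c hs hs' p le_rfl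
  obtain ⟨z, hz⟩ : ∃ z, z = T.prev (T.glue (c.sideAt c.m)) := ⟨_, rfl⟩
  have oz : T.origin z = Q := by rw [hz, c.sideAt_last]; exact c.finish
  have hnz : T.next z = T.glue (c.sideAt c.m) := by rw [hz, T.next_prev]
  have hav : ∀ w, T.origin w = Q → T.prev w ≠ s := fun w hw e =>
    h.interior_right (by rwa [← e, T.next_prev, hw] at hs1)
  have r : T.rot (c.sideAt c.m) = T.prev z := by rw [hz, T.prev_prev, T.rot_apply]
  have p1 := p'.step (by rw [r]; exact hav z oz)
  rw [r, T.weight_of_ne (c.glue_sideAt_ne _), hM] at p1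
  have hpos : 0 < T.cornerCount Q := by
    rw [← h.symm.minimalPeriod_eq oz]
    exact Function.minimalPeriod_pos_of_mem_periodicPts (T.rot.injective.mem_periodicPts z)
  obtain ⟨y, y1, y2, y3⟩ := h.symm.path_star hs oz p1 (T.cornerCount Q - 1) (fun k hk hk' => by
    have o := h.symm.origin_rot_symm oz k
    have n0 : T.rot.symm^[k] z ≠ z := rot_symm_iterate_ne (j := 0) (by omega)
      (by rw [h.symm.minimalPeriod_eq oz]; omega)
    refine ⟨?_, hav _ o⟩
    by_contra hne
    refine n0 (h.symm.corner_unique hper (h.noArc_symm hno) o oz hne ?_)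
    rw [hnz]
    exact T.glue_glue_ne (c.glue_sideAt_ne _))
  refine ⟨y, y1, ?_, y3⟩
  rw [y2, rot_symm_iterate_eq (j := 0) (by rw [h.symm.minimalPeriod_eq oz]; omega)]
  exact hnz

/-- The boundary cycle is closed by applying `path_curve_star` twice: to the curve and then to its
reverse, whose right side is the left side of the curve. -/
theorem wordTrace_of_curve [Finite D] [NeZero b] :
    T.wordTrace (c.sideAt 0) = c.turnSum ^ 2 * T.cornerCount P * T.cornerCount Q - 2 := by
  have hs := c.glue_sideAt_ne 0
  have hb := h.boundary_sideAt_zero hno c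
  obtain ⟨y, y1, y2, y3⟩ := h.path_curve_star hper hno c hs hb.2 (fun n hn hn' e => by
    have := c.distinct_sideAt hn' (Nat.zero_le _) (by rw [e]; exact T.sameTriangle_refl _)
    omega) Path.refl
  have p1 := y1.step (by rw [y2]; exact c.glue_sideAt_ne_sideAt le_rfl (Nat.zero_le _))
  have e0 : c.reverse.sideAt 0 = T.glue (c.sideAt c.m) := c.reverse_sideAt (Nat.zero_le _)
  rw [y2, y3, ← e0] at p1
  have em : c.reverse.sideAt c.reverse.m = T.glue (c.sideAt 0) := by
    change c.reverse.sideAt c.m = _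
    rw [c.reverse_sideAt le_rfl, Nat.sub_self]
  obtain ⟨z, z1, z2, z3⟩ := h.symm.path_curve_star hper (h.noArc_symm hno) c.reverse hs hb.2
    (fun n hn hn' e => by
      rw [c.reverse_sideAt hn'] at e
      exact c.glue_sideAt_ne_sideAt (by omega) (Nat.zero_le _) e) p1
  have hrev : turnProd c.reverse.turn c.reverse.m = (turnProd c.turn c.m).transpose := by
    rw [← turnProd_reverse]
    exact turnProd_congr fun i hi => c.turn_reverse hi
  rw [z1.wordTrace_eq (by rw [z2, em, T.glue_glue]), z3, hrev, one_mul,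
    trace_two_stars _ (det_turnProd _ _)]
  have hpos : ∀ {v : T.Vertex}, ¬ T.IsBoundaryVertex v → 0 < T.cornerCount v := by
    intro v hv
    obtain ⟨w, rfl⟩ := exists_origin_eq v
    rw [cornerCount_interior hv]
    exact Function.minimalPeriod_pos_of_mem_periodicPts (T.rot.injective.mem_periodicPts w)
  have hP := hpos h.interior_left
  have hQ := hpos h.interior_right
  rw [Nat.sub_add_cancel hP, Nat.sub_add_cancel hQ]
  rfl

end IsTwicePuncturedDisk

end TriangulatedSurface

namespace TriangulatedSurface

variable {D : Type u} {T : TriangulatedSurface D}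

namespace IsTwicePuncturedDisk

variable {b : ℕ} {bd : ZMod b → D} {P Q : T.Vertex} (h : T.IsTwicePuncturedDisk bd P Q)
  (hper : ∀ x, ¬ T.IsPeripheral x)
include h

/-! ### Existence of the annulus -/

-- Induction on the size of the region ahead. The next triangle either has its apex at Q, or has
-- exactly one further arc, through which the curve must continue. Removing the triangle from the
-- region guarantees that it is not visited again.
include hper in
theorem exists_sides [Finite D] [NeZero b] (n : ℕ) : ∀ {x : D} {A : Set D} (_ : A.ncard < n)
    (_ : T.CutsOff (T.glue x) A) (_ : T.IsBoundaryVertex (T.origin x))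
    (_ : T.IsBoundaryVertex (T.origin (T.next x))) (_ : ∀ z, T.origin z = P → z ∉ A),
    ∃ (m : ℕ) (side : ℕ → D), side 0 = x ∧ (∀ i ≤ m, T.glue (side i) ≠ side i) ∧
      (∀ i < m, side (i + 1) = T.next (T.glue (side i)) ∨
        side (i + 1) = T.prev (T.glue (side i))) ∧
      T.origin (T.prev (T.glue (side m))) = Q ∧ (∀ i ≤ m, 0 < i → side i ∈ A) ∧
      T.glue (side m) ∈ A ∧ (∀ i j, i ≤ m → j ≤ m → i ≠ j → ¬ T.SameTriangle (side i) (side j)) ∧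
      ∀ i ≤ m, ¬ T.SameTriangle (side i) (T.glue (side m)) := by
  induction n with
  | zero => intro x A hn; exact absurd hn (Nat.not_lt_zero _)
  | succ n ih =>
    intro x A hn hA h1 h2 hP
    obtain ⟨w, hw⟩ : ∃ w, w = T.glue x := ⟨_, rfl⟩
    have hgw : T.glue w = x := by rw [hw, T.glue_glue]
    rw [← hw] at hA
    have hxA : x ∉ A := hgw ▸ hA.glue_notMem
    have hwx : T.glue x ≠ x := by
      have := hA.glue_ne
      rw [hgw, hw] at this
      exact this.symm
    by_cases hQ : T.origin (T.prev w) = Q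
    · refine ⟨0, fun _ => x, rfl, fun _ _ => hwx, fun i hi => absurd hi (Nat.not_lt_zero i),
        by rwa [← hw], fun i hi hi' => by omega, by rw [← hw]; exact hA.mem,
        fun i j hi hj hij => by omega, fun i _ hs => ?_⟩
      rw [← hw] at hs
      exact hxA ((hA.sameTriangle hs).2 hA.mem)
    · have b0 : T.IsBoundaryVertex (T.origin w) := by rwa [hw, T.origin_glue hwx]
      have b1 : T.IsBoundaryVertex (T.origin (T.next w)) := by rwa [hw, T.origin_next_glue hwx]
      have b2 : T.IsBoundaryVertex (T.origin (T.prev w)) :=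
        h.boundary_of_ne (fun e => hP _ e (hA.prev_iff.2 hA.mem)) hQ
      have hb : ∀ y, T.SameTriangle w y → T.IsBoundaryVertex (T.origin y) := by
        rintro y (rfl | rfl | rfl) <;> assumption
      -- One of the other two sides is a boundary segment by `exists_boundary_side`; if both were,
      -- `w` would be peripheral.
      obtain ⟨x', hx', hgx', ht⟩ : ∃ x', (x' = T.next w ∨ x' = T.prev w) ∧ T.glue x' ≠ x' ∧
          ∀ t, T.SameTriangle w t → t = w ∨ t = x' ∨ T.glue t = t := by
        have h3 := h.exists_boundary_side hper b0 b1 b2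
        by_cases c1 : T.glue (T.next w) = T.next w
        · by_cases c2 : T.glue (T.prev w) = T.prev w
          · exfalso
            have hcut : T.CutsOff w {y | T.SameTriangle w y} :=
              ⟨T.sameTriangle_refl w, fun e => hA.glue_notMem ((hA.sameTriangle e).1 hA.mem),
                fun y hy => hy.next, by
                  rintro y (rfl | rfl | rfl) hy
                  · exact absurd rfl hy
                  · rw [c1]; exact (T.sameTriangle_refl w).next
                  · rw [c2]; exact (T.sameTriangle_refl w).prev⟩
            exact hper _ (hcut.isPeripheral hb)
          · exact ⟨_, Or.inr rfl, c2, by rintro t (rfl | rfl | rfl) <;> tauto⟩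
        · have c2 : T.glue (T.prev w) = T.prev w := by
            have := hA.glue_ne
            tauto
          exact ⟨_, Or.inl rfl, c1, by rintro t (rfl | rfl | rfl) <;> tauto⟩
      have hs' : T.SameTriangle w x' := Or.inr hx'
      have hx'A : x' ∈ A := (hA.sameTriangle hs').1 hA.mem
      have hx'w : x' ≠ w := by
        rcases hx' with rfl | rfl
        exacts [T.next_ne w, T.prev_ne w]
      have hA' : T.CutsOff (T.glue x') (A \ {y | T.SameTriangle w y}) :=
        { mem := ⟨hA.glue _ hx'A hx'w, fun e => by
            rcases ht _ e with e | e | e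
            · rw [T.glue_eq_iff, hgw] at e
              exact hxA (e ▸ hx'A)
            · exact hgx' e
            · exact T.glue_glue_ne hgx' e⟩
          glue_notMem := fun e => e.2 (by rw [T.glue_glue]; exact hs')
          next := fun y hy => ⟨hA.next y hy.1, fun e => hy.2 (T.sameTriangle_of_next e)⟩
          glue := fun y hy hne => ⟨hA.glue y hy.1 fun e => hy.2 (e ▸ T.sameTriangle_refl w), fun e => by
            rcases ht _ e with e' | e' | e'
            · rw [T.glue_eq_iff, hgw] at e'
              exact hxA (e' ▸ hy.1)
            · exact hne (T.glue_eq_iff.1 e')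
            · rw [T.glue_glue] at e'
              exact hy.2 (by rw [e']; exact e)⟩ }
      have hcard : (A \ {y | T.SameTriangle w y}).ncard < A.ncard :=
        Set.ncard_lt_ncard ⟨Set.sdiff_subset, fun e => (e hA.mem).2 (T.sameTriangle_refl w)⟩
          (Set.toFinite _)
      obtain ⟨m, side, s0, s1, s2, s3, s4, s5, s6, s7⟩ := ih (by omega) hA' (hb _ hs')
        (hb _ hs'.next) (fun z hz e => hP z hz e.1)
      have hmem : ∀ i ≤ m, side i ∈ A := by
        intro i hi
        rcases Nat.eq_zero_or_pos i with rfl | hpos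
        · rwa [s0]
        · exact (s4 i hi hpos).1
      refine ⟨m + 1, fun i => Nat.casesOn i x side, rfl, ?_, ?_, s3, ?_, s5.1, ?_, ?_⟩
      · rintro (_ | i) hi
        · exact hwx
        · exact s1 i (by omega)
      · rintro (_ | i) hi
        · change side 0 = T.next (T.glue x) ∨ side 0 = T.prev (T.glue x)
          rw [s0, ← hw]
          exact hx'
        · exact s2 i (by omega)
      · rintro (_ | i) hi hpos
        · exact absurd hpos (lt_irrefl 0)
        · exact hmem i (by omega)
      · rintro (_ | i) (_ | j) hi hj hij hs
        · exact hij rfl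
        · exact hxA ((hA.sameTriangle hs).2 (hmem j (by omega)))
        · exact hxA ((hA.sameTriangle hs).1 (hmem i (by omega)))
        · exact s6 i j (by omega) (by omega) (fun e => hij (congrArg _ e)) hs
      · rintro (_ | i) hi hs
        · exact hxA ((hA.sameTriangle hs).2 s5.1)
        · exact s7 i (by omega) hs

/-- Otherwise the triangles at P are closed under gluing and make up the whole surface; one of them
would have Q as a vertex and so yield an arc from P to Q. -/
theorem exists_corner_arc (hno : NoArc T P Q) :
    ∃ z, T.origin z = P ∧ T.glue (T.next z) ≠ T.next z := by
  by_contra! hall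
  have : {y | ∃ z, T.origin z = P ∧ T.SameTriangle z y} = Set.univ := by
    obtain ⟨p, hp⟩ := exists_origin_eq P
    refine h.connected.2 _ ⟨p, p, hp, T.sameTriangle_refl p⟩ ?_
    rintro y ⟨z, hz, hs⟩
    refine ⟨⟨z, hz, hs.next⟩, ?_⟩
    rcases hs with rfl | rfl | rfl
    · exact ⟨_, (T.origin_next_glue (h.glue_ne_left hz)).trans hz,
        (T.sameTriangle_refl _).next.symm⟩
    · rw [hall z hz]
      exact ⟨z, hz, (T.sameTriangle_refl _).next⟩
    · have hn : T.origin (T.next (T.prev z)) = P := by rw [T.next_prev, hz]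
      exact ⟨_, (T.origin_glue (h.glue_ne_next_left hn)).trans hn, T.sameTriangle_refl _⟩
  obtain ⟨q, hq⟩ := exists_origin_eq Q
  obtain ⟨z, hz, hs⟩ : q ∈ {y | ∃ z, T.origin z = P ∧ T.SameTriangle z y} :=
    this ▸ Set.mem_univ q
  rcases hs with rfl | rfl | rfl
  · exact h.punctures_ne (hz.symm.trans hq)
  · exact hno ⟨z, hz, hq⟩
  · exact h.noArc_symm hno ⟨_, hq, by rw [T.next_prev, hz]⟩

include hper in
theorem exists_crossingCurve [Finite D] [NeZero b] (hno : NoArc T P Q) :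
    Nonempty (T.CrossingCurve P Q) := by
  obtain ⟨z, hz, hg⟩ := h.exists_corner_arc hno
  have hb := h.boundary_of_corner (h.noLoops_of_noArc hno) hno hz
  obtain ⟨S, hS⟩ := h.exists_cutsOff hg (Or.inr hb)
  have hP : ∀ y, T.origin y = P → y ∈ S := by
    rcases h.separates hper hS hb.1 hb.2 with h' | h'
    · exact h'.1
    · exact absurd (hS.next_iff.1 hS.mem) (h'.1 z hz)
  obtain ⟨m, side, s0, s1, s2, s3, -, -, s6, s7⟩ := h.exists_sides hper _ (Nat.lt_succ_self _)
    hS.compl hb.1 hb.2 (fun y hy e => e (hP y hy))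
  exact ⟨{
    m := m
    side := fun i => side i
    start := by
      change T.origin (T.prev (side 0)) = P
      rw [s0, T.prev_next, hz]
    glued := fun i => s1 i (by omega)
    step := fun i => s2 i i.2
    finish := s3
    distinct := fun i j hij => s6 i j (by omega) (by omega) fun e => hij (Fin.ext e)
    distinct_last := fun i => s7 i (by omega) }⟩

theorem exists_selfFolded [Finite D] [NeZero b] {l : D} (h1 : T.origin l = P)
    (h2 : T.origin (T.next l) = P) : ∃ x, T.glue x = T.next x ∧ T.origin x = P ∧
      T.origin (T.next x) = Q ∧ ∀ i, ¬ T.SameTriangle x (bd i) := by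
  obtain ⟨l', -, s, o1, o2, o3⟩ := h.selfFolded_of_loop h1 h2
  refine ⟨T.next l', s, o2, o3, fun i hs => ?_⟩
  have hb := h.boundary_bd i
  rcases hs with e | e | e <;> rw [e] at hb
  · exact h.ne_left hb o2
  · exact h.ne_right hb o3
  · rw [T.prev_next] at hb
    exact h.ne_left hb o1

-- If an arc joins the punctures, either there is no loop at them, and the apices of the triangles
-- along the arc join both punctures to the boundary, or a loop bounds a self-folded triangle.
include hper in
theorem exists_associatedAnnulus [Finite D] [NeZero b] :
    ∃ A : CutSurface.{u} b, T.IsAssociatedAnnulus bd P Q A := by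
  by_cases hno : NoArc T P Q
  · obtain ⟨c⟩ := h.exists_crossingCurve hper hno
    exact ⟨_, .noArc hno c⟩
  · obtain ⟨x, hx, hx'⟩ := not_not.1 hno
    by_cases hl : NoLoops T
    · have key : ∀ {X Y : T.Vertex}, T.IsTwicePuncturedDisk bd X Y → ∀ {y : D}, T.origin y = X →
          T.origin (T.next y) = Y →
          ∃ z, T.origin z = X ∧ T.IsBoundaryVertex (T.origin (T.next z)) := by
        intro X Y h' y hy hy'
        have hg := h'.glue_ne_next_left (x := T.prev y) (by rw [T.next_prev, hy])
        refine ⟨T.glue (T.prev y), by rw [T.origin_glue hg, T.next_prev, hy], ?_⟩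
        rw [T.origin_next_glue hg]
        exact h'.apex_boundary hl hy hy'
      have hg := h.glue_ne_left hx
      exact ⟨_, .arc x hx hx' (key h hx hx')
        (key h.symm (y := T.glue x) (by rw [T.origin_glue hg, hx'])
          (by rw [T.origin_next_glue hg, hx]))⟩
    · obtain ⟨l, hl', hb⟩ : ∃ l, T.origin l = T.origin (T.next l) ∧
          ¬ T.IsBoundaryVertex (T.origin l) := by
        simpa [NoLoops] using hl
      rcases (h.interior_iff _).1 hb with e | e
      · obtain ⟨y, y1, y2, y3, y4⟩ := h.exists_selfFolded e (hl' ▸ e)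
        exact ⟨_, .selfFolded y y1 (Or.inl ⟨y2, y3⟩) y4⟩
      · obtain ⟨y, y1, y2, y3, y4⟩ := h.symm.exists_selfFolded e (hl' ▸ e)
        exact ⟨_, .selfFolded y y1 (Or.inr ⟨y2, y3⟩) y4⟩

end IsTwicePuncturedDisk

end TriangulatedSurface

namespace TriangulatedSurface

variable {D : Type u} {T : TriangulatedSurface D}

/-! ### The quiddity sequence of the annulus -/

/-- If the corners at `v` are mapped to corners of another surface compatibly with the steps from
a corner to the next one, the numbers of corners agree. -/
theorem cornerCount_eq_of_map {D' : Type*} {T' : TriangulatedSurface D'} (φ : D → D')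
    {v : T.Vertex} {x : D} (hx : T.origin x = v)
    (hinj : ∀ y z, T.origin y = v → T.origin z = v → φ y = φ z → y = z)
    (hstep : ∀ y, T.origin y = v → T.glue y ≠ y →
      T'.glue (φ y) ≠ φ y ∧ T'.next (T'.glue (φ y)) = φ (T.next (T.glue y)))
    (hlast : ∀ y, T.origin y = v → T.glue y = y → T'.glue (φ y) = φ y)
    (hfirst : ∀ y, T.origin y = v → T.glue (T.prev y) = T.prev y →
      T'.glue (T'.prev (φ y)) = T'.prev (φ y)) :
    T'.cornerCount (T'.origin (φ x)) = T.cornerCount v := by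
  have hwd : ∀ y, T.origin y = v → T'.origin (φ y) = T'.origin (φ x) := by
    intro y hy
    refine (T.mem_iff_of_origin_eq (S := {y | T'.origin (φ y) = T'.origin (φ x)})
      (hx.trans hy.symm) fun z hz hg => ?_).1 rfl
    obtain ⟨s1, s2⟩ := hstep z (hz.trans hx) hg
    rw [Set.mem_ofPred_eq, Set.mem_ofPred_eq, T.rot_apply, ← s2, T'.origin_next_glue s1]
  refine (Nat.card_congr (Equiv.ofBijective (fun y : {y // T.origin y = v} =>
    (⟨φ y.1, hwd y.1 y.2⟩ : {d // T'.origin d = T'.origin (φ x)})) ⟨fun y z e =>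
      Subtype.ext (hinj _ _ y.2 z.2 (congrArg Subtype.val e)), fun ⟨d, hd⟩ => ?_⟩)).symm
  obtain ⟨y, hy, hyd⟩ := (T'.mem_iff_of_origin_eq (S := {d | ∃ y, T.origin y = v ∧ φ y = d})
    hd.symm fun d' _ hg => by
      constructor
      · rintro ⟨y, hy, rfl⟩
        have hgy : T.glue y ≠ y := fun e => hg (hlast y hy e)
        exact ⟨_, (T.origin_rot hgy).trans hy, (hstep y hy hgy).2.symm⟩
      · rintro ⟨z, hz, hzd⟩
        have e := T'.next_eq_iff.1 hzd.symm
        by_cases hp : T.glue (T.prev z) = T.prev z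
        · exfalso
          have := hfirst z hz hp
          rw [← e, T'.glue_glue] at this
          exact hg this.symm
        · have hr : T.next (T.glue (T.glue (T.prev z))) = z := by rw [T.glue_glue, T.next_prev]
          have ho : T.origin (T.glue (T.prev z)) = v := by
            rw [T.origin_glue hp, T.next_prev, hz]
          refine ⟨_, ho, ?_⟩
          have s2 := (hstep _ ho (T.glue_glue_ne hp)).2
          rw [hr, hzd] at s2
          exact T'.glue_inj.1 (T'.next_inj.1 s2)).1 ⟨x, hx, rfl⟩
  exact ⟨⟨y, hy⟩, Subtype.ext hyd⟩

namespace CrossingCurve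

variable {P Q : T.Vertex} (c : T.CrossingCurve P Q)

theorem crosses_iff {x : D} :
    c.Crosses x ↔ ∃ n ≤ c.m, x = c.sideAt n ∨ x = T.glue (c.sideAt n) := by
  constructor
  · rintro ⟨i, hi⟩
    exact ⟨i.1, by omega, by rwa [c.sideAt_val]⟩
  · rintro ⟨n, -, hn⟩
    exact ⟨_, hn⟩

theorem isLeft_iff {x : D} :
    c.isLeft x = true ↔ ∃ n ≤ c.m, x = T.next (c.sideAt n) ∨ x = T.prev (T.glue (c.sideAt n)) := by
  simp only [isLeft, decide_eq_true_eq]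
  constructor
  · rintro ⟨i, hi⟩
    exact ⟨i.1, by omega, by rwa [c.sideAt_val]⟩
  · rintro ⟨n, -, hn⟩
    exact ⟨_, hn⟩

theorem crosses_sideAt (n : ℕ) : c.Crosses (c.sideAt n) := ⟨_, Or.inl rfl⟩

open Classical in
/-- `true` if the starting point of `x`, in its triangle, lies to the left of the curve. -/
noncomputable def startsLeft (x : D) : Bool :=
  if ∃ n ≤ c.m, x = T.glue (c.sideAt n) then true
  else if ∃ n ≤ c.m, x = c.sideAt n then false else c.isLeft x

theorem startsLeft_glue_sideAt {n : ℕ} (hn : n ≤ c.m) :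
    c.startsLeft (T.glue (c.sideAt n)) = true := if_pos ⟨n, hn, rfl⟩

theorem startsLeft_sideAt {n : ℕ} (hn : n ≤ c.m) : c.startsLeft (c.sideAt n) = false := by
  rw [startsLeft, if_neg, if_pos ⟨n, hn, rfl⟩]
  rintro ⟨k, hk, e⟩
  exact c.glue_sideAt_ne_sideAt hk hn e.symm

theorem startsLeft_of_not_crosses {x : D} (hx : ¬ c.Crosses x) : c.startsLeft x = c.isLeft x := by
  rw [c.crosses_iff] at hx
  rw [startsLeft, if_neg, if_neg]
  · exact fun ⟨n, hn, e⟩ => hx ⟨n, hn, Or.inl e⟩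
  · exact fun ⟨n, hn, e⟩ => hx ⟨n, hn, Or.inr e⟩

theorem startsLeft_next_sideAt {n : ℕ} (hn : n ≤ c.m) :
    c.startsLeft (T.next (c.sideAt n)) = true := by
  by_cases hc : c.Crosses (T.next (c.sideAt n))
  · obtain ⟨k, hk, e | e⟩ := c.crosses_iff.1 hc
    · obtain rfl := c.distinct_sideAt hn hk (Or.inr (Or.inl e.symm))
      exact absurd e (T.next_ne _)
    · rw [e, c.startsLeft_glue_sideAt hk]
  · rw [c.startsLeft_of_not_crosses hc, c.isLeft_iff]
    exact ⟨n, hn, Or.inl rfl⟩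

theorem startsLeft_next_glue_sideAt {n : ℕ} (hn : n ≤ c.m) :
    c.startsLeft (T.next (T.glue (c.sideAt n))) = false := by
  by_cases hc : c.Crosses (T.next (T.glue (c.sideAt n)))
  · obtain ⟨k, hk, e | e⟩ := c.crosses_iff.1 hc
    · rw [e, c.startsLeft_sideAt hk]
    · obtain rfl := c.glue_sideAt_glue hn hk (Or.inr (Or.inl e.symm))
      exact absurd e (T.next_ne _)
  · rw [c.startsLeft_of_not_crosses hc, Bool.eq_false_iff, Ne, c.isLeft_iff]
    rintro ⟨k, hk, e | e⟩
    · exact c.glue_sideAt_ne_sideAt hn hk (T.next_inj.1 e)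
    · have hs : T.SameTriangle (T.glue (c.sideAt n)) (T.glue (c.sideAt k)) :=
        SameTriangle.trans (Or.inr (Or.inl e.symm) : T.SameTriangle _ (T.prev (T.glue (c.sideAt k))))
          (T.sameTriangle_refl _).prev.symm
      obtain rfl := c.glue_sideAt_glue hn hk hs
      exact T.prev_ne_next _ e.symm

/-- An uncrossed side lies entirely on one side of the curve. Its end can be ambiguous only where
the curve itself starts or ends, at P or Q. -/
theorem startsLeft_next_of_not_crosses {x : D} (hx : ¬ c.Crosses x)
    (hP : T.origin (T.next x) ≠ P) (hQ : T.origin (T.next x) ≠ Q) :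
    c.startsLeft (T.next x) = c.isLeft x := by
  by_cases hc : c.Crosses (T.next x)
  · obtain ⟨k, hk, e | e⟩ := c.crosses_iff.1 hc
    · rw [e, c.startsLeft_sideAt hk, eq_comm, Bool.eq_false_iff, Ne, c.isLeft_iff]
      rw [T.next_eq_iff] at e
      rintro ⟨j, hj, e' | e'⟩
      · have hs : T.SameTriangle (c.sideAt j) (c.sideAt k) :=
          SameTriangle.trans (Or.inr (Or.inl (e'.symm.trans e).symm) :
            T.SameTriangle _ (T.prev (c.sideAt k))) (T.sameTriangle_refl _).prev.symm
        obtain rfl := c.distinct_sideAt hj hk hs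
        exact T.prev_ne_next _ (e.symm.trans e')
      · exact c.glue_sideAt_ne_sideAt hj hk (T.prev_inj.1 (e'.symm.trans e))
    · rw [e, c.startsLeft_glue_sideAt hk, eq_comm, c.isLeft_iff]
      exact ⟨k, hk, Or.inr (T.next_eq_iff.1 e)⟩
  · rw [c.startsLeft_of_not_crosses hc]
    refine Eq.trans (b := false) ?_ (Eq.symm ?_) <;> rw [Bool.eq_false_iff]
    rotate_left
    · rw [Ne, c.isLeft_iff]
      rintro ⟨j, hj, rfl | e⟩
      · cases j with
        | zero => exact hP (by rw [T.next_next, c.sideAt_zero]; exact c.start)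
        | succ j =>
          rcases c.step_sideAt hj with e | e
          · rw [e, T.next_next, T.prev_next] at hc
            exact hc (c.crosses_glue (c.crosses_sideAt j))
          · rw [e, T.next_prev] at hx
            exact hx (c.crosses_glue (c.crosses_sideAt j))
      · rw [e, T.next_prev] at hc
        exact hc (c.crosses_glue (c.crosses_sideAt j))
    · rw [Ne, c.isLeft_iff]
      rintro ⟨j, hj, e | e⟩
      · exact hx (T.next_inj.1 e ▸ c.crosses_sideAt j)
      · rcases Nat.lt_or_ge j c.m with hlt | hge
        · rcases c.step_sideAt hlt with e' | e'
          · rw [T.next_eq_iff, T.prev_prev, ← e'] at e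
            exact hx (e ▸ c.crosses_sideAt _)
          · rw [← e'] at e
            exact hc (e ▸ c.crosses_sideAt _)
        · obtain rfl : j = c.m := by omega
          rw [e, c.sideAt_last] at hQ
          exact hQ c.finish

theorem visits_or_startsLeft (x : D) : c.Visits x ∨ c.startsLeft x = false := by
  by_cases hx : c.Crosses x
  · exact Or.inl ⟨x, hx, T.sameTriangle_refl x⟩
  · rw [c.startsLeft_of_not_crosses hx]
    exact c.visits_or x

/-- The copy of the triangle of `x` which contains the starting point of `x`. -/
noncomputable def keepStart (x : D) : c.CutSide := ⟨(x, c.startsLeft x), c.visits_or_startsLeft x⟩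

theorem keepStart_of_not_crosses {x : D} (hx : ¬ c.Crosses x) : c.keepStart x = c.keep x :=
  Subtype.ext (Prod.ext rfl (c.startsLeft_of_not_crosses hx))

theorem not_crosses_of_boundary {x : D} (hx : T.glue x = x) : ¬ c.Crosses x := by
  rintro ⟨i, rfl | rfl⟩
  · exact c.glued i hx
  · exact T.glue_glue_ne (c.glued i) hx

theorem cutGlue_of_crosses {d : c.CutSide} (hd : c.Crosses d.1.1) :
    (c.cutGlue d).1 = (T.glue d.1.1, d.1.2) :=
  congrArg Subtype.val (dif_pos hd)

theorem cutGlue_keep {x : D} (hx : ¬ c.Crosses x) : c.cutGlue (c.keep x) = c.keep (T.glue x) :=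
  (dif_neg hx).trans (if_pos rfl)

theorem cutGlue_of_boundary {d : c.CutSide} (hd : T.glue d.1.1 = d.1.1) : c.cutGlue d = d := by
  have hc := c.not_crosses_of_boundary hd
  by_cases hs : d.1.2 = c.isLeft d.1.1
  · have : d = c.keep d.1.1 := Subtype.ext (Prod.ext rfl hs)
    rw [this, c.cutGlue_keep hc]
    exact congrArg c.keep hd
  · exact (dif_neg hc).trans (if_neg hs)

/-- The curve meets vertices only at P and Q, so each corner at another vertex survives in exactly
one piece of its triangle, the one chosen by `keepStart`, and neighbouring corners stay neighbours.
-/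
theorem cornerCount_cut {x : D} (hx : T.glue x = x) (hP : T.origin x ≠ P) (hQ : T.origin x ≠ Q) :
    c.cut.cornerCount (c.cut.origin (c.keep x)) = T.cornerCount (T.origin x) := by
  rw [← c.keepStart_of_not_crosses (c.not_crosses_of_boundary hx)]
  refine cornerCount_eq_of_map (T' := c.cut) c.keepStart rfl
    (fun y z _ _ e => congrArg (fun d : c.CutSide => d.1.1) e) (fun y hy hg => ?_)
    (fun y hy hg => ?_) (fun y hy hg => ?_)
  · have hglue : (c.cutGlue (c.keepStart y)).1 = (T.glue y, c.startsLeft (T.next (T.glue y))) := by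
      by_cases hc : c.Crosses y
      · rw [c.cutGlue_of_crosses (d := c.keepStart y) hc]
        refine Prod.ext rfl ?_
        change c.startsLeft y = _
        obtain ⟨n, hn, rfl | rfl⟩ := c.crosses_iff.1 hc
        · rw [c.startsLeft_sideAt hn, c.startsLeft_next_glue_sideAt hn]
        · rw [c.startsLeft_glue_sideAt hn, T.glue_glue, c.startsLeft_next_sideAt hn]
      · rw [c.keepStart_of_not_crosses hc, c.cutGlue_keep hc]
        refine Prod.ext rfl (c.startsLeft_next_of_not_crosses
          (fun e => hc (c.crosses_glue_iff.1 e)) ?_ ?_).symm <;> rwa [T.origin_next_glue hg, hy]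
    have h1 := congrArg Prod.fst hglue
    have h2 := congrArg Prod.snd hglue
    exact ⟨fun e => hg (h1.symm.trans (congrArg (fun d : c.CutSide => d.1.1) e)),
      Subtype.ext (Prod.ext (congrArg T.next h1) h2)⟩
  · have hc := c.not_crosses_of_boundary hg
    change c.cutGlue _ = _
    rw [c.keepStart_of_not_crosses hc, c.cutGlue_keep hc, hg]
  · exact c.cutGlue_of_boundary (d := c.cut.prev (c.keepStart y)) hg

end CrossingCurve

namespace IsTwicePuncturedDisk

variable {b : ℕ} {bd : ZMod b → D} {P Q : T.Vertex} (h : T.IsTwicePuncturedDisk bd P Q)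
include h

theorem cornerCount_unglue {x : D} (hx : T.origin x = P) (hx' : T.origin (T.next x) = Q)
    (i : ZMod b) :
    (T.unglue x).cornerCount ((T.unglue x).origin (bd i)) = T.cornerCount (T.origin (bd i)) := by
  have hb := h.boundary_bd i
  have hg := h.glue_ne_left hx
  have hne : ∀ y, T.origin y = T.origin (bd i) → ¬ (y = x ∨ y = T.glue x) := by
    rintro y hy (rfl | rfl)
    · exact h.ne_left hb (hy.symm.trans hx)
    · exact h.ne_right hb (by rw [← hy, T.origin_glue hg, hx'])
  have hne' : ∀ y, T.glue y = y → ¬ (y = x ∨ y = T.glue x) := by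
    rintro y hy (rfl | rfl)
    · exact hg hy
    · exact T.glue_glue_ne hg hy
  refine cornerCount_eq_of_map (T' := T.unglue x) id rfl (fun y z _ _ e => e) (fun y hy hgy => ?_)
    (fun y hy hgy => ?_) (fun y hy hgy => ?_)
  · simp only [unglue, id, if_neg (hne y hy)]
    exact ⟨hgy, trivial⟩
  · simp only [unglue, id, if_neg (hne y hy)]
    exact hgy
  · change (T.unglue x).glue (T.prev y) = T.prev y
    simp only [unglue, if_neg (hne' _ hgy)]
    exact hgy

theorem cornerCount_removeTriangle {x : D} (hx : ∀ y, T.SameTriangle x y → ¬ T.IsBoundaryVertex (T.origin y))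
    (hbd : ∀ i, ¬ T.SameTriangle x (bd i)) (i : ZMod b) :
    (T.removeTriangle x).cornerCount ((T.removeTriangle x).origin ⟨bd i, hbd i⟩) =
      T.cornerCount (T.origin (bd i)) := by
  classical
  have hb := h.boundary_bd i
  have hne : ∀ {y}, T.origin y = T.origin (bd i) → ¬ T.SameTriangle x y := fun {y} hy hs =>
    hx y hs (hy ▸ hb)
  -- The default value is irrelevant: no corner at a boundary vertex lies in the removed triangle.
  let φ : D → {y // ¬ T.SameTriangle x y} := fun y =>
    if hy : ¬ T.SameTriangle x y then ⟨y, hy⟩ else ⟨bd i, hbd i⟩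
  have hφ : ∀ {y} (hy : ¬ T.SameTriangle x y), φ y = ⟨y, hy⟩ := fun hy => dif_pos hy
  rw [← hφ]
  refine cornerCount_eq_of_map (T' := T.removeTriangle x) φ rfl (fun y z hy hz e => ?_)
    (fun y hy hgy => ?_) (fun y hy hgy => ?_) (fun y hy hgy => ?_)
  · rw [hφ (hne hy), hφ (hne hz)] at e
    exact congrArg Subtype.val e
  · have ho : T.origin (T.next (T.glue y)) = T.origin (bd i) := (T.origin_next_glue hgy).trans hy
    have hgs : ¬ T.SameTriangle x (T.glue y) := fun e => hne ho e.next
    rw [hφ (hne hy), hφ (hne ho)]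
    simp only [removeTriangle, hgs, not_false_eq_true, dif_pos]
    exact ⟨fun e => hgy (congrArg Subtype.val e), trivial⟩
  · rw [hφ (hne hy)]
    simp only [removeTriangle, hgy, hne hy, not_false_eq_true, dif_pos]
  · have hps : ¬ T.SameTriangle x (T.prev y) := fun e => hne hy (by
      have := e.next
      rwa [T.next_prev] at this)
    rw [hφ (hne hy)]
    change (T.removeTriangle x).glue ⟨T.prev y, hps⟩ = ⟨T.prev y, hps⟩
    simp only [removeTriangle, hgy, hps, not_false_eq_true, dif_pos]

end IsTwicePuncturedDisk

end TriangulatedSurface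

/-! ### Submodules of string modules -/

section Representations

variable (k : Type v) [Field k] {V : Type u}

theorem thinSpace_eq_bot_of_notMem {S : Set V} {v : V} (hv : v ∉ S)
    (N : Submodule k (thinSpace k S v)) : N = ⊥ :=
  (Submodule.eq_bot_iff N).2 fun x _ => Subtype.ext (x.2 hv)

theorem eq_top_of_ne_bot {S : Set V} {v : V} {N : Submodule k (thinSpace k S v)} (hN : N ≠ ⊥) :
    N = ⊤ := by
  obtain ⟨m, hm, hm0⟩ := Submodule.exists_mem_ne_zero_of_ne_bot hN
  have hm1 : m.1 ≠ 0 := fun e => hm0 (Subtype.ext e)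
  refine Submodule.eq_top_iff'.2 fun x => ?_
  have : x = (x.1 / m.1) • m := Subtype.ext (by
    change x.1 = x.1 / m.1 * m.1
    rw [div_mul_cancel₀ _ hm1])
  rw [this]
  exact N.smul_mem _ hm

open Classical in
/-- Submodules of a module given by a subquiver correspond to sets of vertices which are closed
under its arrows. -/
theorem numSubrep_subquiverModule [Quiver.{w} V] (S : Set V) (A : ∀ v w : V, (v ⟶ w) → Prop) :
    numSubrep k (subquiverModule k S A) =
      Nat.card {X : Set V // X ⊆ S ∧ ∀ v w (f : v ⟶ w), A v w f → w ∈ S → v ∈ X → w ∈ X} := by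
  have hmap : ∀ {v w : V} (f : v ⟶ w) (m : thinSpace k S v),
      (thinMap k S v w (A v w f) m).1 = if A v w f ∧ w ∈ S then m.1 else 0 := fun f m => rfl
  change Nat.card {W : ∀ v : V, Submodule k (thinSpace k S v) //
    ∀ (v w : V) (f : v ⟶ w), ∀ m ∈ W v, thinMap k S v w (A v w f) m ∈ W w} = _
  refine Nat.card_congr
    { toFun := fun W => ⟨{v | (W.1 v : Submodule k (thinSpace k S v)) ≠ ⊥}, fun v hv => ?_,
        fun v w f hA hw hv => ?_⟩
      invFun := fun X => ⟨fun v => (if v ∈ X.1 then ⊤ else ⊥ : Submodule k (thinSpace k S v)),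
        fun v w f m hm => ?_⟩
      left_inv := fun W => Subtype.ext (funext fun v => ?_)
      right_inv := fun X => Subtype.ext (Set.ext fun v => ?_) }
  · by_contra hvS
    exact hv (thinSpace_eq_bot_of_notMem k hvS _)
  · obtain ⟨m, hm, hm0⟩ := Submodule.exists_mem_ne_zero_of_ne_bot hv
    refine (Submodule.ne_bot_iff _).2 ⟨_, W.2 v w f m hm, fun e => hm0 (Subtype.ext ?_)⟩
    have := hmap f m
    rw [if_pos ⟨hA, hw⟩] at this
    rw [← this]
    exact congrArg Subtype.val e
  · by_cases hw : w ∈ X.1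
    · simp only [if_pos hw]
      exact Submodule.mem_top
    · simp only [if_neg hw]
      refine (Submodule.mem_bot k).2 (Subtype.ext ((hmap f m).trans ?_))
      by_cases hA : A v w f ∧ w ∈ S
      · have hv : v ∉ X.1 := fun e => hw (X.2.2 v w f hA.1 hA.2 e)
        simp only [if_neg hv] at hm
        rw [if_pos hA, (Submodule.mem_bot k).1 hm]
        rfl
      · rw [if_neg hA]
        rfl
  · by_cases hv : W.1 v = ⊥
    · exact (if_neg (not_not.2 hv)).trans hv.symm
    · exact (if_pos hv).trans (eq_top_of_ne_bot k hv).symm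
  · change (if v ∈ X.1 then ⊤ else ⊥ : Submodule k (thinSpace k S v)) ≠ ⊥ ↔ v ∈ X.1
    by_cases hv : v ∈ X.1
    · rw [if_pos hv]
      refine ⟨fun _ => hv, fun _ => (Submodule.ne_bot_iff _).2
        ⟨⟨1, fun e => absurd (X.2.1 hv) e⟩, Submodule.mem_top, fun e => ?_⟩⟩
      exact one_ne_zero (congrArg Subtype.val e)
    · rw [if_neg hv]
      exact ⟨fun e => absurd rfl e, fun e => absurd e hv⟩

end Representations

/-! ### Counting the closed sets of a zigzag by transfer matrices. -/

namespace TriangulatedSurface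

/-- The set of the indices marked `true` is closed under the arrows `i → i + 1` for `d i = true`
and `i + 1 → i` for `d i = false`. -/
def ZigzagClosed (d : ℕ → Bool) (m : ℕ) (χ : Fin (m + 1) → Bool) : Prop :=
  ∀ i : Fin m, (d i = true → χ i.castSucc = true → χ i.succ = true) ∧
    (d i = false → χ i.succ = true → χ i.castSucc = true)

/-- The number of closed sets which contain, or do not contain, the last index. -/
noncomputable def zigzagCount (d : ℕ → Bool) (m : ℕ) (v : Bool) : ℕ :=
  Nat.card {χ : {χ // ZigzagClosed d m χ} // χ.1 (Fin.last m) = v}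

theorem card_zigzagClosed (d : ℕ → Bool) (m : ℕ) :
    Nat.card {χ // ZigzagClosed d m χ} = zigzagCount d m true + zigzagCount d m false := by
  rw [← Nat.card_congr (Equiv.sigmaFiberEquiv
    fun χ : {χ // ZigzagClosed d m χ} => χ.1 (Fin.last m)), Nat.card_sigma, Fintype.sum_bool]
  rfl

theorem zigzagClosed_succ_iff (d : ℕ → Bool) (m : ℕ) (χ : Fin (m + 2) → Bool) :
    ZigzagClosed d (m + 1) χ ↔ ZigzagClosed d m (Fin.init χ) ∧
      (d m = true → χ (Fin.last m).castSucc = true → χ (Fin.last (m + 1)) = true) ∧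
      (d m = false → χ (Fin.last (m + 1)) = true → χ (Fin.last m).castSucc = true) := by
  rw [ZigzagClosed, Fin.forall_fin_succ']
  rfl

theorem zigzagCount_succ (d : ℕ → Bool) (m : ℕ) (v : Bool) :
    zigzagCount d (m + 1) v = Nat.card {χ : {χ // ZigzagClosed d m χ} //
      (d m = true → χ.1 (Fin.last m) = true → v = true) ∧
        (d m = false → v = true → χ.1 (Fin.last m) = true)} := by
  refine Nat.card_congr
    { toFun := fun χ => ⟨⟨Fin.init χ.1.1, ((zigzagClosed_succ_iff d m _).1 χ.1.2).1⟩, ?_⟩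
      invFun := fun χ => ⟨⟨Fin.snoc (α := fun _ => Bool) χ.1.1 v, ?_⟩, ?_⟩
      left_inv := fun χ => Subtype.ext (Subtype.ext ?_)
      right_inv := fun χ => Subtype.ext (Subtype.ext ?_) }
  · have := ((zigzagClosed_succ_iff d m _).1 χ.1.2).2
    rw [χ.2] at this
    exact this
  · rw [zigzagClosed_succ_iff, Fin.init_snoc, Fin.snoc_last, Fin.snoc_castSucc]
    exact ⟨χ.1.2, χ.2⟩
  · exact Fin.snoc_last (α := fun _ => Bool) _ _
  · obtain ⟨χ, rfl⟩ := χ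
    exact Fin.snoc_init_self (α := fun _ => Bool) _
  · exact Fin.init_snoc (α := fun _ => Bool) _ _

/-- The counts with last index unmarked and marked are the two column sums. An arrow to the new
index restricts only the unmarked choice, an arrow from it only the marked one; these are the two
elementary column operations. -/
theorem zigzagCount_eq (d : ℕ → Bool) (m : ℕ) :
    (zigzagCount d m false : ℤ) = turnProd d m 0 0 + turnProd d m 1 0 ∧
      (zigzagCount d m true : ℤ) = turnProd d m 0 1 + turnProd d m 1 1 := by
  induction m with
  | zero =>
    have : ∀ v, zigzagCount d 0 v = 1 := by
      intro v
      rw [zigzagCount, Nat.card_eq_one_iff_unique]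
      refine ⟨⟨fun χ ψ => Subtype.ext (Subtype.ext (funext fun i => ?_))⟩,
        ⟨⟨⟨fun _ => v, fun i => i.elim0⟩, rfl⟩⟩⟩
      rw [show i = Fin.last 0 from Fin.ext (by omega), χ.2, ψ.2]
    simp [this, turnProd]
  | succ m ih =>
    have hall : ∀ {p : {χ // ZigzagClosed d m χ} → Prop}, (∀ χ, p χ) →
        Nat.card {χ // p χ} = zigzagCount d m true + zigzagCount d m false := by
      intro p hp
      rw [← card_zigzagClosed]
      exact Nat.card_congr (Equiv.subtypeUnivEquiv hp)
    have hval : ∀ {p : {χ // ZigzagClosed d m χ} → Prop} (v : Bool),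
        (∀ χ, p χ ↔ χ.1 (Fin.last m) = v) → Nat.card {χ // p χ} = zigzagCount d m v :=
      fun v hp => Nat.card_congr (Equiv.subtypeEquivRight hp)
    rw [zigzagCount_succ, zigzagCount_succ, turnProd]
    cases hd : d m
    · rw [hall (by simp), hval true (by simp)]
      simp only [turnMatrix, Matrix.mul_apply, Fin.sum_univ_two]
      simp
      constructor <;> linarith [ih.1, ih.2]
    · rw [hval false (by simp), hall (by simp)]
      simp only [turnMatrix, Matrix.mul_apply, Fin.sum_univ_two]
      simp
      constructor <;> linarith [ih.1, ih.2]

theorem card_zigzagClosed_eq (d : ℕ → Bool) (m : ℕ) :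
    (Nat.card {χ // ZigzagClosed d m χ} : ℤ) = entrySum (turnProd d m) := by
  rw [card_zigzagClosed, Nat.cast_add, (zigzagCount_eq d m).1, (zigzagCount_eq d m).2, entrySum]
  ring

variable {D : Type u} {T : TriangulatedSurface D}

theorem numSubrep_stringModule (k : Type v) [Field k] (C : Set D) :
    numSubrep k (T.stringModule k C) = Nat.card {X : Set T.Arc //
      X ⊆ {α | ∃ x ∈ C, T.edge x = α.1} ∧
        ∀ (v w : T.Arc) (x : D), T.edge (T.prev x) = v.1 → T.edge x = w.1 → x ∈ C →
          T.prev x ∈ C → v ∈ X → w ∈ X} := by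
  refine (numSubrep_subquiverModule k _ _).trans (Nat.card_congr (Equiv.subtypeEquivRight
    fun X => and_congr_right fun _ => ⟨fun h v w x hv hw hx hx' => ?_, fun h v w f hA _ => ?_⟩))
  · exact h v w ⟨x, hv, hw⟩ ⟨hx, hx'⟩ ⟨x, hx, hw⟩
  · exact h v w f.1 f.2.1 f.2.2 hA.1 hA.2

theorem numSubrep_stringModule_empty (k : Type v) [Field k] :
    numSubrep k (T.stringModule k ∅) = 1 := by
  rw [numSubrep_stringModule, Nat.card_eq_one_iff_unique]
  refine ⟨⟨fun X Y => Subtype.ext ?_⟩, ⟨⟨∅, Set.empty_subset _, fun _ _ _ _ _ hx => absurd hx id⟩⟩⟩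
  have : ∀ Z : Set T.Arc, Z ⊆ {α | ∃ x ∈ (∅ : Set D), T.edge x = α.1} → Z = ∅ := fun Z hZ =>
    Set.eq_empty_of_forall_notMem fun α hα => by
      obtain ⟨x, hx, -⟩ := hZ hα
      exact hx
  rw [this X.1 X.2.1, this Y.1 Y.2.1]

namespace CrossingCurve

variable {P Q : T.Vertex} (c : T.CrossingCurve P Q)

/-- Because no triangle is visited twice, two crossed sides of one triangle are consecutive along
the curve. Hence the string module has only the zigzag arrows, directed by the turns. -/
theorem crosses_pair {y : D} (h1 : c.Crosses y) (h2 : c.Crosses (T.prev y)) :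
    ∃ n < c.m, c.turn n = true ∧ y = c.sideAt (n + 1) ∧ T.prev y = T.glue (c.sideAt n) ∨
      c.turn n = false ∧ y = T.glue (c.sideAt n) ∧ T.prev y = c.sideAt (n + 1) := by
  have hs : T.SameTriangle y (T.prev y) := (T.sameTriangle_refl y).prev
  obtain ⟨i, hi, e1 | e1⟩ := c.crosses_iff.1 h1 <;> obtain ⟨j, hj, e2 | e2⟩ := c.crosses_iff.1 h2 <;>
    rw [e2] at hs <;> nth_rw 1 [e1] at hs
  · obtain rfl := c.distinct_sideAt hi hj hs
    exact absurd (e2.trans e1.symm) (T.prev_ne y)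
  · obtain ⟨hlt, rfl⟩ := c.sideAt_glue hi hj hs
    refine ⟨j, hlt, Or.inl ⟨?_, e1, e2⟩⟩
    simp only [turn, decide_eq_true_eq]
    rw [← e1, ← e2, T.next_prev]
  · obtain ⟨hlt, rfl⟩ := c.sideAt_glue hj hi hs.symm
    refine ⟨i, hlt, Or.inr ⟨?_, e1, e2⟩⟩
    simp only [turn, decide_eq_false_iff_not]
    rw [← e1, ← e2]
    exact T.prev_ne_next y
  · obtain rfl := c.glue_sideAt_glue hi hj hs
    exact absurd (e2.trans e1.symm) (T.prev_ne y)

/-- The half of a crossed side on the side `s` of the curve. -/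
noncomputable def half {x : D} (hx : c.Crosses x) (s : Bool) : c.CutSide :=
  ⟨(x, s), Or.inl ⟨x, hx, T.sameTriangle_refl x⟩⟩

theorem cut_glue_half {x : D} (hx : c.Crosses x) (s : Bool) :
    c.cut.glue (c.half hx s) = c.half (c.crosses_glue hx) s :=
  Subtype.ext (c.cutGlue_of_crosses (d := c.half hx s) hx)

theorem edge_half_glue {x y : D} (hx : c.Crosses x) (hy : c.Crosses y) (hxy : y = T.glue x)
    (s : Bool) : c.cut.edge (c.half hy s) = c.cut.edge (c.half hx s) := by
  subst hxy
  rw [← c.cut_glue_half hx, edge_glue]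

/-- The half on the side `s` of the curve of the arc which is crossed as number `n`. -/
noncomputable def halfArc (s : Bool) (n : ℕ) : c.cut.Arc :=
  ⟨c.cut.edge (c.half (c.crosses_sideAt n) s), c.half (c.crosses_sideAt n) s, by
    rw [c.cut_glue_half]
    exact fun e => c.glue_sideAt_ne n (congrArg (fun d : c.CutSide => d.1.1) e), rfl⟩

theorem halfArc_injective {s : Bool} {i j : ℕ} (hi : i ≤ c.m) (hj : j ≤ c.m)
    (hij : c.halfArc s i = c.halfArc s j) : i = j := by
  rcases edge_eq_iff.1 (congrArg Subtype.val hij) with e | e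
  · have : c.sideAt j = c.sideAt i := congrArg (fun d : c.CutSide => d.1.1) e
    exact (c.distinct_sideAt hj hi (by rw [this]; exact T.sameTriangle_refl _)).symm
  · rw [c.cut_glue_half] at e
    exact absurd (congrArg (fun d : c.CutSide => d.1.1) e).symm (c.glue_sideAt_ne_sideAt hi hj)

theorem exists_halfArc {s : Bool} {d : c.CutSide} (hd : c.Crosses d.1.1) (hs : d.1.2 = s) :
    ∃ n ≤ c.m, (c.halfArc s n).1 = c.cut.edge d := by
  obtain ⟨n, hn, e⟩ := c.crosses_iff.1 hd
  refine ⟨n, hn, ?_⟩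
  have hd' : d = c.half hd s := Subtype.ext (Prod.ext rfl hs)
  rw [hd']
  rcases e with e | e
  · exact congrArg c.cut.edge (Subtype.ext (Prod.ext e.symm rfl))
  · exact (c.edge_half_glue _ _ e s).symm

/-- Both halves of a crossed triangle inherit its angle between the two crossed sides, so the two
string modules have the same zigzag shape, whatever `s` is. -/
theorem numSubrep_cut (k : Type v) [Field k] (s : Bool) :
    (numSubrep k (c.cut.stringModule k {d : c.CutSide | c.Crosses d.1.1 ∧ d.1.2 = s}) : ℤ) =
      c.turnSum := by
  classical
  rw [numSubrep_stringModule, turnSum, ← card_zigzagClosed_eq, Nat.cast_inj]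
  have hedge : ∀ {n : ℕ} {d : c.CutSide}, d.1.2 = s →
      (d.1.1 = c.sideAt n ∨ d.1.1 = T.glue (c.sideAt n)) → c.cut.edge d = (c.halfArc s n).1 := by
    intro n d hs e
    rcases e with e | e
    · exact congrArg c.cut.edge (Subtype.ext (Prod.ext e hs))
    · have hd : c.Crosses d.1.1 := e ▸ c.crosses_glue (c.crosses_sideAt n)
      have hd' : d = c.half hd s := Subtype.ext (Prod.ext rfl hs)
      rw [hd']
      exact c.edge_half_glue _ _ e s
  refine Nat.card_congr (Equiv.ofBijective (fun X => ⟨fun i => decide (c.halfArc s i ∈ X.1),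
    fun i => ⟨fun ht h1 => ?_, fun ht h1 => ?_⟩⟩) ⟨fun X Y hXY => Subtype.ext ?_, fun χ => ?_⟩)
  · rw [decide_eq_true_eq] at h1 ⊢
    have e := c.turn_eq_true ht
    have e' : T.prev (c.sideAt (i + 1)) = T.glue (c.sideAt i) := by rw [e, T.prev_next]
    have hc := c.crosses_sideAt (i + 1)
    have hc' : c.Crosses (T.prev (c.sideAt (i + 1))) :=
      e' ▸ c.crosses_glue (c.crosses_sideAt i)
    exact X.2.2 _ _ (c.half hc s) (hedge (d := c.cut.prev (c.half hc s)) rfl (Or.inr e'))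
      rfl ⟨hc, rfl⟩ ⟨hc', rfl⟩ h1
  · rw [decide_eq_true_eq] at h1 ⊢
    have e := c.turn_eq_false i.2 ht
    have hc := c.crosses_glue (c.crosses_sideAt i)
    have hc' : c.Crosses (T.prev (T.glue (c.sideAt i))) := e ▸ c.crosses_sideAt (i + 1)
    exact X.2.2 _ _ (c.half hc s) (hedge (d := c.cut.prev (c.half hc s)) rfl (Or.inl e.symm))
      (hedge rfl (Or.inr rfl)) ⟨hc, rfl⟩ ⟨hc', rfl⟩ h1
  · have hmem : ∀ n ≤ c.m, (c.halfArc s n ∈ X.1 ↔ c.halfArc s n ∈ Y.1) := by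
      intro n hn
      have := congrFun (congrArg Subtype.val hXY) ⟨n, Nat.lt_succ_of_le hn⟩
      exact decide_eq_decide.1 this
    have hex : ∀ α : c.cut.Arc, (α ∈ X.1 ∨ α ∈ Y.1) → ∃ n ≤ c.m, α = c.halfArc s n := by
      intro α hα
      obtain ⟨d, hd, hα⟩ : ∃ d ∈ {d : c.CutSide | c.Crosses d.1.1 ∧ d.1.2 = s},
          c.cut.edge d = α.1 := hα.elim (fun h => X.2.1 h) (fun h => Y.2.1 h)
      obtain ⟨n, hn, e⟩ := c.exists_halfArc hd.1 hd.2
      exact ⟨n, hn, Subtype.ext (e.trans hα).symm⟩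
    ext α
    constructor
    · intro hα
      obtain ⟨n, hn, rfl⟩ := hex α (Or.inl hα)
      exact (hmem n hn).1 hα
    · intro hα
      obtain ⟨n, hn, rfl⟩ := hex α (Or.inr hα)
      exact (hmem n hn).2 hα
  · have hval : ∀ i : Fin (c.m + 1), (∃ j : Fin (c.m + 1), c.halfArc s i = c.halfArc s j ∧
        χ.1 j = true) ↔ χ.1 i = true := by
      intro i
      constructor
      · rintro ⟨j, e, hj⟩
        rwa [Fin.ext (c.halfArc_injective (by omega) (by omega) e)]
      · exact fun hi => ⟨i, rfl, hi⟩
    refine ⟨⟨{α | ∃ j : Fin (c.m + 1), α = c.halfArc s j ∧ χ.1 j = true}, ?_, ?_⟩,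
      Subtype.ext (funext fun i => ?_)⟩
    · rintro _ ⟨j, rfl, -⟩
      exact ⟨_, ⟨c.crosses_sideAt j, rfl⟩, rfl⟩
    · rintro v w x hv hw hx hx' ⟨j, rfl, hj⟩
      obtain ⟨n, hn, ⟨ht, e1, e2⟩ | ⟨ht, e1, e2⟩⟩ := c.crosses_pair (y := x.1.1) hx.1 hx'.1
      · have h1 := (hedge (d := c.cut.prev x) hx'.2 (Or.inr e2)).symm.trans hv
        have h2 := (hedge hx.2 (Or.inl e1)).symm.trans hw
        have hj' := c.halfArc_injective (by omega) (by omega) (Subtype.ext h1)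
        obtain rfl : j = (⟨n, hn⟩ : Fin c.m).castSucc := Fin.ext hj'.symm
        exact ⟨(⟨n, hn⟩ : Fin c.m).succ, Subtype.ext h2.symm, (χ.2 ⟨n, hn⟩).1 ht hj⟩
      · have h1 := (hedge (d := c.cut.prev x) hx'.2 (Or.inl e2)).symm.trans hv
        have h2 := (hedge hx.2 (Or.inr e1)).symm.trans hw
        have hj' := c.halfArc_injective (by omega) (by omega) (Subtype.ext h1)
        obtain rfl : j = (⟨n, hn⟩ : Fin c.m).succ := Fin.ext hj'.symm
        exact ⟨(⟨n, hn⟩ : Fin c.m).castSucc, Subtype.ext h2.symm, (χ.2 ⟨n, hn⟩).2 ht hj⟩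
    · refine Bool.eq_iff_iff.2 ?_
      exact (@decide_eq_true_iff _ (Classical.propDecidable _)).trans (hval i)

end CrossingCurve

end TriangulatedSurface

/-! ### The main theorem, from the three cases. -/

theorem mainTheorem2 {D : Type u} [Finite D] (T : TriangulatedSurface D) {b : ℕ} (hb : 1 ≤ b)
    (bd : ZMod b → D) (P Q : T.Vertex) (hT : T.IsTwicePuncturedDisk bd P Q)
    (hper : ∀ x, ¬ T.IsPeripheral x) (k : Type v) [Field k] :
    (∃ A : CutSurface.{u} b, T.IsAssociatedAnnulus bd P Q A) ∧
      ∀ A : CutSurface.{u} b, T.IsAssociatedAnnulus bd P Q A →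
        (∀ i, A.quiddity i = T.cornerCount (T.origin (bd i))) ∧
        A.rho k true = A.rho k false ∧
        (∃! F : ℕ → ℤ → ℤ, IsFriezeOf A.quiddity F) ∧
        ∀ F : ℕ → ℤ → ℤ, IsFriezeOf A.quiddity F →
          HasGrowthCoefficient F b
            ((A.rho k true : ℤ) ^ 2 * T.cornerCount P * T.cornerCount Q - 2) := by
  have : NeZero b := ⟨by omega⟩
  refine ⟨hT.exists_associatedAnnulus hper, fun A hA => ?_⟩
  -- The word trace is the same at every boundary corner, so one convenient corner suffices in each
  -- case.
  suffices h : (∀ i, A.quiddity i = T.cornerCount (T.origin (bd i))) ∧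
      A.rho k true = A.rho k false ∧ ∃ s, T.IsBoundaryVertex (T.origin s) ∧
        T.wordTrace s = (A.rho k true : ℤ) ^ 2 * T.cornerCount P * T.cornerCount Q - 2 by
    obtain ⟨h1, h2, s, hs, hw⟩ := h
    have hq : A.quiddity = fun i => T.cornerCount (T.origin (bd i)) := funext h1
    refine ⟨h1, h2, exists_unique_frieze hb (fun i => ?_) fun i => ?_⟩
    · rw [h1]
      exact hT.two_le_cornerCount hper i
    · rw [hq, hT.trace_continuantProd hs, hw]
  cases hA with
  | noArc hno c =>
    have hrho : ∀ s, ((c.cutSurface bd).rho k s : ℤ) = c.turnSum := fun s => c.numSubrep_cut k s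
    refine ⟨fun i => c.cornerCount_cut (hT.glue_bd i) (hT.ne_left (hT.boundary_bd i))
      (hT.ne_right (hT.boundary_bd i)), ?_, c.sideAt 0, (hT.boundary_sideAt_zero hno c).1, ?_⟩
    · have := (hrho true).trans (hrho false).symm
      exact_mod_cast this
    · rw [hrho, hT.wordTrace_of_curve hper hno c]
  | arc x hx hx' hP hQ =>
    have hl := hT.noLoops_of_joined hP hQ
    refine ⟨fun i => hT.cornerCount_unglue hx hx' i, rfl, T.prev x, hT.apex_boundary hl hx hx', ?_⟩
    rw [hT.wordTrace_of_arc hper hl hx hx', CutSurface.rho,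
      TriangulatedSurface.numSubrep_stringModule_empty]
    norm_num
  | selfFolded x hx hPQ hbd =>
    have hsym : ∀ {X Y : T.Vertex}, T.IsTwicePuncturedDisk bd X Y → T.origin x = X →
        T.origin (T.next x) = Y → ∀ y, T.SameTriangle x y → ¬ T.IsBoundaryVertex (T.origin y) := by
      intro X Y h ox oy y hy hb'
      rcases hy with rfl | rfl | rfl
      · exact h.ne_left hb' ox
      · exact h.ne_right hb' oy
      · refine h.ne_left hb' ?_
        rw [← T.next_next, ← hx, T.origin_next_glue (h.glue_ne_left ox), ox]
    have hint : ∀ y, T.SameTriangle x y → ¬ T.IsBoundaryVertex (T.origin y) := by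
      rcases hPQ with ⟨o1, o2⟩ | ⟨o1, o2⟩
      exacts [hsym hT o1 o2, hsym hT.symm o1 o2]
    refine ⟨fun i => hT.cornerCount_removeTriangle hint hbd i, rfl, ?_⟩
    rw [CutSurface.rho, TriangulatedSurface.numSubrep_stringModule_empty]
    rcases hPQ with ⟨o1, o2⟩ | ⟨o1, o2⟩
    · obtain ⟨s, h1, h2⟩ := hT.wordTrace_of_selfFolded hper hx o1 o2
      exact ⟨s, h1, by rw [h2]; norm_num⟩
    · obtain ⟨s, h1, h2⟩ := hT.symm.wordTrace_of_selfFolded hper hx o1 o2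
      exact ⟨s, h1, by rw [h2]; ring⟩
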